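/- \textbf{Theorem (Energy identity).} Let $(M,g)$ be a compact oriented Riemannian $2$-manifold with (possibly empty) smooth boundary, with Gaussian curvature $K$ and area form $dV_g$, and let $SM$ be its unit tangent bundle, $\partial(SM)=\{(x,v)\in SM : x\in\partial M\}$. Let $X$ be the geodesic vector field on $SM$, let $V$ be the generator of the circle action on the fibres (rotation in the positive direction), and let $X_\perp:=[X,V]$. Let $d\Sigma^3$ be the volume form of the Riemannian metric on $SM$ for which $X,X_\perp,V$ are orthonormal, and write $$\langle u,w\rangle=\int_{SM}\langle u,w\rangle_{\mathbb C^n}\,d\Sigma^3,\qquad |u|^2=\langle u,u\rangle .$$ Let $\lambda\in C^\infty(M,\mathbb R)$ (the magnetic field being $\Omega=\lambda\,dV_g$). Let $A:TM\to\mathfrak u(n)$ be a unitary connection, that is, a smooth $1$-form on $M$ with values in the skew-Hermitian $n\times n$ matrices, and let $\Phi:M\to\mathfrak u(n)$ be a smooth map (a Higgs field). Let $F_A=dA+A\wedge A$, let $d_A\Phi=d\Phi+[A,\Phi]$, and let $\ast$ be the Hodge star, so that $F_A=(\ast F_A)\,dV_g$ and $(\ast\beta)(v)=-\beta(iv)$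 for a $1$-form $\beta$, where $iv$ is $v$ rotated by $+90^\circ$; functions and $1$-forms on $M$ are regarded as functions on $SM$. If $u:SM\to\mathbb C^n$ is a smooth function with $u|_{\partial(SM)}=0$, then \begin{align*} &|(X+\lambda V+A+\Phi)Vu|^2-\langle \ast F_A\,u,Vu\rangle-\operatorname{Re}\langle(\ast d_A\Phi)u,Vu\rangle-2\operatorname{Re}\langle\lambda Vu,\Phi u\rangle\\ &\qquad-\operatorname{Re}\langle\Phi u,(X+A+\Phi)u\rangle-\langle(K+X_\perp\lambda+\lambda^2)Vu,Vu\rangle\\ &=|V(X+\lambda V+A+\Phi)u|^2-|(X+\lambda V+A+\Phi)u|^2 . \end{align*} -/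

import Mathlib

open scoped Manifold ContDiff

noncomputable section

namespace MagneticSurface

/-- The model vector space of a surface. -/
abbrev Plane : Type := EuclideanSpace ℝ (Fin 2)

/-- The tangent bundle of a surface with (possibly empty) boundary. -/
abbrev TM (M : Type*) [TopologicalSpace M] [ChartedSpace (EuclideanHalfSpace 2) M]
    [IsManifold (𝓡∂ 2) ∞ M] : Type _ :=
  TangentBundle (𝓡∂ 2) M

/-- Smooth Riemannian metrics on the surface `M`. -/
abbrev Metric (M : Type*) [TopologicalSpace M] [ChartedSpace (EuclideanHalfSpace 2) M]
    [IsManifold (𝓡∂ 2) ∞ M] : Type _ :=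
  Bundle.ContMDiffRiemannianMetric (𝓡∂ 2) ∞ Plane (fun x : M => TangentSpace (𝓡∂ 2) x)

/-- The standard basis vector `e i` of the model space. -/
abbrev stdVec (i : Fin 2) : Plane := EuclideanSpace.single i (1 : ℝ)

/-- The partial derivative `∂f/∂yᵢ` at a point `y` of the model half plane
(one-sided across the edge of the half plane). -/
def pd {F : Type*} [NormedAddCommGroup F] [NormedSpace ℝ F]
    (i : Fin 2) (f : Plane → F) (y : Plane) : F :=
  fderivWithin ℝ f (Set.range (𝓡∂ 2)) y (stdVec i)

section Surface

variable {M : Type*} [TopologicalSpace M] [ChartedSpace (EuclideanHalfSpace 2) M]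
  [IsManifold (𝓡∂ 2) ∞ M]

/-! ### Orientation -/

/-- The sign of an orientation `o` of the tangent plane at `x`, relative to the coordinate basis of
the preferred chart at `x` (with respect to which `TangentSpace (𝓡∂ 2) x` is the plane). -/
def orientationSign {x : M} (o : Orientation ℝ (TangentSpace (𝓡∂ 2) x) (Fin 2)) : ℝ :=
  open Classical in
  if ((EuclideanSpace.basisFun (Fin 2) ℝ).toBasis.orientation : Orientation ℝ Plane (Fin 2)) = o
  then 1 else -1

variable (M) in
/-- An orientation of the surface `M`: an orientation of every tangent plane that depends
continuously on the point, i.e. near each `x₀` the coordinate basis of the chart at `x₀` has a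
constant sign with respect to it. (`tangentCoordChange _ x₀ x x` is the Jacobian at `x` of the
transition map from the chart at `x₀` to the preferred chart at `x`.) -/
structure SurfaceOrientation where
  /-- the orientation of the tangent plane at `x` -/
  orient : ∀ x : M, Orientation ℝ (TangentSpace (𝓡∂ 2) x) (Fin 2)
  continuous : ∀ x₀ : M, ∀ᶠ x in nhds x₀,
    0 < orientationSign (orient x₀) *
      (orientationSign (orient x) * (tangentCoordChange (𝓡∂ 2) x₀ x x).det)

/-! ### Local coordinates, Christoffel symbols, Gaussian curvature, area -/

/-- The coordinate vector `∂/∂yᵢ` at the point `x`, in the chart at `x₀`. -/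
def coordVec (x₀ : M) (i : Fin 2) (x : M) : TangentSpace (𝓡∂ 2) x :=
  (trivializationAt Plane (TangentSpace (𝓡∂ 2)) x₀).symmL ℝ x (stdVec i)

/-- The coefficient matrix `(gᵢⱼ)` of the metric in the chart at `x₀`, as a function of the
coordinates `y`. -/
def gMat (g : Metric M) (x₀ : M) (y : Plane) : Matrix (Fin 2) (Fin 2) ℝ :=
  Matrix.of fun i j =>
    g.inner ((extChartAt (𝓡∂ 2) x₀).symm y)
      (coordVec x₀ i ((extChartAt (𝓡∂ 2) x₀).symm y))
      (coordVec x₀ j ((extChartAt (𝓡∂ 2) x₀).symm y))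

/-- The Christoffel symbol `Γᵏᵢⱼ` of the Levi-Civita connection, in the chart at `x₀`. -/
def christoffel (g : Metric M) (x₀ : M) (k i j : Fin 2) (y : Plane) : ℝ :=
  (1 / 2) * ∑ l, (gMat g x₀ y)⁻¹ k l *
    (pd i (fun z => gMat g x₀ z j l) y + pd j (fun z => gMat g x₀ z i l) y
      - pd l (fun z => gMat g x₀ z i j) y)

/-- The component `Rˡₖᵢⱼ` of the curvature tensor in the chart at `x₀`:
`R(∂ᵢ, ∂ⱼ)∂ₖ = ∑ₗ Rˡₖᵢⱼ ∂ₗ`. -/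
def riemann (g : Metric M) (x₀ : M) (l k i j : Fin 2) (y : Plane) : ℝ :=
  pd i (christoffel g x₀ l j k) y - pd j (christoffel g x₀ l i k) y
    + ∑ m, (christoffel g x₀ l i m y * christoffel g x₀ m j k y
      - christoffel g x₀ l j m y * christoffel g x₀ m i k y)

/-- The Gaussian curvature `K = ⟨R(∂₀, ∂₁)∂₁, ∂₀⟩ / det g`. -/
def gaussCurv (g : Metric M) (x : M) : ℝ :=
  (∑ l, gMat g x (extChartAt (𝓡∂ 2) x x) 0 l * riemann g x l 1 0 1 (extChartAt (𝓡∂ 2) x x)) /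
    (gMat g x (extChartAt (𝓡∂ 2) x x)).det

/-- The Riemannian area measure. In the chart at `x₀` it is `√(det g) dy₀ dy₁`; these measures on the
chart domains agree on overlaps, and their supremum is the measure that they glue to. -/
def areaMeasure [MeasurableSpace M] (g : Metric M) : MeasureTheory.Measure M :=
  ⨆ x₀ : M, MeasureTheory.Measure.map (extChartAt (𝓡∂ 2) x₀).symm
    ((MeasureTheory.volume.restrict (extChartAt (𝓡∂ 2) x₀).target).withDensity
      fun y => ENNReal.ofReal (Real.sqrt (gMat g x₀ y).det))

/-- Rotation `v ↦ i v` of the tangent plane at `x` by `+90` degrees, for the metric `g` and the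
orientation `o`, written in the coordinates of the preferred chart at `x`. -/
def rot (g : Metric M) (o : SurfaceOrientation M) (x : M) (v : TangentSpace (𝓡∂ 2) x) :
    TangentSpace (𝓡∂ 2) x :=
  let G := gMat g x (extChartAt (𝓡∂ 2) x x)
  let c : Plane := v
  let w : Plane := (orientationSign (o.orient x) / Real.sqrt G.det) •
    !₂[-(G 0 1 * c 0 + G 1 1 * c 1), G 0 0 * c 0 + G 0 1 * c 1]
  w

/-! ### The unit tangent bundle and functions on it -/

/-- The unit tangent bundle `SM`. -/
def SM (g : Metric M) : Type _ := {p : TM M // g.inner p.1 p.2 p.2 = 1}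

/-- The unit vector `v / |v|`. -/
def normalize (g : Metric M) (p : TM M) (hp : p.2 ≠ 0) : SM g :=
  ⟨⟨p.1, (Real.sqrt (g.inner p.1 p.2 p.2))⁻¹ • p.2⟩, by
    have h := g.pos p.1 p.2 hp
    have h2 := Real.mul_self_sqrt h.le
    have h3 := (Real.sqrt_pos.2 h).ne'
    simp only [map_smul, smul_apply, smul_eq_mul]
    field_simp
    rw [sq, h2]⟩

/-- The extension `(x, v) ↦ u (x, v / |v|)` of a function on `SM` to the nonzero tangent vectors
(by `0` to the zero vectors). -/
def ext {F : Type*} [Zero F] (g : Metric M) (u : SM g → F) (p : TM M) : F :=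
  open Classical in if hp : p.2 ≠ 0 then u (normalize g p hp) else 0

variable {F : Type*} [NormedAddCommGroup F] [NormedSpace ℝ F]

/-- Smoothness (up to the boundary) of a function on the submanifold `SM` of `TM`: its extension
that is constant along the rays `(x, ℝ_{>0} v)` is smooth off the zero section. -/
def IsSmooth (g : Metric M) (u : SM g → F) : Prop :=
  ContMDiffOn (𝓡∂ 2).tangent 𝓘(ℝ, F) ∞ (ext g u) {p : TM M | p.2 ≠ 0}

/-- The vertical vector field `V`, the generator of the circle action
`(x, v) ↦ (x, cos t v + sin t i v)` on `SM`, acting on functions. -/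
def opV (g : Metric M) (o : SurfaceOrientation M) (u : SM g → F) (p : SM g) : F :=
  deriv (fun t : ℝ =>
    ext g u ⟨p.1.1, Real.cos t • p.1.2 + Real.sin t • rot g o p.1.1 p.1.2⟩) 0

/-- The value at `p = (x, v)` of the geodesic spray
`∑ₖ vₖ ∂/∂xₖ - ∑ᵢⱼₖ Γᵏᵢⱼ(x) vᵢ vⱼ ∂/∂vₖ`, in the coordinates of `TM` that are induced by the
preferred chart at `x`; these are the coordinates that identify the tangent space of `TM` at `p`
with `Plane × Plane`. -/
def spray (g : Metric M) (p : TM M) : TangentSpace (𝓡∂ 2).tangent p :=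
  let v : Plane := p.2
  let a : Plane := WithLp.toLp 2 fun k =>
    -∑ i, ∑ j, christoffel g p.1 k i j (extChartAt (𝓡∂ 2) p.1 p.1) * v i * v j
  ((v, a) : Plane × Plane)

/-- The geodesic vector field `X` acting on functions on `SM`. -/
def opX (g : Metric M) (u : SM g → F) (p : SM g) : F :=
  mfderiv (𝓡∂ 2).tangent 𝓘(ℝ, F) (ext g u) p.1 (spray g p.1)

/-- The commutator `X_⊥ = [X, V]`. -/
def opXperp (g : Metric M) (o : SurfaceOrientation M) (u : SM g → F) (p : SM g) : F :=
  opX g (opV g o u) p - opV g o (opX g u) p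

/-! ### Integration over `SM` -/

/-- A unit tangent vector at `x`. -/
def baseVec (g : Metric M) (x : M) : TangentSpace (𝓡∂ 2) x :=
  (Real.sqrt (g.inner x (coordVec x 0 x) (coordVec x 0 x)))⁻¹ • coordVec x 0 x

/-- The integral `∫ f dΣ³` over `SM`, for the volume form of the Riemannian metric on `SM` for which
`X`, `X_⊥`, `V` are orthonormal. At `(x, v)` the projection to `M` maps `X`, `X_⊥` to the orthonormal
pair `v`, `-i v` and kills `V`, which is the rotation field `∂/∂t` of the fibre; so this volume is the
product of the Riemannian area of `M` and of the angle `dt` in the fibres. -/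
def integralSM [MeasurableSpace M] (g : Metric M) (o : SurfaceOrientation M) (f : SM g → F) : F :=
  ∫ x, (∫ t in (0 : ℝ)..(2 * Real.pi),
    ext g f ⟨x, Real.cos t • baseVec g x + Real.sin t • rot g o x (baseVec g x)⟩) ∂(areaMeasure g)

/-- The `L²` inner product `⟨u, w⟩ = ∫ ⟨u, w⟩_{ℂⁿ} dΣ³`, linear in the first variable. -/
def pairing [MeasurableSpace M] {n : ℕ} (g : Metric M) (o : SurfaceOrientation M)
    (u w : SM g → EuclideanSpace ℂ (Fin n)) : ℂ :=
  integralSM g o fun p => inner ℂ (w p) (u p)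

/-- The squared `L²` norm `|u|² = ∫ |u|² dΣ³`. -/
def normSq [MeasurableSpace M] {n : ℕ} (g : Metric M) (o : SurfaceOrientation M)
    (u : SM g → EuclideanSpace ℂ (Fin n)) : ℝ :=
  integralSM g o fun p => ‖u p‖ ^ 2

/-! ### Connections and Higgs fields -/

variable (M) in
/-- A unitary connection on `M × ℂⁿ`: a smooth map `A : TM → 𝔲(n)`, linear on every tangent plane. -/
structure UnitaryConnection (n : ℕ) where
  /-- the matrix `A(x, v)` -/
  form : ∀ x : M, TangentSpace (𝓡∂ 2) x →ₗ[ℝ] Matrix (Fin n) (Fin n) ℂ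
  skew : ∀ (x : M) (v : TangentSpace (𝓡∂ 2) x), (form x v).conjTranspose = -form x v
  smooth : ∀ i j, ContMDiff (𝓡∂ 2).tangent 𝓘(ℝ, ℂ) ∞ fun p : TM M => form p.1 p.2 i j

variable (M) in
/-- A Higgs field: a smooth map `Φ : M → 𝔲(n)`. -/
structure HiggsField (n : ℕ) where
  /-- the matrix `Φ(x)` -/
  mat : M → Matrix (Fin n) (Fin n) ℂ
  skew : ∀ x : M, (mat x).conjTranspose = -mat x
  smooth : ∀ i j, ContMDiff (𝓡∂ 2) 𝓘(ℝ, ℂ) ∞ fun x : M => mat x i j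

variable {n : ℕ}

/-- The coefficient `A(∂/∂yᵢ)` of the connection in the chart at `x₀`. -/
def connCoord (A : UnitaryConnection M n) (x₀ : M) (i : Fin 2) (y : Plane) :
    Matrix (Fin n) (Fin n) ℂ :=
  A.form ((extChartAt (𝓡∂ 2) x₀).symm y) (coordVec x₀ i ((extChartAt (𝓡∂ 2) x₀).symm y))

/-- The function `⋆F_A` on `M`, where `F_A = dA + A ∧ A` is the curvature of the connection:
`F_A(∂₀, ∂₁) = ∂₀A₁ - ∂₁A₀ + [A₀, A₁]`, divided by `dV_g(∂₀, ∂₁) = ± √(det g)`. -/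
def starCurvature (g : Metric M) (o : SurfaceOrientation M) (A : UnitaryConnection M n) (x : M) :
    Matrix (Fin n) (Fin n) ℂ :=
  let y := extChartAt (𝓡∂ 2) x x
  (orientationSign (o.orient x) / Real.sqrt (gMat g x y).det) •
    ((Matrix.of fun a b =>
        pd 0 (fun z => connCoord A x 1 z a b) y - pd 1 (fun z => connCoord A x 0 z a b) y)
      + (connCoord A x 0 y * connCoord A x 1 y - connCoord A x 1 y * connCoord A x 0 y))

/-- The 1-form `d_A Φ = dΦ + [A, Φ]`. -/
def covDerivHiggs (A : UnitaryConnection M n) (Φ : HiggsField M n) (x : M)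
    (v : TangentSpace (𝓡∂ 2) x) : Matrix (Fin n) (Fin n) ℂ :=
  (Matrix.of fun a b => mfderiv (𝓡∂ 2) 𝓘(ℝ, ℂ) (fun z : M => Φ.mat z a b) x v)
    + (A.form x v * Φ.mat x - Φ.mat x * A.form x v)

/-- `⋆d_A Φ` as a function on `SM`; the Hodge star of a 1-form is `(⋆β)(v) = -β(i v)`. -/
def starCovDerivHiggs (g : Metric M) (o : SurfaceOrientation M) (A : UnitaryConnection M n)
    (Φ : HiggsField M n) (p : SM g) : Matrix (Fin n) (Fin n) ℂ :=
  -covDerivHiggs A Φ p.1.1 (rot g o p.1.1 p.1.2)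

/-- Pointwise multiplication of `u : SM → ℂⁿ` by a matrix-valued function on `SM`. -/
def mulMat (g : Metric M) (B : SM g → Matrix (Fin n) (Fin n) ℂ)
    (u : SM g → EuclideanSpace ℂ (Fin n)) (p : SM g) : EuclideanSpace ℂ (Fin n) :=
  WithLp.toLp 2 ((B p).mulVec (u p).ofLp)

/-- `Φ u`. -/
def opHiggs (g : Metric M) (Φ : HiggsField M n) (u : SM g → EuclideanSpace ℂ (Fin n)) :
    SM g → EuclideanSpace ℂ (Fin n) :=
  mulMat g (fun p => Φ.mat p.1.1) u

/-- `(X + A + Φ) u`. -/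
def opAttenuated (g : Metric M) (A : UnitaryConnection M n) (Φ : HiggsField M n)
    (u : SM g → EuclideanSpace ℂ (Fin n)) (p : SM g) : EuclideanSpace ℂ (Fin n) :=
  opX g u p + mulMat g (fun q => A.form q.1.1 q.1.2) u p + opHiggs g Φ u p

/-- `(X + λ V + A + Φ) u`. -/
def opMagnetic (g : Metric M) (o : SurfaceOrientation M) (lam : M → ℝ)
    (A : UnitaryConnection M n) (Φ : HiggsField M n)
    (u : SM g → EuclideanSpace ℂ (Fin n)) (p : SM g) : EuclideanSpace ℂ (Fin n) :=
  opX g u p + lam p.1.1 • opV g o u p + mulMat g (fun q => A.form q.1.1 q.1.2) u p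
    + opHiggs g Φ u p

/-- The function `K + X_⊥ λ + λ²` on `SM`. -/
def magneticCurv (g : Metric M) (o : SurfaceOrientation M) (lam : M → ℝ) (p : SM g) : ℝ :=
  gaussCurv g p.1.1 + opXperp g o (fun q : SM g => lam q.1.1) p + lam p.1.1 ^ 2

end Surface

end MagneticSurface

end

open scoped Manifold ContDiff

noncomputable section

namespace MagneticSurface

/-! ### Linear algebra of an oriented Euclidean plane -/

section PlaneAlgebra

/-! Write P = X + λV + A + Φ and H = [P, V]. Since λ and Φ are constant on fibres, H = X_⊥ − VA,
where VA is v ↦ A(iv). The identity is the Pestov integration-by-parts argument for the pair P, V,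
and it rests on two facts.

Commutators. The structure equations [X, V] = X_⊥, [V, X_⊥] = X and [X, X_⊥] = −KV, together with
V(VA) = −A and ⋆F_A = X_⊥A + X(VA) + [A, VA], give [V, H] = X + A (`opV_opComm_sub`) and [H, P] = (K
+ X_⊥λ)V − λ(X + A) + ⋆F_A + ⋆d_AΦ (`opComm_opMagnetic_sub`).

Adjoints. V is skew-adjoint because the fibres are closed circles. X is skew-adjoint when one of the
two functions vanishes over ∂M, because it preserves the measure (`integralSM_opX`). As A and Φ are
skew-Hermitian, P is skew-adjoint under the same condition, and so is its commutator H with V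
(`pairing_opComm`).

Now PVu = VPu + Hu, hence |PVu|² − |VPu|² = ⟨Hu, VPu⟩ + ⟨PVu, Hu⟩. Moving V off Pu and P off Vu,
then using [V, H] and the skew-adjointness of H, turns the right side into ⟨Vu, [H, P]u⟩ − ⟨(X +
A)u, Pu⟩. Adding |Pu|² and inserting Pu = (X + A)u + λVu + Φu cancels the terms that pair λVu with
(X + A)u and leaves the curvature terms (`energy_identity`). The theorem is the real part of this
identity.

All geometry is done in charts. A function on SM is extended to the nonzero tangent vectors by
homogeneity of degree zero, and X, X_⊥, V become vector fields on (chart domain) × (plane minus 0).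
`LocalGeometry` records what is used there: a metric, symmetric metric-compatible Christoffel
symbols and a rotation J by a right angle. Brackets are computed with symmetric second derivatives
within the chart domain, which remain available at boundary points. The transformation laws of the
metric, Γ and J show that the pointwise definitions, made in the preferred chart at each point,
agree with the expressions in any chart.

For the measure, let W_t be a rotating unit frame with connection form ω and ρ the area density. The
divergence of ρ U(W_t) W_t is ρ (XU + ∂_t(ω(W_t) U)) (`LocalGeometry.divergence_flux`). Integrated
over the angle the last term disappears; integrated over the chart the divergence disappears when U
has compact support and vanishes at the boundary. A partition of unity makes this global. -/

lemma plane_eq (a : Plane) : a = a 0 • stdVec 0 + a 1 • stdVec 1 := by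
  ext i; fin_cases i <;> simp

lemma stdVec_ne_zero (i : Fin 2) : stdVec i ≠ 0 := by
  intro h
  have := congrArg (fun v : Plane => v i) h
  simp at this

/-- `J` is rotation by a right angle for the inner product `G`. -/
structure IsRotation (G : Plane →L[ℝ] Plane →L[ℝ] ℝ) (J : Plane →L[ℝ] Plane) : Prop where
  symm : ∀ a b, G a b = G b a
  pos : ∀ a, a ≠ 0 → 0 < G a a
  sq : ∀ a, J (J a) = -a
  skew : ∀ a, G (J a) a = 0

variable {G : Plane →L[ℝ] Plane →L[ℝ] ℝ} {J : Plane →L[ℝ] Plane}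

/-- Polarization of the quadratic form G(Ba, a). -/
lemma bilin_antisymm_of_diag {B : Plane →L[ℝ] Plane} (hs : ∀ a b, G a b = G b a)
    (hB : ∀ a, G (B a) a = 0) (a b : Plane) : G (B a) b = -G a (B b) := by
  have h := hB (a + b)
  simp only [map_add, add_apply, hB] at h
  rw [hs a (B b)]
  linarith

namespace IsRotation

lemma antisymm (h : IsRotation G J) (a b : Plane) : G (J a) b = -G a (J b) :=
  bilin_antisymm_of_diag h.symm h.skew a b

lemma isometry (h : IsRotation G J) (a b : Plane) : G (J a) (J b) = G a b := by
  rw [h.antisymm, h.sq, map_neg, neg_neg]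

/-- `w` and `J w` are orthogonal and of equal nonzero length, hence independent, and the plane has
dimension two. -/
lemma mem_span (h : IsRotation G J) {w : Plane} (hw : w ≠ 0) (v : Plane) :
    ∃ α β : ℝ, α • w + β • J w = v := by
  have hli : LinearIndependent ℝ ![w, J w] := by
    rw [LinearIndependent.pair_iff]
    intro s t hst
    have hpos := h.pos w hw
    have h1 := congrArg (fun v => G v w) hst
    have h2 := congrArg (fun v => G v (J w)) hst
    simp only [map_add, map_smul, add_apply, smul_apply, smul_eq_mul, h.skew,
      map_zero, zero_apply, h.isometry, h.symm w (J w)] at h1 h2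
    constructor
    · nlinarith [mul_eq_zero.mp (show s * G w w = 0 by linarith)]
    · nlinarith [mul_eq_zero.mp (show t * G w w = 0 by linarith)]
  have htop := hli.span_eq_top_of_card_eq_finrank (by simp)
  have hv : v ∈ Submodule.span ℝ (Set.range ![w, J w]) := by rw [htop]; trivial
  rw [Matrix.range_cons, Matrix.range_cons, Matrix.range_empty, Set.union_empty,
    Set.singleton_union, Submodule.mem_span_pair] at hv
  exact hv

lemma expand (h : IsRotation G J) {w : Plane} (hw : w ≠ 0) (v : Plane) :
    G w w • v = G v w • w + G v (J w) • J w := by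
  obtain ⟨α, β, rfl⟩ := h.mem_span hw v
  simp only [map_add, map_smul, add_apply, smul_apply, smul_eq_mul, h.skew, h.isometry,
    h.symm w (J w)]
  module

/-- Skew endomorphisms of a Euclidean plane form a line, spanned by `J`. This is applied twice: to
the covariant derivative of `J`, and to the curvature endomorphism, which is thereby reduced to a
single scalar. -/
lemma exists_smul_of_diag (h : IsRotation G J) {B : Plane →L[ℝ] Plane}
    (hB : ∀ a, G (B a) a = 0) : ∃ μ : ℝ, ∀ v, B v = μ • J v := by
  set w : Plane := stdVec 0
  have hw : w ≠ 0 := stdVec_ne_zero 0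
  have hpos := h.pos w hw
  have hB' := bilin_antisymm_of_diag h.symm hB
  have h1 : B w = (G (B w) (J w) / G w w) • J w := by
    have := h.expand hw (B w)
    rw [hB, zero_smul, zero_add] at this
    rw [div_eq_inv_mul, mul_smul, ← this, smul_smul, inv_mul_cancel₀ hpos.ne', one_smul]
  have h2 : B (J w) = (G (B w) (J w) / G w w) • J (J w) := by
    have := h.expand hw (B (J w))
    rw [hB, zero_smul, add_zero, hB', h.symm (J w) (B w)] at this
    rw [h.sq, div_eq_inv_mul, mul_smul, smul_neg, ← neg_smul, ← this, smul_smul,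
      inv_mul_cancel₀ hpos.ne', one_smul]
  generalize G (B w) (J w) / G w w = μ at h1 h2
  refine ⟨μ, fun v => ?_⟩
  obtain ⟨α, β, rfl⟩ := h.mem_span hw v
  simp only [map_add, map_smul]
  rw [h2, h1]
  module

/-- The coefficient of the oriented area form. -/
lemma area_eq (h : IsRotation G J) (a b : Plane) :
    G (J a) b = G (J (stdVec 0)) (stdVec 1) * (a 0 * b 1 - a 1 * b 0) := by
  conv_lhs => rw [plane_eq a, plane_eq b]
  simp only [map_add, map_smul, add_apply, smul_apply, smul_eq_mul, h.skew,
    h.antisymm (stdVec 1) (stdVec 0), h.symm (stdVec 1) (J (stdVec 0))]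
  ring

/-- Expanding the second basis vector in the frame of the first and its rotation, and pairing the
result with the second vector, gives the Gram determinant. -/
lemma area_sq (h : IsRotation G J) :
    G (J (stdVec 0)) (stdVec 1) ^ 2 =
      G (stdVec 0) (stdVec 0) * G (stdVec 1) (stdVec 1) - G (stdVec 0) (stdVec 1) ^ 2 := by
  have := congrArg (fun v => G v (stdVec 1)) (h.expand (stdVec_ne_zero 0) (stdVec 1))
  simp only [map_add, map_smul, add_apply, smul_apply, smul_eq_mul] at this
  rw [h.symm (stdVec 1) (J (stdVec 0)), h.symm (stdVec 1) (stdVec 0)] at this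
  linarith

lemma area_ne_zero (h : IsRotation G J) : G (J (stdVec 0)) (stdVec 1) ≠ 0 := by
  intro h0
  have h1 := h.area_eq (stdVec 0) (J (stdVec 0))
  rw [h0, zero_mul, h.isometry] at h1
  exact (h.pos _ (stdVec_ne_zero 0)).ne' h1

end IsRotation

end PlaneAlgebra

/-! ### Lie brackets within a set -/

/-- The second-derivative terms cancel by symmetry, leaving the derivative of `U` along the Lie
bracket of the fields. Symmetry at a boundary point only requires that it be a limit of interior
points of the set. -/
lemma fderivWithin_bracket {E F : Type*} [NormedAddCommGroup E] [NormedSpace ℝ E]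
    [NormedAddCommGroup F] [NormedSpace ℝ F] {s : Set E} (hs : UniqueDiffOn ℝ s) {U : E → F}
    (hU : ContDiffOn ℝ ∞ U s) {z : E} (hz : z ∈ s) (hz' : z ∈ closure (interior s))
    {A B : E → E} {A' B' : E →L[ℝ] E} (hA : HasFDerivWithinAt A A' s z)
    (hB : HasFDerivWithinAt B B' s z) :
    fderivWithin ℝ (fun y => fderivWithin ℝ U s y (B y)) s z (A z)
      - fderivWithin ℝ (fun y => fderivWithin ℝ U s y (A y)) s z (B z)
      = fderivWithin ℝ U s z (B' (A z) - A' (B z)) := by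
  have hD : DifferentiableWithinAt ℝ (fderivWithin ℝ U s) s z :=
    ((hU.fderivWithin hs (m := 1) (by decide)) z hz).differentiableWithinAt one_ne_zero
  have hsymm : IsSymmSndFDerivWithinAt ℝ U s z :=
    (hU z hz).isSymmSndFDerivWithinAt (by simpa using WithTop.coe_le_coe.2 (le_top : (2 : ℕ∞) ≤ ⊤)) hs hz' hz
  rw [(hD.hasFDerivWithinAt.clm_apply hB).fderivWithin (hs z hz),
    (hD.hasFDerivWithinAt.clm_apply hA).fderivWithin (hs z hz)]
  simp only [add_apply, ContinuousLinearMap.comp_apply, ContinuousLinearMap.flip_apply, map_sub]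
  rw [hsymm (A z) (B z)]
  abel

/-! ### The geodesic flow in a coordinate chart -/

/-- The metric `G`, the Christoffel symbols `Γ` and the rotation by a right angle `J`
on a coordinate domain `T`. -/
structure LocalGeometry (T : Set Plane) (G : Plane → Plane →L[ℝ] Plane →L[ℝ] ℝ)
    (Γ : Plane → Plane →L[ℝ] Plane →L[ℝ] Plane) (J : Plane → Plane →L[ℝ] Plane) : Prop where
  uniqueDiff : UniqueDiffOn ℝ T
  dense : T ⊆ closure (interior T)
  smoothG : ContDiffOn ℝ ∞ G T
  smoothΓ : ContDiffOn ℝ ∞ Γ T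
  smoothJ : ContDiffOn ℝ ∞ J T
  rotation : ∀ y ∈ T, IsRotation (G y) (J y)
  symmΓ : ∀ y ∈ T, ∀ a b, Γ y a b = Γ y b a
  compat : ∀ y ∈ T, ∀ a b c, fderivWithin ℝ G T y a b c = G y (Γ y a b) c + G y b (Γ y a c)

/-- The curvature tensor of the Christoffel symbols `Γ`. -/
def curvTensor (T : Set Plane) (Γ : Plane → Plane →L[ℝ] Plane →L[ℝ] Plane) (y a b c : Plane) :
    Plane :=
  fderivWithin ℝ Γ T y a b c - fderivWithin ℝ Γ T y b a c + Γ y a (Γ y b c) - Γ y b (Γ y a c)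

/-- The nonzero tangent vectors over the coordinate domain `T`. -/
def punctured (T : Set Plane) : Set (Plane × Plane) := T ×ˢ {0}ᶜ

/-- The geodesic spray. -/
def sprayField (Γ : Plane → Plane →L[ℝ] Plane →L[ℝ] Plane) (z : Plane × Plane) : Plane × Plane :=
  (z.2, -Γ z.1 z.2 z.2)

/-- The horizontal lift of the rotated vector. -/
def horField (Γ : Plane → Plane →L[ℝ] Plane →L[ℝ] Plane) (J : Plane → Plane →L[ℝ] Plane)
    (z : Plane × Plane) : Plane × Plane :=
  (J z.1 z.2, -Γ z.1 z.2 (J z.1 z.2))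

/-- The generator of the rotation of the fibres. -/
def vertField (J : Plane → Plane →L[ℝ] Plane) (z : Plane × Plane) : Plane × Plane :=
  (0, J z.1 z.2)

/-- The length of a tangent vector. -/
def len (G : Plane → Plane →L[ℝ] Plane →L[ℝ] ℝ) (z : Plane × Plane) : ℝ :=
  Real.sqrt (G z.1 z.2 z.2)

section Operators

variable {F : Type*} [NormedAddCommGroup F] [NormedSpace ℝ F]

/-- The geodesic vector field acting on functions that are constant along rays. -/
def locX (T : Set Plane) (G : Plane → Plane →L[ℝ] Plane →L[ℝ] ℝ)
    (Γ : Plane → Plane →L[ℝ] Plane →L[ℝ] Plane) (U : Plane × Plane → F) (z : Plane × Plane) : F :=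
  (len G z)⁻¹ • fderivWithin ℝ U (punctured T) z (sprayField Γ z)

/-- The vertical vector field. -/
def locV (T : Set Plane) (J : Plane → Plane →L[ℝ] Plane) (U : Plane × Plane → F)
    (z : Plane × Plane) : F :=
  fderivWithin ℝ U (punctured T) z (vertField J z)

/-- The horizontal vector field `X_⊥`. -/
def locXperp (T : Set Plane) (G : Plane → Plane →L[ℝ] Plane →L[ℝ] ℝ)
    (Γ : Plane → Plane →L[ℝ] Plane →L[ℝ] Plane) (J : Plane → Plane →L[ℝ] Plane)
    (U : Plane × Plane → F) (z : Plane × Plane) : F :=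
  -((len G z)⁻¹ • fderivWithin ℝ U (punctured T) z (horField Γ J z))

end Operators

namespace LocalGeometry

variable {T : Set Plane} {G : Plane → Plane →L[ℝ] Plane →L[ℝ] ℝ}
  {Γ : Plane → Plane →L[ℝ] Plane →L[ℝ] Plane} {J : Plane → Plane →L[ℝ] Plane}

lemma hasG (h : LocalGeometry T G Γ J) {y : Plane} (hy : y ∈ T) :
    HasFDerivWithinAt G (fderivWithin ℝ G T y) T y :=
  ((h.smoothG y hy).differentiableWithinAt (by simp)).hasFDerivWithinAt

lemma hasΓ (h : LocalGeometry T G Γ J) {y : Plane} (hy : y ∈ T) :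
    HasFDerivWithinAt Γ (fderivWithin ℝ Γ T y) T y :=
  ((h.smoothΓ y hy).differentiableWithinAt (by simp)).hasFDerivWithinAt

lemma hasJ (h : LocalGeometry T G Γ J) {y : Plane} (hy : y ∈ T) :
    HasFDerivWithinAt J (fderivWithin ℝ J T y) T y :=
  ((h.smoothJ y hy).differentiableWithinAt (by simp)).hasFDerivWithinAt

/-- The rotation is parallel. -/
lemma parallel (h : LocalGeometry T G Γ J) {y : Plane} (hy : y ∈ T) (a w : Plane) :
    fderivWithin ℝ J T y a w = J y (Γ y a w) - Γ y a (J y w) := by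
  have hR := h.rotation y hy
  have hu := h.uniqueDiff y hy
  set J' := fderivWithin ℝ J T y
  -- `B` is the covariant derivative of `J` in the direction `a`. Differentiating ⟨Jw, w⟩ = 0 shows
  -- that it is skew, hence a multiple μJ. Differentiating J² = −1 shows that it anticommutes with
  -- `J`, which forces μ = 0.
  let B : Plane →L[ℝ] Plane := J' a + (Γ y a).comp (J y) - (J y).comp (Γ y a)
  have hBw : ∀ w, B w = J' a w + Γ y a (J y w) - J y (Γ y a w) := fun w => by
    simp [B]
  have hskew : ∀ w, G y (B w) w = 0 := by
    intro w
    have h1 : HasFDerivWithinAt (fun y => G y (J y w) w) (0 : Plane →L[ℝ] ℝ) T y :=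
      (hasFDerivWithinAt_const (0 : ℝ) y T).congr (fun x hx => (h.rotation x hx).skew w)
        (hR.skew w)
    have h2 := ((h.hasG hy).clm_apply ((h.hasJ hy).clm_apply
      (hasFDerivWithinAt_const w y T))).clm_apply (hasFDerivWithinAt_const w y T)
    have h3 := congrArg (fun L : Plane →L[ℝ] ℝ => L a) (hu.eq h1 h2)
    simp only [ContinuousLinearMap.comp_zero, zero_add, zero_apply,
      add_apply, ContinuousLinearMap.comp_apply, ContinuousLinearMap.flip_apply, h.compat y hy] at h3
    rw [hBw, map_sub, map_add, sub_apply, add_apply, hR.antisymm (Γ y a w) w,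
      hR.symm (Γ y a w) (J y w)]
    change _ = G y (J' a w) w + _ at h3
    linarith
  obtain ⟨μ, hμ⟩ := hR.exists_smul_of_diag hskew
  have hanti : ∀ w, B (J y w) + J y (B w) = 0 := by
    intro w
    have h1 : HasFDerivWithinAt (fun y => J y (J y w)) (0 : Plane →L[ℝ] Plane) T y :=
      (hasFDerivWithinAt_const (-w) y T).congr (fun x hx => (h.rotation x hx).sq w) (hR.sq w)
    have h2 := (h.hasJ hy).clm_apply ((h.hasJ hy).clm_apply (hasFDerivWithinAt_const w y T))
    have h3 := congrArg (fun L : Plane →L[ℝ] Plane => L a) (hu.eq h1 h2)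
    simp only [ContinuousLinearMap.comp_zero, zero_add, zero_apply,
      add_apply, ContinuousLinearMap.comp_apply, ContinuousLinearMap.flip_apply] at h3
    rw [hBw, hBw, hR.sq, map_sub, map_add, hR.sq, map_neg]
    change 0 = J y (J' a w) + J' a (J y w) at h3
    rw [eq_comm] at h3
    rw [← h3]; abel
  have hμ0 : μ = 0 := by
    have := hanti (stdVec 0)
    rw [hμ, hμ, map_smul, hR.sq, ← two_smul ℝ] at this
    simpa [stdVec_ne_zero] using this
  have := hBw w
  rw [hμ, hμ0, zero_smul] at this
  rw [eq_comm, sub_eq_zero] at this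
  rw [← this]; abel

/-- The curvature tensor is skew-adjoint. -/
lemma curvTensor_skew (h : LocalGeometry T G Γ J) {y : Plane} (hy : y ∈ T) (a b c : Plane) :
    G y (curvTensor T Γ y a b c) c = 0 := by
  have hR := h.rotation y hy
  have hu := h.uniqueDiff y hy
  have hf : ContDiffOn ℝ ∞ (fun y => G y c c) T :=
    (h.smoothG.clm_apply contDiffOn_const).clm_apply contDiffOn_const
  have hf' : ∀ x ∈ T, ∀ a, fderivWithin ℝ (fun y => G y c c) T x a = 2 * G x (Γ x a c) c := by
    intro x hx a
    have h1 := ((h.hasG hx).clm_apply (hasFDerivWithinAt_const c x T)).clm_apply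
      (hasFDerivWithinAt_const c x T)
    rw [h1.fderivWithin (h.uniqueDiff x hx)]
    simp only [ContinuousLinearMap.comp_zero, zero_add, ContinuousLinearMap.flip_apply,
      h.compat x hx, (h.rotation x hx).symm c]
    ring
  -- This is the Hessian of ⟨c, c⟩ for a constant vector `c`. The middle term is symmetric in `a`
  -- and `d`, so symmetry of the Hessian leaves exactly the vanishing of the curvature term.
  have key : ∀ d a, fderivWithin ℝ (fderivWithin ℝ (fun y => G y c c) T) T y d a =
      2 * (G y (Γ y d (Γ y a c)) c + G y (Γ y a c) (Γ y d c)
        + G y (fderivWithin ℝ Γ T y d a c) c) := by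
    intro d a
    have hD : DifferentiableWithinAt ℝ (fderivWithin ℝ (fun y => G y c c) T) T y :=
      ((hf.fderivWithin h.uniqueDiff (m := 1) (by decide)) y hy).differentiableWithinAt
        one_ne_zero
    have h1 := hD.hasFDerivWithinAt.clm_apply (hasFDerivWithinAt_const a y T)
    have h2 := (((h.hasG hy).clm_apply (((h.hasΓ hy).clm_apply
      (hasFDerivWithinAt_const a y T)).clm_apply (hasFDerivWithinAt_const c y T))).clm_apply
      (hasFDerivWithinAt_const c y T)).const_mul 2
    have h3 := h2.congr (fun x hx => hf' x hx a) (hf' y hy a)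
    have h4 := congrArg (fun L : Plane →L[ℝ] ℝ => L d) (hu.eq h1 h3)
    simp only [ContinuousLinearMap.comp_zero, zero_add, add_apply, smul_apply, smul_eq_mul,
      ContinuousLinearMap.comp_apply, ContinuousLinearMap.flip_apply, h.compat y hy] at h4
    rw [h4]; ring
  have hsymm : IsSymmSndFDerivWithinAt ℝ (fun y => G y c c) T y :=
    (hf y hy).isSymmSndFDerivWithinAt (by simpa using WithTop.coe_le_coe.2 (le_top : (2 : ℕ∞) ≤ ⊤)) h.uniqueDiff
      (h.dense hy) hy
  have h1 := key a b
  rw [hsymm a b, key b a, hR.symm (Γ y a c)] at h1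
  simp only [curvTensor, map_add, map_sub, add_apply, sub_apply]
  linarith

end LocalGeometry

/-! ### The brackets of the geodesic, horizontal and vertical fields -/

namespace LocalGeometry

variable {T : Set Plane} {G : Plane → Plane →L[ℝ] Plane →L[ℝ] ℝ}
  {Γ : Plane → Plane →L[ℝ] Plane →L[ℝ] Plane} {J : Plane → Plane →L[ℝ] Plane}

lemma uniqueDiff_punctured (h : LocalGeometry T G Γ J) : UniqueDiffOn ℝ (punctured T) :=
  h.uniqueDiff.prod isOpen_compl_singleton.uniqueDiffOn

lemma punctured_dense (h : LocalGeometry T G Γ J) :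
    punctured T ⊆ closure (interior (punctured T)) := by
  rw [punctured, interior_prod_eq, closure_prod_eq, isOpen_compl_singleton.interior_eq]
  exact Set.prod_mono h.dense subset_closure

lemma comp_fst {E : Type*} [NormedAddCommGroup E] [NormedSpace ℝ E] {f : Plane → E}
    {f' : Plane →L[ℝ] E} {z : Plane × Plane}
    (hf : HasFDerivWithinAt f f' T z.1) :
    HasFDerivWithinAt (fun z : Plane × Plane => f z.1)
      (f'.comp (ContinuousLinearMap.fst ℝ Plane Plane)) (punctured T) z :=
  HasFDerivWithinAt.comp z hf hasFDerivWithinAt_fst (fun _ hx => hx.1)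

lemma symm_fderivΓ (h : LocalGeometry T G Γ J) {y : Plane} (hy : y ∈ T) (a b c : Plane) :
    fderivWithin ℝ Γ T y a b c = fderivWithin ℝ Γ T y a c b := by
  have h1 := ((h.hasΓ hy).clm_apply (hasFDerivWithinAt_const b y T)).clm_apply
    (hasFDerivWithinAt_const c y T)
  have h2 := ((h.hasΓ hy).clm_apply (hasFDerivWithinAt_const c y T)).clm_apply
    (hasFDerivWithinAt_const b y T)
  have h3 := h1.congr (fun x hx => h.symmΓ x hx c b) (h.symmΓ y hy c b)
  have h4 := congrArg (fun L : Plane →L[ℝ] Plane => L a) ((h.uniqueDiff y hy).eq h3 h2)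
  simpa using h4

variable {z : Plane × Plane}

lemma hasFDeriv_spray (h : LocalGeometry T G Γ J) (hz : z ∈ punctured T) :
    ∃ S' : Plane × Plane →L[ℝ] Plane × Plane,
      HasFDerivWithinAt (sprayField Γ) S' (punctured T) z ∧
      ∀ v, S' v = (v.2, -(fderivWithin ℝ Γ T z.1 v.1 z.2 z.2 + 2 • Γ z.1 z.2 v.2)) := by
  refine ⟨_, HasFDerivWithinAt.prodMk hasFDerivWithinAt_snd
    (((comp_fst (h.hasΓ hz.1)).clm_apply hasFDerivWithinAt_snd).clm_apply
      hasFDerivWithinAt_snd).neg, fun v => ?_⟩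
  ext1
  · simp
  · simp [h.symmΓ z.1 hz.1 v.2 z.2]
    module

/-- The derivative of `J` is eliminated by `parallel`, so that the brackets below become linear
algebra in `J`, `Γ` and the first derivative of `Γ`. -/
lemma hasFDeriv_vert (h : LocalGeometry T G Γ J) (hz : z ∈ punctured T) :
    ∃ V' : Plane × Plane →L[ℝ] Plane × Plane,
      HasFDerivWithinAt (vertField J) V' (punctured T) z ∧
      ∀ v, V' v = (0, J z.1 (Γ z.1 v.1 z.2) - Γ z.1 v.1 (J z.1 z.2) + J z.1 v.2) := by
  refine ⟨_, HasFDerivWithinAt.prodMk (hasFDerivWithinAt_const 0 _ _)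
    ((comp_fst (h.hasJ hz.1)).clm_apply hasFDerivWithinAt_snd), fun v => ?_⟩
  ext1
  · simp
  · simp [h.parallel hz.1]
    module

lemma hasFDeriv_hor (h : LocalGeometry T G Γ J) (hz : z ∈ punctured T) :
    ∃ H' : Plane × Plane →L[ℝ] Plane × Plane,
      HasFDerivWithinAt (horField Γ J) H' (punctured T) z ∧
      ∀ v, H' v = (J z.1 (Γ z.1 v.1 z.2) - Γ z.1 v.1 (J z.1 z.2) + J z.1 v.2,
        -(fderivWithin ℝ Γ T z.1 v.1 z.2 (J z.1 z.2) + Γ z.1 v.2 (J z.1 z.2)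
          + Γ z.1 z.2 (J z.1 (Γ z.1 v.1 z.2) - Γ z.1 v.1 (J z.1 z.2) + J z.1 v.2))) := by
  have h1 := (comp_fst (h.hasJ hz.1)).clm_apply
    (hasFDerivWithinAt_snd (𝕜 := ℝ) (s := punctured T) (p := z))
  refine ⟨_, HasFDerivWithinAt.prodMk h1
    (((comp_fst (h.hasΓ hz.1)).clm_apply hasFDerivWithinAt_snd).clm_apply h1).neg, fun v => ?_⟩
  ext1
  · simp [h.parallel hz.1]
    module
  · simp [h.parallel hz.1]
    module

lemma len_pos (h : LocalGeometry T G Γ J) (hz : z ∈ punctured T) : 0 < len G z :=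
  Real.sqrt_pos.2 ((h.rotation z.1 hz.1).pos z.2 hz.2)

lemma len_sq (h : LocalGeometry T G Γ J) (hz : z ∈ punctured T) :
    len G z ^ 2 = G z.1 z.2 z.2 :=
  Real.sq_sqrt ((h.rotation z.1 hz.1).pos z.2 hz.2).le

/-- Length is constant along all three fields: along the two horizontal ones by metric
compatibility, along the vertical one because `J w` is orthogonal to `w`. -/
lemma hasFDeriv_len (h : LocalGeometry T G Γ J) (hz : z ∈ punctured T) :
    ∃ N' : Plane × Plane →L[ℝ] ℝ,
      HasFDerivWithinAt (fun z => (len G z)⁻¹) N' (punctured T) z ∧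
      N' (sprayField Γ z) = 0 ∧ N' (vertField J z) = 0 ∧ N' (horField Γ J z) = 0 := by
  have hR := h.rotation z.1 hz.1
  have h1 := ((((comp_fst (h.hasG hz.1)).clm_apply hasFDerivWithinAt_snd).clm_apply
    hasFDerivWithinAt_snd).sqrt (hR.pos z.2 hz.2).ne')
  refine ⟨_, (hasDerivAt_inv (h.len_pos hz).ne').comp_hasFDerivWithinAt z h1, ?_, ?_, ?_⟩ <;>
  simp [sprayField, vertField, horField, h.compat z.1 hz.1, hR.skew,
    hR.symm z.2]
  · ring
  · rw [h.symmΓ z.1 hz.1 (J z.1 z.2) z.2]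
    ring

variable {F : Type*} [NormedAddCommGroup F] [NormedSpace ℝ F]

lemma smooth_len_inv (h : LocalGeometry T G Γ J) :
    ContDiffOn ℝ ∞ (fun z => (len G z)⁻¹) (punctured T) := by
  have h1 : ContDiffOn ℝ ∞ (fun z : Plane × Plane => G z.1 z.2 z.2) (punctured T) :=
    ((h.smoothG.comp contDiffOn_fst (fun _ hx => hx.1)).clm_apply contDiffOn_snd).clm_apply
      contDiffOn_snd
  exact (h1.sqrt fun z hz => ((h.rotation z.1 hz.1).pos z.2 hz.2).ne').inv
    fun z hz => (h.len_pos hz).ne'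

lemma smooth_spray (h : LocalGeometry T G Γ J) :
    ContDiffOn ℝ ∞ (sprayField Γ) (punctured T) :=
  contDiffOn_snd.prodMk (((h.smoothΓ.comp contDiffOn_fst (fun _ hx => hx.1)).clm_apply
    contDiffOn_snd).clm_apply contDiffOn_snd).neg

lemma smooth_vert (h : LocalGeometry T G Γ J) :
    ContDiffOn ℝ ∞ (vertField J) (punctured T) :=
  contDiffOn_const.prodMk ((h.smoothJ.comp contDiffOn_fst (fun _ hx => hx.1)).clm_apply
    contDiffOn_snd)

lemma smooth_hor (h : LocalGeometry T G Γ J) :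
    ContDiffOn ℝ ∞ (horField Γ J) (punctured T) := by
  have h1 : ContDiffOn ℝ ∞ (fun z : Plane × Plane => J z.1 z.2) (punctured T) :=
    (h.smoothJ.comp contDiffOn_fst (fun _ hx => hx.1)).clm_apply contDiffOn_snd
  exact h1.prodMk (((h.smoothΓ.comp contDiffOn_fst (fun _ hx => hx.1)).clm_apply
    contDiffOn_snd).clm_apply h1).neg

lemma smooth_fderiv (h : LocalGeometry T G Γ J) {U : Plane × Plane → F}
    (hU : ContDiffOn ℝ ∞ U (punctured T)) :
    ContDiffOn ℝ ∞ (fderivWithin ℝ U (punctured T)) (punctured T) :=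
  hU.fderivWithin h.uniqueDiff_punctured (by simp)

lemma smooth_locX (h : LocalGeometry T G Γ J) {U : Plane × Plane → F}
    (hU : ContDiffOn ℝ ∞ U (punctured T)) : ContDiffOn ℝ ∞ (locX T G Γ U) (punctured T) :=
  h.smooth_len_inv.smul ((h.smooth_fderiv hU).clm_apply h.smooth_spray)

lemma smooth_locV (h : LocalGeometry T G Γ J) {U : Plane × Plane → F}
    (hU : ContDiffOn ℝ ∞ U (punctured T)) : ContDiffOn ℝ ∞ (locV T J U) (punctured T) :=
  (h.smooth_fderiv hU).clm_apply h.smooth_vert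

/-- The factor 1/|w| makes X and X_⊥ preserve homogeneity of degree zero. Being constant along the
three fields, it passes through every bracket. -/
lemma fderivWithin_len_smul (h : LocalGeometry T G Γ J) (hz : z ∈ punctured T)
    {f : Plane × Plane → F} (hf : DifferentiableWithinAt ℝ f (punctured T) z)
    {v : Plane × Plane} (hv : v = sprayField Γ z ∨ v = vertField J z ∨ v = horField Γ J z) :
    fderivWithin ℝ (fun z => (len G z)⁻¹ • f z) (punctured T) z v =
      (len G z)⁻¹ • fderivWithin ℝ f (punctured T) z v := by
  obtain ⟨N', hN, hS, hV, hH⟩ := h.hasFDeriv_len hz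
  have hN0 : N' v = 0 := by rcases hv with rfl | rfl | rfl <;> assumption
  rw [(hN.fun_smul hf.hasFDerivWithinAt).fderivWithin (h.uniqueDiff_punctured z hz)]
  simp [hN0]

/-- `[X, V] = X_⊥`. -/
lemma locX_locV (h : LocalGeometry T G Γ J) {U : Plane × Plane → F}
    (hU : ContDiffOn ℝ ∞ U (punctured T)) (hz : z ∈ punctured T) :
    locX T G Γ (locV T J U) z - locV T J (locX T G Γ U) z = locXperp T G Γ J U z := by
  obtain ⟨S', hS, hS'⟩ := h.hasFDeriv_spray hz
  obtain ⟨V', hV, hV'⟩ := h.hasFDeriv_vert hz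
  have hb := fderivWithin_bracket h.uniqueDiff_punctured hU hz (h.punctured_dense hz) hS hV
  have hd : DifferentiableWithinAt ℝ (fun y => fderivWithin ℝ U (punctured T) y (sprayField Γ y))
      (punctured T) z := (((h.smooth_fderiv hU).clm_apply h.smooth_spray) z
        hz).differentiableWithinAt (by simp)
  have e : V' (sprayField Γ z) - S' (vertField J z) = -horField Γ J z := by
    rw [hV', hS']
    ext1
    · simp [sprayField, vertField, horField]
    · simp [sprayField, vertField, horField]
      module
  rw [e, map_neg] at hb
  unfold locX locV locXperp
  rw [h.fderivWithin_len_smul hz hd (.inr (.inl rfl)), ← smul_sub, hb, smul_neg]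

/-- `[V, X_⊥] = X`. -/
lemma locV_locXperp (h : LocalGeometry T G Γ J) {U : Plane × Plane → F}
    (hU : ContDiffOn ℝ ∞ U (punctured T)) (hz : z ∈ punctured T) :
    locV T J (locXperp T G Γ J U) z - locXperp T G Γ J (locV T J U) z = locX T G Γ U z := by
  obtain ⟨H', hH, hH'⟩ := h.hasFDeriv_hor hz
  obtain ⟨V', hV, hV'⟩ := h.hasFDeriv_vert hz
  have hR := h.rotation z.1 hz.1
  have hb := fderivWithin_bracket h.uniqueDiff_punctured hU hz (h.punctured_dense hz) hV hH
  have hd : DifferentiableWithinAt ℝ (fun y => fderivWithin ℝ U (punctured T) y (horField Γ J y))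
      (punctured T) z := (((h.smooth_fderiv hU).clm_apply h.smooth_hor) z
        hz).differentiableWithinAt (by simp)
  have e : H' (vertField J z) - V' (horField Γ J z) = -sprayField Γ z := by
    rw [hV', hH']
    ext1
    · simp [sprayField, vertField, horField, hR.sq]
    · simp [sprayField, vertField, horField, hR.sq, h.symmΓ z.1 hz.1 (J z.1 z.2) z.2]
      abel
  rw [e, map_neg] at hb
  unfold locX locV locXperp
  rw [fderivWithin_fun_neg (h.uniqueDiff_punctured z hz), neg_apply,
    h.fderivWithin_len_smul hz hd (.inr (.inl rfl)), sub_neg_eq_add, neg_add_eq_sub, ← smul_sub,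
    ← neg_sub, hb, neg_neg]

/-- `[X, X_⊥]` is the curvature. -/
lemma locX_locXperp (h : LocalGeometry T G Γ J) {U : Plane × Plane → F}
    (hU : ContDiffOn ℝ ∞ U (punctured T)) (hz : z ∈ punctured T) :
    locX T G Γ (locXperp T G Γ J U) z - locXperp T G Γ J (locX T G Γ U) z =
      (len G z ^ 2)⁻¹ • fderivWithin ℝ U (punctured T) z
        (0, curvTensor T Γ z.1 z.2 (J z.1 z.2) z.2) := by
  obtain ⟨H', hH, hH'⟩ := h.hasFDeriv_hor hz
  obtain ⟨S', hS, hS'⟩ := h.hasFDeriv_spray hz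
  have hR := h.rotation z.1 hz.1
  have hb := fderivWithin_bracket h.uniqueDiff_punctured hU hz (h.punctured_dense hz) hS hH
  have hd : DifferentiableWithinAt ℝ (fun y => fderivWithin ℝ U (punctured T) y (horField Γ J y))
      (punctured T) z := (((h.smooth_fderiv hU).clm_apply h.smooth_hor) z
        hz).differentiableWithinAt (by simp)
  have hd' : DifferentiableWithinAt ℝ (fun y => fderivWithin ℝ U (punctured T) y (sprayField Γ y))
      (punctured T) z := (((h.smooth_fderiv hU).clm_apply h.smooth_spray) z
        hz).differentiableWithinAt (by simp)
  -- The base components of the bracket cancel, so it is vertical, and its fibre component collects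
  -- exactly the four terms of the curvature tensor.
  have e : H' (sprayField Γ z) - S' (horField Γ J z) =
      -(0, curvTensor T Γ z.1 z.2 (J z.1 z.2) z.2) := by
    rw [hS', hH']
    ext1
    · simp [sprayField, horField]
      abel
    · simp [sprayField, horField, curvTensor, h.symmΓ z.1 hz.1 (Γ z.1 z.2 z.2) (J z.1 z.2)]
      rw [h.symm_fderivΓ hz.1 z.2 (J z.1 z.2) z.2, h.symmΓ z.1 hz.1 (J z.1 z.2) z.2]
      module
  rw [e, map_neg] at hb
  unfold locX locXperp
  rw [fderivWithin_fun_neg (h.uniqueDiff_punctured z hz), neg_apply,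
    h.fderivWithin_len_smul hz hd (.inl rfl),
    h.fderivWithin_len_smul hz hd' (.inr (.inr rfl)), sub_neg_eq_add, smul_neg, neg_add_eq_sub,
    ← smul_sub, ← smul_sub, ← neg_sub, hb, neg_neg, smul_smul, sq, mul_inv]

/-- The curvature in terms of the Gaussian curvature. -/
lemma curvTensor_rotation (h : LocalGeometry T G Γ J) {y : Plane} (hy : y ∈ T) (w : Plane) :
    curvTensor T Γ y w (J y w) w =
      -((G y (curvTensor T Γ y (stdVec 0) (stdVec 1) (stdVec 1)) (stdVec 0) /
        (G y (stdVec 0) (stdVec 0) * G y (stdVec 1) (stdVec 1) - G y (stdVec 0) (stdVec 1) ^ 2))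
        * G y w w) • J y w := by
  have hR := h.rotation y hy
  let B : Plane →L[ℝ] Plane := fderivWithin ℝ Γ T y (stdVec 0) (stdVec 1)
    - fderivWithin ℝ Γ T y (stdVec 1) (stdVec 0)
    + (Γ y (stdVec 0)).comp (Γ y (stdVec 1)) - (Γ y (stdVec 1)).comp (Γ y (stdVec 0))
  have hB : ∀ c, curvTensor T Γ y (stdVec 0) (stdVec 1) c = B c := fun c => by
    simp [B, curvTensor]
  obtain ⟨μ, hμ⟩ := hR.exists_smul_of_diag (B := B)
    fun c => by rw [← hB]; exact h.curvTensor_skew hy _ _ _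
  -- The tensor is alternating in its first two arguments, so in the plane it is its (0, 1)
  -- component times a determinant. For the pair `w`, `J w`, `area_eq` expresses that determinant
  -- through ⟨w, w⟩.
  have hgen : ∀ a b c, curvTensor T Γ y a b c =
      (a 0 * b 1 - a 1 * b 0) • curvTensor T Γ y (stdVec 0) (stdVec 1) c := by
    intro a b c
    conv_lhs => rw [plane_eq a, plane_eq b]
    simp only [curvTensor, map_add, map_smul, add_apply, smul_apply]
    module
  have hN := hR.area_eq w (J y w)
  rw [hR.isometry] at hN
  rw [hgen, hB, hB, hμ, hμ, ← hR.area_sq, map_smul, smul_apply, hR.antisymm, hR.symm,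
    smul_smul, hN, smul_eq_mul]
  have := hR.area_ne_zero
  congr 1
  field_simp

end LocalGeometry

/-! ### Coordinates on the tangent bundle -/

section Coordinates

set_option linter.unusedSectionVars false

variable {M : Type*} [TopologicalSpace M] [ChartedSpace (EuclideanHalfSpace 2) M]
  [IsManifold (𝓡∂ 2) ∞ M]

/-- The coordinate domain of the chart at `x₀`. -/
abbrev dom (x₀ : M) : Set Plane := (extChartAt (𝓡∂ 2) x₀).target

/-- The point with coordinates `y` in the chart at `x₀`. -/
abbrev pt (x₀ : M) (y : Plane) : M := (extChartAt (𝓡∂ 2) x₀).symm y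

/-- The tangent vector at `x` with given components in the chart at `x₀`. -/
def vec (x₀ x : M) : Plane →L[ℝ] TangentSpace (𝓡∂ 2) x :=
  (trivializationAt Plane (TangentSpace (𝓡∂ 2)) x₀).symmL ℝ x

/-- The transition map from the chart at `x₀` to the chart at `x₁`. -/
def transition (x₀ x₁ : M) : Plane → Plane :=
  extChartAt (𝓡∂ 2) x₁ ∘ (extChartAt (𝓡∂ 2) x₀).symm

/-- The Jacobian of the transition map. -/
def jac (x₀ x₁ : M) (y : Plane) : Plane →L[ℝ] Plane :=
  fderivWithin ℝ (transition x₀ x₁) (Set.range (𝓡∂ 2)) y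

/-- The tangent vector with coordinates `z` in the chart of the tangent bundle. -/
def lift (x₀ : M) (z : Plane × Plane) : TM M := ⟨pt x₀ z.1, vec x₀ (pt x₀ z.1) z.2⟩

lemma coordVec_eq (x₀ : M) (i : Fin 2) (x : M) : coordVec x₀ i x = vec x₀ x (stdVec i) := rfl

lemma pt_mem {x₀ : M} {y : Plane} (hy : y ∈ dom x₀) :
    pt x₀ y ∈ (extChartAt (𝓡∂ 2) x₀).source :=
  (extChartAt (𝓡∂ 2) x₀).map_target hy

/-- `TangentSpace` at `x` is identified with the plane through the preferred chart at `x`, so a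
vector with components `a` in the chart at `x₀` is represented by the image of `a` under the
Jacobian. The equality is stated in `Plane` to make this identification explicit. -/
lemma vec_apply {x₀ x : M} (hx : x ∈ (extChartAt (𝓡∂ 2) x₀).source) (a : Plane) :
    @Eq Plane (vec x₀ x a) (tangentCoordChange (𝓡∂ 2) x₀ x x a) := by
  rw [extChartAt_source] at hx
  exact congrArg (fun L : Plane →L[ℝ] TangentSpace (𝓡∂ 2) x => L a)
    (TangentBundle.symmL_trivializationAt_eq_core (I := 𝓡∂ 2) hx)

lemma jac_pt {x₀ x₁ : M} {y : Plane} (hy : y ∈ dom x₀) :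
    jac x₀ x₁ y = tangentCoordChange (𝓡∂ 2) x₀ x₁ (pt x₀ y) := by
  rw [tangentCoordChange_def, (extChartAt (𝓡∂ 2) x₀).right_inv hy]
  rfl

lemma vec_tangentCoordChange {x₀ x₁ x : M} (h₀ : x ∈ (extChartAt (𝓡∂ 2) x₀).source)
    (h₁ : x ∈ (extChartAt (𝓡∂ 2) x₁).source) (a : Plane) :
    vec x₁ x (tangentCoordChange (𝓡∂ 2) x₀ x₁ x a) = vec x₀ x a :=
  (vec_apply h₁ _).trans ((tangentCoordChange_comp
    ⟨⟨h₀, h₁⟩, mem_extChartAt_source x⟩).trans (vec_apply h₀ a).symm)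

lemma vec_self (x : M) (a : Plane) : @Eq Plane (vec x x a) a :=
  (vec_apply (mem_extChartAt_source x) a).trans
    (tangentCoordChange_self (mem_extChartAt_source x))

lemma vec_surjective {x₀ x : M} (h₀ : x ∈ (extChartAt (𝓡∂ 2) x₀).source) :
    Function.Surjective (vec x₀ x) := fun v =>
  ⟨tangentCoordChange (𝓡∂ 2) x x₀ x (v : Plane),
    (vec_tangentCoordChange (mem_extChartAt_source x) h₀ (v : Plane)).trans (vec_self x v)⟩

lemma vec_injective {x₀ x : M} (h₀ : x ∈ (extChartAt (𝓡∂ 2) x₀).source) :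
    Function.Injective (vec x₀ x) := by
  have h : ∀ a : Plane,
      tangentCoordChange (𝓡∂ 2) x x₀ x (show Plane from vec x₀ x a) = a := fun a =>
    (congrArg (tangentCoordChange (𝓡∂ 2) x x₀ x) (vec_apply h₀ a)).trans
      ((tangentCoordChange_comp ⟨⟨h₀, mem_extChartAt_source x⟩, h₀⟩).trans
        (tangentCoordChange_self h₀))
  intro a b hab
  exact (h a).symm.trans ((congrArg (fun v : Plane => tangentCoordChange (𝓡∂ 2) x x₀ x v)
    hab).trans (h b))

lemma vec_ne_zero {x₀ x : M} (h₀ : x ∈ (extChartAt (𝓡∂ 2) x₀).source) {a : Plane} (ha : a ≠ 0) :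
    vec x₀ x a ≠ 0 := fun h => ha (vec_injective h₀ (by rw [h, map_zero]))

lemma transition_mem {x₀ x₁ : M} {y : Plane} (hy' : pt x₀ y ∈ (extChartAt (𝓡∂ 2) x₁).source) :
    transition x₀ x₁ y ∈ dom x₁ :=
  (extChartAt (𝓡∂ 2) x₁).map_source hy'

lemma pt_transition {x₀ x₁ : M} {y : Plane} (hy' : pt x₀ y ∈ (extChartAt (𝓡∂ 2) x₁).source) :
    pt x₁ (transition x₀ x₁ y) = pt x₀ y :=
  (extChartAt (𝓡∂ 2) x₁).left_inv hy'

lemma vec_jac {x₀ x₁ : M} {y : Plane} (hy : y ∈ dom x₀)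
    (hy' : pt x₀ y ∈ (extChartAt (𝓡∂ 2) x₁).source) (a : Plane) :
    vec x₁ (pt x₀ y) (jac x₀ x₁ y a) = vec x₀ (pt x₀ y) a := by
  rw [jac_pt hy, vec_tangentCoordChange (pt_mem hy) hy']

lemma lift_transition {x₀ x₁ : M} {z : Plane × Plane} (hz : z.1 ∈ dom x₀)
    (hz' : pt x₀ z.1 ∈ (extChartAt (𝓡∂ 2) x₁).source) :
    lift x₁ (transition x₀ x₁ z.1, jac x₀ x₁ z.1 z.2) = lift x₀ z := by
  unfold lift
  simp only
  rw [pt_transition hz', vec_jac hz hz']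

lemma jac_injective {x₀ x₁ : M} {y : Plane} (hy : y ∈ dom x₀)
    (hy' : pt x₀ y ∈ (extChartAt (𝓡∂ 2) x₁).source) : Function.Injective (jac x₀ x₁ y) := by
  intro a b hab
  apply vec_injective (pt_mem hy)
  rw [← vec_jac hy hy', ← vec_jac hy hy', hab]

lemma dom_mem_nhdsWithin {x₀ : M} {y : Plane} (hy : y ∈ dom x₀) :
    dom x₀ ∈ nhdsWithin y (Set.range (𝓡∂ 2)) :=
  extChartAt_target_mem_nhdsWithin_of_mem hy

lemma fderivWithin_dom {F : Type*} [NormedAddCommGroup F] [NormedSpace ℝ F] {x₀ : M} {y : Plane}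
    (hy : y ∈ dom x₀) (f : Plane → F) :
    fderivWithin ℝ f (dom x₀) y = fderivWithin ℝ f (Set.range (𝓡∂ 2)) y :=
  fderivWithin_congr_set (extChartAt_target_eventuallyEq_of_mem hy)

lemma eventually_mem_source {x₀ x₁ : M} {y : Plane} (hy : y ∈ dom x₀)
    (hy' : pt x₀ y ∈ (extChartAt (𝓡∂ 2) x₁).source) :
    ∀ᶠ y' in nhdsWithin y (dom x₀), pt x₀ y' ∈ (extChartAt (𝓡∂ 2) x₁).source :=
  (continuousOn_extChartAt_symm x₀ y hy).eventually
    ((isOpen_extChartAt_source x₁).mem_nhds hy')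

lemma contDiffWithinAt_transition {x₀ x₁ : M} {y : Plane} (hy : y ∈ dom x₀)
    (hy' : pt x₀ y ∈ (extChartAt (𝓡∂ 2) x₁).source) :
    ContDiffWithinAt ℝ ∞ (transition x₀ x₁) (dom x₀) y :=
  (contDiffWithinAt_ext_coord_change x₁ x₀ (by
    simp only [PartialEquiv.trans_source, PartialEquiv.symm_source]
    exact ⟨hy, hy'⟩)).mono (extChartAt_target_subset_range x₀)

lemma contDiffWithinAt_jac {x₀ x₁ : M} {y : Plane} (hy : y ∈ dom x₀)
    (hy' : pt x₀ y ∈ (extChartAt (𝓡∂ 2) x₁).source) :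
    ContDiffWithinAt ℝ ∞ (jac x₀ x₁) (dom x₀) y := by
  refine ((contDiffWithinAt_transition hy hy').fderivWithin_right (m := ∞)
    (uniqueDiffOn_extChartAt_target x₀) (by simp) hy).congr_of_mem (fun x hx => ?_) hy
  rw [fderivWithin_dom hx]
  rfl

lemma hasFDerivWithinAt_transition {x₀ x₁ : M} {y : Plane} (hy : y ∈ dom x₀)
    (hy' : pt x₀ y ∈ (extChartAt (𝓡∂ 2) x₁).source) :
    HasFDerivWithinAt (transition x₀ x₁) (jac x₀ x₁ y) (dom x₀) y := by
  have := ((contDiffWithinAt_transition hy hy').differentiableWithinAt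
    (by simp)).hasFDerivWithinAt
  rwa [fderivWithin_dom hy] at this

/-- The second derivative of a transition map is symmetric. -/
lemma fderivWithin_jac_symm {x₀ x₁ : M} {y : Plane} (hy : y ∈ dom x₀)
    (hy' : pt x₀ y ∈ (extChartAt (𝓡∂ 2) x₁).source) (a b : Plane) :
    fderivWithin ℝ (jac x₀ x₁) (dom x₀) y a b = fderivWithin ℝ (jac x₀ x₁) (dom x₀) y b a := by
  have h : IsSymmSndFDerivWithinAt ℝ (transition x₀ x₁) (dom x₀) y :=
    (contDiffWithinAt_transition hy hy').isSymmSndFDerivWithinAt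
      (by simpa using WithTop.coe_le_coe.2 (le_top : (2 : ℕ∞) ≤ ⊤))
      (uniqueDiffOn_extChartAt_target x₀) (extChartAt_target_subset_closure_interior hy) hy
  have e : fderivWithin ℝ (jac x₀ x₁) (dom x₀) y =
      fderivWithin ℝ (fderivWithin ℝ (transition x₀ x₁) (dom x₀)) (dom x₀) y :=
    fderivWithin_congr (fun x hx => by rw [fderivWithin_dom hx]; rfl)
      (by rw [fderivWithin_dom hy]; rfl)
  rw [e]
  exact h a b

lemma extChartAt_tangent_target (p : TM M) :
    (extChartAt (𝓡∂ 2).tangent p).target = dom p.1 ×ˢ Set.univ := by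
  rw [FiberBundle.extChartAt_target]
  congr 1
  ext y
  simp only [Set.mem_inter_iff, Set.mem_preimage, TangentBundle.trivializationAt_baseSet,
    and_iff_left_iff_imp]
  intro hy
  have := pt_mem hy
  rwa [extChartAt_source] at this

lemma extChartAt_tangent_symm (p : TM M) {z : Plane × Plane} (hz : z.1 ∈ dom p.1) :
    (extChartAt (𝓡∂ 2).tangent p).symm z = lift p.1 z := by
  have hb : pt p.1 z.1 ∈ (trivializationAt Plane (TangentSpace (𝓡∂ 2)) p.1).baseSet := by
    have := pt_mem hz
    rwa [extChartAt_source] at this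
  rw [FiberBundle.extChartAt]
  have := (trivializationAt Plane (TangentSpace (𝓡∂ 2)) p.1).mk_symm hb z.2
  simp only [PartialEquiv.coe_trans_symm, PartialEquiv.prod_symm, PartialEquiv.prod_coe,
    PartialEquiv.refl_symm, PartialEquiv.refl_coe, id, Function.comp_apply]
  rw [lift, vec, Bundle.Trivialization.symmL_apply _ hb]
  exact this.symm

lemma extChartAt_tangent_apply (p q : TM M) :
    extChartAt (𝓡∂ 2).tangent p q =
      (extChartAt (𝓡∂ 2) p.1 q.1, (tangentCoordChange (𝓡∂ 2) q.1 p.1 q.1 q.2 : Plane)) := by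
  rw [FiberBundle.extChartAt]
  rfl

lemma extChartAt_tangent_self (p : TM M) :
    extChartAt (𝓡∂ 2).tangent p p = (extChartAt (𝓡∂ 2) p.1 p.1, (p.2 : Plane)) := by
  rw [extChartAt_tangent_apply p p]
  congr 1
  exact tangentCoordChange_self (mem_extChartAt_source _)

lemma contMDiffOn_lift (x₀ : M) :
    ContMDiffOn 𝓘(ℝ, Plane × Plane) (𝓡∂ 2).tangent ∞ (lift x₀) (dom x₀ ×ˢ Set.univ) := by
  have h := contMDiffOn_extChartAt_symm (I := (𝓡∂ 2).tangent) (n := ∞) (⟨x₀, 0⟩ : TM M)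
  rw [extChartAt_tangent_target] at h
  exact h.congr fun z hz => (extChartAt_tangent_symm (⟨x₀, 0⟩ : TM M) hz.1).symm

end Coordinates

/-! ### Bilinear maps on the plane -/

section Bilin

variable {F : Type*} [NormedAddCommGroup F] [NormedSpace ℝ F]

/-- The bilinear map with given values on the standard basis. -/
def bilin (m : Fin 2 → Fin 2 → F) : Plane →L[ℝ] Plane →L[ℝ] F :=
  ∑ i, ∑ j, (EuclideanSpace.proj i : Plane →L[ℝ] ℝ).smulRight
    ((EuclideanSpace.proj j : Plane →L[ℝ] ℝ).smulRight (m i j))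

lemma bilin_apply (m : Fin 2 → Fin 2 → F) (a b : Plane) :
    bilin m a b = ∑ i, ∑ j, a i • b j • m i j := by
  simp [bilin]

lemma bilin_stdVec (m : Fin 2 → Fin 2 → F) (i j : Fin 2) :
    bilin m (stdVec i) (stdVec j) = m i j := by
  rw [bilin_apply]
  fin_cases i <;> fin_cases j <;> simp

lemma contDiffOn_bilin {s : Set Plane} {m : Plane → Fin 2 → Fin 2 → F}
    (hm : ∀ i j, ContDiffOn ℝ ∞ (fun y => m y i j) s) : ContDiffOn ℝ ∞ (fun y => bilin (m y)) s := by
  unfold bilin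
  refine ContDiffOn.sum fun i _ => ContDiffOn.sum fun j _ => ?_
  exact contDiffOn_const.smulRight (contDiffOn_const.smulRight (hm i j))

end Bilin

/-! ### The metric and the Levi-Civita connection in a chart -/

section Coordinates

set_option linter.unusedSectionVars false

variable {M : Type*} [TopologicalSpace M] [ChartedSpace (EuclideanHalfSpace 2) M]
  [IsManifold (𝓡∂ 2) ∞ M]

/-- The metric in the chart at `x₀`. -/
def metricCoord (g : Metric M) (x₀ : M) (y : Plane) : Plane →L[ℝ] Plane →L[ℝ] ℝ :=
  bilin fun i j => gMat g x₀ y i j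

lemma metricCoord_apply (g : Metric M) (x₀ : M) (y : Plane) (a b : Plane) :
    metricCoord g x₀ y a b = g.inner (pt x₀ y) (vec x₀ (pt x₀ y) a) (vec x₀ (pt x₀ y) b) := by
  conv_rhs => rw [plane_eq a, plane_eq b]
  rw [metricCoord, bilin_apply]
  simp only [map_add, map_smul, add_apply, smul_apply, smul_eq_mul, Fin.sum_univ_two, gMat,
    Matrix.of_apply, coordVec_eq]
  ring

lemma metricCoord_symm (g : Metric M) (x₀ : M) (y : Plane) (a b : Plane) :
    metricCoord g x₀ y a b = metricCoord g x₀ y b a := by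
  rw [metricCoord_apply, metricCoord_apply, g.symm]

lemma metricCoord_pos (g : Metric M) {x₀ : M} {y : Plane} (hy : y ∈ dom x₀) {a : Plane}
    (ha : a ≠ 0) : 0 < metricCoord g x₀ y a a := by
  rw [metricCoord_apply]
  exact g.pos _ _ (vec_ne_zero (pt_mem hy) ha)

lemma gMat_eq (g : Metric M) (x₀ : M) (y : Plane) (i j : Fin 2) :
    gMat g x₀ y i j = metricCoord g x₀ y (stdVec i) (stdVec j) :=
  (bilin_stdVec _ i j).symm

lemma gMat_symm (g : Metric M) (x₀ : M) (y : Plane) (i j : Fin 2) :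
    gMat g x₀ y i j = gMat g x₀ y j i := by
  rw [gMat_eq, gMat_eq, metricCoord_symm]

lemma gMat_det (g : Metric M) (x₀ : M) (y : Plane) :
    (gMat g x₀ y).det = gMat g x₀ y 0 0 * gMat g x₀ y 1 1 - gMat g x₀ y 0 1 ^ 2 := by
  rw [Matrix.det_fin_two, gMat_symm g x₀ y 1 0, sq]

lemma gMat_zero_pos (g : Metric M) {x₀ : M} {y : Plane} (hy : y ∈ dom x₀) :
    0 < gMat g x₀ y 0 0 := by
  rw [gMat_eq]
  exact metricCoord_pos g hy (stdVec_ne_zero 0)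

lemma gMat_det_pos (g : Metric M) {x₀ : M} {y : Plane} (hy : y ∈ dom x₀) :
    0 < (gMat g x₀ y).det := by
  have h0 := gMat_zero_pos g hy
  -- This vector is orthogonal to the first coordinate vector, and its squared length is g₀₀ det g.
  have hne : gMat g x₀ y 0 0 • stdVec 1 - gMat g x₀ y 0 1 • stdVec 0 ≠ 0 := by
    intro h
    have := congrArg (fun v : Plane => v 1) h
    simp at this
    exact h0.ne' this
  have h := metricCoord_pos g hy hne
  simp only [map_sub, map_smul, sub_apply, smul_apply, smul_eq_mul, ← gMat_eq,
    gMat_symm g x₀ y 1 0] at h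
  rw [gMat_det]
  have h2 : 0 < gMat g x₀ y 0 0 * (gMat g x₀ y 0 0 * gMat g x₀ y 1 1 - gMat g x₀ y 0 1 ^ 2) := by
    linarith
  exact (mul_pos_iff_of_pos_left h0).1 h2

/-- The metric is a smooth section of the bundle of bilinear forms, and the coordinate fields are
smooth maps into `TM` because `lift x₀` is smooth. -/
lemma contDiffOn_gMat (g : Metric M) (x₀ : M) (i j : Fin 2) :
    ContDiffOn ℝ ∞ (fun y => gMat g x₀ y i j) (dom x₀) := by
  rw [← contMDiffOn_iff_contDiffOn]
  have hs : ∀ i, ContMDiffOn 𝓘(ℝ, Plane) (𝓡∂ 2).tangent ∞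
      (fun y => (⟨pt x₀ y, vec x₀ (pt x₀ y) (stdVec i)⟩ : TM M)) (dom x₀) := fun i =>
    (contMDiffOn_lift x₀).comp (s := dom x₀) (f := fun y : Plane => (y, stdVec i))
      (contMDiffOn_iff_contDiffOn.2 (contDiffOn_id.prodMk contDiffOn_const))
      (fun y hy => ⟨hy, trivial⟩)
  intro y hy
  have hb : ContMDiffWithinAt 𝓘(ℝ, Plane) (𝓡∂ 2) ∞ (pt x₀) (dom x₀) y :=
    contMDiffOn_extChartAt_symm x₀ y hy
  have : ContMDiffWithinAt 𝓘(ℝ, Plane) ((𝓡∂ 2).prod 𝓘(ℝ)) ∞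
      (fun y => Bundle.TotalSpace.mk' ℝ (E := Bundle.Trivial M ℝ) (pt x₀ y)
        (g.inner (pt x₀ y) (vec x₀ (pt x₀ y) (stdVec i)) (vec x₀ (pt x₀ y) (stdVec j))))
      (dom x₀) y := by
    apply ContMDiffWithinAt.clm_bundle_apply₂ (F₁ := Plane) (F₂ := Plane)
    · exact ContMDiffAt.comp_contMDiffWithinAt y g.contMDiff.contMDiffAt hb
    · exact hs i y hy
    · exact hs j y hy
  simp only [Bundle.contMDiffWithinAt_totalSpace] at this
  exact this.2

lemma contDiffOn_metricCoord (g : Metric M) (x₀ : M) :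
    ContDiffOn ℝ ∞ (metricCoord g x₀) (dom x₀) :=
  contDiffOn_bilin fun i j => contDiffOn_gMat g x₀ i j

lemma contDiffOn_pd {F : Type*} [NormedAddCommGroup F] [NormedSpace ℝ F] {x₀ : M} {f : Plane → F}
    (hf : ContDiffOn ℝ ∞ f (dom x₀)) (i : Fin 2) : ContDiffOn ℝ ∞ (pd i f) (dom x₀) :=
  (((hf.fderivWithin (m := ∞) (uniqueDiffOn_extChartAt_target x₀) (by simp)).clm_apply
    contDiffOn_const).congr fun y hy => by rw [fderivWithin_dom hy]; rfl)

lemma contDiffOn_gMat_det (g : Metric M) (x₀ : M) :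
    ContDiffOn ℝ ∞ (fun y => (gMat g x₀ y).det) (dom x₀) := by
  simp only [Matrix.det_fin_two]
  exact ((contDiffOn_gMat g x₀ 0 0).mul (contDiffOn_gMat g x₀ 1 1)).sub
    ((contDiffOn_gMat g x₀ 0 1).mul (contDiffOn_gMat g x₀ 1 0))

lemma contDiffOn_gMat_inv (g : Metric M) (x₀ : M) (i j : Fin 2) :
    ContDiffOn ℝ ∞ (fun y => (gMat g x₀ y)⁻¹ i j) (dom x₀) := by
  have h : ContDiffOn ℝ ∞ (fun y => ((gMat g x₀ y).det)⁻¹ * (gMat g x₀ y).adjugate i j)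
      (dom x₀) := by
    refine ((contDiffOn_gMat_det g x₀).inv fun y hy => (gMat_det_pos g hy).ne').mul ?_
    simp only [Matrix.adjugate_fin_two]
    fin_cases i <;> fin_cases j
    · exact contDiffOn_gMat g x₀ 1 1
    · exact (contDiffOn_gMat g x₀ 0 1).neg
    · exact (contDiffOn_gMat g x₀ 1 0).neg
    · exact contDiffOn_gMat g x₀ 0 0
  exact h.congr fun y hy => by
    rw [Matrix.inv_def, Ring.inverse_eq_inv', Matrix.smul_apply, smul_eq_mul]

lemma contDiffOn_christoffel (g : Metric M) (x₀ : M) (k i j : Fin 2) :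
    ContDiffOn ℝ ∞ (christoffel g x₀ k i j) (dom x₀) := by
  unfold christoffel
  refine contDiffOn_const.mul (ContDiffOn.sum fun l _ => (contDiffOn_gMat_inv g x₀ k l).mul ?_)
  exact ((contDiffOn_pd (contDiffOn_gMat g x₀ j l) i).add
    (contDiffOn_pd (contDiffOn_gMat g x₀ i l) j)).sub (contDiffOn_pd (contDiffOn_gMat g x₀ i j) l)

/-- The Christoffel symbols in the chart at `x₀`, as a bilinear map. -/
def chrisCoord (g : Metric M) (x₀ : M) (y : Plane) : Plane →L[ℝ] Plane →L[ℝ] Plane :=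
  bilin fun i j => WithLp.toLp 2 fun k => christoffel g x₀ k i j y

lemma contDiffOn_chrisCoord (g : Metric M) (x₀ : M) :
    ContDiffOn ℝ ∞ (chrisCoord g x₀) (dom x₀) :=
  contDiffOn_bilin fun i j => contDiffOn_euclidean.2 fun k => contDiffOn_christoffel g x₀ k i j

lemma chrisCoord_apply (g : Metric M) (x₀ : M) (y a b : Plane) (k : Fin 2) :
    chrisCoord g x₀ y a b k = ∑ i, ∑ j, christoffel g x₀ k i j y * a i * b j := by
  rw [chrisCoord, bilin_apply]
  simp only [Fin.sum_univ_two, PiLp.add_apply, PiLp.smul_apply, smul_eq_mul]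
  ring

lemma pd_gMat_symm (g : Metric M) (x₀ : M) (y : Plane) (l i j : Fin 2) :
    pd l (fun z => gMat g x₀ z i j) y = pd l (fun z => gMat g x₀ z j i) y := by
  simp only [gMat_symm g x₀ _ i j]

lemma christoffel_symm (g : Metric M) (x₀ : M) (k i j : Fin 2) (y : Plane) :
    christoffel g x₀ k i j y = christoffel g x₀ k j i y := by
  unfold christoffel
  simp only [pd_gMat_symm g x₀ y _ i j]
  congr 1
  refine Finset.sum_congr rfl fun l _ => ?_
  ring

/-- Lowering the index cancels the inverse matrix in the definition and leaves the symbols of the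
first kind. -/
lemma gMat_christoffel (g : Metric M) {x₀ : M} {y : Plane} (hy : y ∈ dom x₀) (m i j : Fin 2) :
    ∑ k, gMat g x₀ y m k * christoffel g x₀ k i j y =
      (1 / 2) * (pd i (fun z => gMat g x₀ z j m) y + pd j (fun z => gMat g x₀ z i m) y
        - pd m (fun z => gMat g x₀ z i j) y) := by
  set c : Fin 2 → ℝ := fun l => pd i (fun z => gMat g x₀ z j l) y
    + pd j (fun z => gMat g x₀ z i l) y - pd l (fun z => gMat g x₀ z i j) y with hc
  have h : (gMat g x₀ y).mulVec ((gMat g x₀ y)⁻¹.mulVec c) = c := by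
    rw [Matrix.mulVec_mulVec, Matrix.mul_nonsing_inv _ (gMat_det_pos g hy).ne'.isUnit,
      Matrix.one_mulVec]
  have h2 := congrFun h m
  simp only [Matrix.mulVec, dotProduct] at h2
  unfold christoffel
  calc _ = (1 / 2) * ∑ k, gMat g x₀ y m k * ∑ l, (gMat g x₀ y)⁻¹ k l * c l := by
        rw [Finset.mul_sum]
        exact Finset.sum_congr rfl fun k _ => by simp only [hc]; ring
    _ = _ := by rw [h2]

lemma fderivWithin_metricCoord (g : Metric M) {x₀ : M} {y : Plane} (hy : y ∈ dom x₀)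
    (i j k : Fin 2) :
    fderivWithin ℝ (metricCoord g x₀) (dom x₀) y (stdVec i) (stdVec j) (stdVec k) =
      pd i (fun z => gMat g x₀ z j k) y := by
  have h := ((((contDiffOn_metricCoord g x₀ y hy).differentiableWithinAt
    (by simp)).hasFDerivWithinAt.clm_apply (hasFDerivWithinAt_const (stdVec j) y _)).clm_apply
      (hasFDerivWithinAt_const (stdVec k) y _))
  have h2 := h.fderivWithin (uniqueDiffOn_extChartAt_target x₀ y hy)
  simp only [← gMat_eq] at h2
  rw [pd, ← fderivWithin_dom hy, h2]
  simp

lemma chrisCoord_symm (g : Metric M) (x₀ : M) (y a b : Plane) :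
    chrisCoord g x₀ y a b = chrisCoord g x₀ y b a := by
  ext k
  rw [chrisCoord_apply, chrisCoord_apply, Finset.sum_comm]
  refine Finset.sum_congr rfl fun i _ => Finset.sum_congr rfl fun j _ => ?_
  rw [christoffel_symm]
  ring

lemma metricCoord_chrisCoord (g : Metric M) {x₀ : M} {y : Plane} (hy : y ∈ dom x₀)
    (i j k : Fin 2) :
    metricCoord g x₀ y (chrisCoord g x₀ y (stdVec i) (stdVec j)) (stdVec k) =
      (1 / 2) * (pd i (fun z => gMat g x₀ z j k) y + pd j (fun z => gMat g x₀ z i k) y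
        - pd k (fun z => gMat g x₀ z i j) y) := by
  rw [← gMat_christoffel g hy, plane_eq (chrisCoord g x₀ y (stdVec i) (stdVec j))]
  simp only [map_add, map_smul, add_apply, smul_apply, smul_eq_mul, ← gMat_eq, chrisCoord,
    bilin_stdVec, Fin.sum_univ_two, gMat_symm g x₀ y k]
  ring

/-- On basis vectors, two first-kind symbols with the last two indices exchanged are added; four of
the six derivatives cancel and the other two coincide. The general case follows by trilinearity. -/
lemma metricCoord_compat (g : Metric M) {x₀ : M} {y : Plane} (hy : y ∈ dom x₀) (a b c : Plane) :
    fderivWithin ℝ (metricCoord g x₀) (dom x₀) y a b c =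
      metricCoord g x₀ y (chrisCoord g x₀ y a b) c
        + metricCoord g x₀ y b (chrisCoord g x₀ y a c) := by
  have key : ∀ i j k, fderivWithin ℝ (metricCoord g x₀) (dom x₀) y (stdVec i) (stdVec j) (stdVec k)
      = metricCoord g x₀ y (chrisCoord g x₀ y (stdVec i) (stdVec j)) (stdVec k)
        + metricCoord g x₀ y (stdVec j) (chrisCoord g x₀ y (stdVec i) (stdVec k)) := by
    intro i j k
    rw [metricCoord_symm g x₀ y (stdVec j), metricCoord_chrisCoord g hy,
      metricCoord_chrisCoord g hy, fderivWithin_metricCoord g hy, pd_gMat_symm g x₀ y i k j,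
      pd_gMat_symm g x₀ y j i k, pd_gMat_symm g x₀ y k i j]
    ring
  rw [plane_eq a, plane_eq b, plane_eq c]
  simp only [map_add, map_smul, add_apply, smul_apply, smul_eq_mul, key]
  ring

end Coordinates

lemma det_plane (D : Plane →L[ℝ] Plane) :
    D.det = D (stdVec 0) 0 * D (stdVec 1) 1 - D (stdVec 1) 0 * D (stdVec 0) 1 := by
  rw [ContinuousLinearMap.det, ← LinearMap.det_toMatrix (EuclideanSpace.basisFun (Fin 2) ℝ).toBasis,
    Matrix.det_fin_two]
  simp [LinearMap.toMatrix_apply]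

/-! ### Orientation and the rotation by a right angle in a chart -/

section Coordinates

set_option linter.unusedSectionVars false

variable {M : Type*} [TopologicalSpace M] [ChartedSpace (EuclideanHalfSpace 2) M]
  [IsManifold (𝓡∂ 2) ∞ M]

lemma orientationSign_eq {x : M} (o : Orientation ℝ (TangentSpace (𝓡∂ 2) x) (Fin 2)) :
    orientationSign o = 1 ∨ orientationSign o = -1 := by
  unfold orientationSign
  split_ifs <;> simp

lemma det_tangentCoordChange_ne_zero {x₀ x₁ x : M} (h₀ : x ∈ (extChartAt (𝓡∂ 2) x₀).source)
    (h₁ : x ∈ (extChartAt (𝓡∂ 2) x₁).source) : (tangentCoordChange (𝓡∂ 2) x₀ x₁ x).det ≠ 0 := by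
  have h : (tangentCoordChange (𝓡∂ 2) x₁ x₀ x).comp (tangentCoordChange (𝓡∂ 2) x₀ x₁ x) =
      ContinuousLinearMap.id ℝ Plane := by
    ext1 a
    exact (tangentCoordChange_comp ⟨⟨h₀, h₁⟩, h₀⟩).trans (tangentCoordChange_self h₀)
  have h2 := congrArg ContinuousLinearMap.det h
  rw [ContinuousLinearMap.det, ContinuousLinearMap.toLinearMap_comp, LinearMap.det_comp] at h2
  intro h0
  change _ * (tangentCoordChange (𝓡∂ 2) x₀ x₁ x).det = _ at h2
  rw [h0, mul_zero] at h2
  simp [ContinuousLinearMap.det] at h2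

lemma det_tangentCoordChange_comp {x₀ x₁ x₂ x : M} (h₀ : x ∈ (extChartAt (𝓡∂ 2) x₀).source)
    (h₁ : x ∈ (extChartAt (𝓡∂ 2) x₁).source) (h₂ : x ∈ (extChartAt (𝓡∂ 2) x₂).source) :
    (tangentCoordChange (𝓡∂ 2) x₀ x₂ x).det =
      (tangentCoordChange (𝓡∂ 2) x₁ x₂ x).det * (tangentCoordChange (𝓡∂ 2) x₀ x₁ x).det := by
  have h : tangentCoordChange (𝓡∂ 2) x₀ x₂ x =
      (tangentCoordChange (𝓡∂ 2) x₁ x₂ x).comp (tangentCoordChange (𝓡∂ 2) x₀ x₁ x) := by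
    ext1 a
    exact (tangentCoordChange_comp ⟨⟨h₀, h₁⟩, h₂⟩).symm
  rw [h, ContinuousLinearMap.det, ContinuousLinearMap.toLinearMap_comp, LinearMap.det_comp]

/-- The sign of the orientation at `x` relative to the chart at `x₀`. -/
def chartSign (o : SurfaceOrientation M) (x₀ x : M) : ℝ :=
  open Classical in
  if 0 < (tangentCoordChange (𝓡∂ 2) x₀ x x).det then orientationSign (o.orient x)
  else -orientationSign (o.orient x)

lemma chartSign_eq (o : SurfaceOrientation M) (x₀ x : M) :
    chartSign o x₀ x = 1 ∨ chartSign o x₀ x = -1 := by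
  unfold chartSign
  rcases orientationSign_eq (o.orient x) with h | h <;> split_ifs <;> simp [h]

lemma chartSign_self (o : SurfaceOrientation M) (x : M) :
    chartSign o x x = orientationSign (o.orient x) := by
  unfold chartSign
  rw [if_pos]
  have h : tangentCoordChange (𝓡∂ 2) x x x = ContinuousLinearMap.id ℝ Plane := by
    ext1 a
    exact tangentCoordChange_self (mem_extChartAt_source x)
  rw [h]
  simp [ContinuousLinearMap.det]

lemma chartSign_mul_abs (o : SurfaceOrientation M) (x₀ x : M) :
    chartSign o x₀ x * |(tangentCoordChange (𝓡∂ 2) x₀ x x).det| =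
      orientationSign (o.orient x) * (tangentCoordChange (𝓡∂ 2) x₀ x x).det := by
  unfold chartSign
  split_ifs with h
  · rw [abs_of_pos h]
  · rw [abs_of_nonpos (not_lt.1 h)]
    ring

/-- Preferred charts may jump from point to point, and `orientationSign` jumps with them. Continuity
of the orientation says that near `x` it jumps with the sign of the Jacobian from the chart at `x`
to the chart at `x'`. By the cocycle relation the same factor occurs in the Jacobian from `x₀`, and
the other factor keeps its sign by continuity, so the two jumps compensate. -/
lemma chartSign_eventually (o : SurfaceOrientation M) {x₀ x : M}
    (hx : x ∈ (extChartAt (𝓡∂ 2) x₀).source) :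
    ∀ᶠ x' in nhds x, chartSign o x₀ x' = chartSign o x₀ x := by
  have hc : ContinuousAt (fun x' => (tangentCoordChange (𝓡∂ 2) x₀ x x').det) x := by
    have := (continuousOn_tangentCoordChange (I := 𝓡∂ 2) x₀ x).continuousAt
      (((isOpen_extChartAt_source x₀).inter (isOpen_extChartAt_source x)).mem_nhds
        ⟨hx, mem_extChartAt_source x⟩)
    exact ContinuousLinearMap.continuous_det.continuousAt.comp this
  have hne := det_tangentCoordChange_ne_zero hx (mem_extChartAt_source (I := 𝓡∂ 2) x)
  have hpos : ∀ᶠ x' in nhds x, 0 < (tangentCoordChange (𝓡∂ 2) x₀ x x').det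
      * (tangentCoordChange (𝓡∂ 2) x₀ x x).det :=
    (hc.mul continuousAt_const).eventually_const_lt (mul_self_pos.2 hne)
  filter_upwards [o.continuous x, hpos, (isOpen_extChartAt_source x₀).mem_nhds hx,
    extChartAt_source_mem_nhds (I := 𝓡∂ 2) x] with x' h1 h2 h3 h4
  have hcomp := det_tangentCoordChange_comp h3 h4 (mem_extChartAt_source (I := 𝓡∂ 2) x')
  unfold chartSign
  rw [hcomp]
  generalize (tangentCoordChange (𝓡∂ 2) x x' x').det = a at *
  generalize (tangentCoordChange (𝓡∂ 2) x₀ x x').det = b at *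
  generalize (tangentCoordChange (𝓡∂ 2) x₀ x x).det = c at *
  have h5 : 0 < c ↔ 0 < b := by
    constructor
    · exact fun h => (pos_iff_pos_of_mul_pos h2).2 h
    · exact fun h => (pos_iff_pos_of_mul_pos h2).1 h
  have hb : b ≠ 0 := left_ne_zero_of_mul h2.ne'
  rcases orientationSign_eq (o.orient x) with e | e <;>
  rcases orientationSign_eq (o.orient x') with e' | e' <;> rw [e, e'] at h1 ⊢ <;>
  rcases lt_or_gt_of_ne hb with hb | hb
  all_goals
    first
    | (have ha : 0 < a := by linarith)
    | (have ha : a < 0 := by linarith)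
    simp only [h5, mul_pos_iff, ha, hb, not_lt_of_gt ha, not_lt_of_gt hb, and_self, or_self,
      and_false, false_and, or_true, or_false, if_true, if_false, neg_neg]

/-- The rotation by a right angle in the chart at `x₀`. -/
def rotCoord (g : Metric M) (o : SurfaceOrientation M) (x₀ : M) (y : Plane) : Plane →L[ℝ] Plane :=
  (chartSign o x₀ (pt x₀ y) / Real.sqrt (gMat g x₀ y).det) •
    ((EuclideanSpace.proj 0 : Plane →L[ℝ] ℝ).smulRight (!₂[-gMat g x₀ y 0 1, gMat g x₀ y 0 0])
      + (EuclideanSpace.proj 1 : Plane →L[ℝ] ℝ).smulRight !₂[-gMat g x₀ y 1 1, gMat g x₀ y 0 1])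

lemma rotCoord_zero (g : Metric M) (o : SurfaceOrientation M) (x₀ : M) (y a : Plane) :
    rotCoord g o x₀ y a 0 = (chartSign o x₀ (pt x₀ y) / Real.sqrt (gMat g x₀ y).det) *
      -(gMat g x₀ y 0 1 * a 0 + gMat g x₀ y 1 1 * a 1) := by
  simp [rotCoord]; ring

lemma rotCoord_one (g : Metric M) (o : SurfaceOrientation M) (x₀ : M) (y a : Plane) :
    rotCoord g o x₀ y a 1 = (chartSign o x₀ (pt x₀ y) / Real.sqrt (gMat g x₀ y).det) *
      (gMat g x₀ y 0 0 * a 0 + gMat g x₀ y 0 1 * a 1) := by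
  simp [rotCoord]; ring

lemma sq_chartSign_div (g : Metric M) (o : SurfaceOrientation M) {x₀ : M} {y : Plane}
    (hy : y ∈ dom x₀) :
    (chartSign o x₀ (pt x₀ y) / Real.sqrt (gMat g x₀ y).det) ^ 2 * (gMat g x₀ y).det = 1 := by
  have h := gMat_det_pos g hy
  rw [div_pow, Real.sq_sqrt h.le]
  rcases chartSign_eq o x₀ (pt x₀ y) with e | e <;> rw [e] <;> field_simp

lemma isRotation (g : Metric M) (o : SurfaceOrientation M) {x₀ : M} {y : Plane}
    (hy : y ∈ dom x₀) : IsRotation (metricCoord g x₀ y) (rotCoord g o x₀ y) where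
  symm := metricCoord_symm g x₀ y
  pos _ ha := metricCoord_pos g hy ha
  sq a := by
    have h := sq_chartSign_div g o hy
    rw [gMat_det] at h
    ext i
    fin_cases i
    · change rotCoord g o x₀ y _ 0 = -a 0
      rw [rotCoord_zero, rotCoord_zero, rotCoord_one, gMat_det]
      linear_combination (-a 0) * h
    · change rotCoord g o x₀ y _ 1 = -a 1
      rw [rotCoord_one, rotCoord_zero, rotCoord_one, gMat_det]
      linear_combination (-a 1) * h
  skew a := by
    rw [metricCoord, bilin_apply]
    simp only [Fin.sum_univ_two, rotCoord_zero, rotCoord_one, smul_eq_mul, gMat_symm g x₀ y 1 0]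
    ring

lemma contDiffOn_rotCoord (g : Metric M) (o : SurfaceOrientation M) (x₀ : M) :
    ContDiffOn ℝ ∞ (rotCoord g o x₀) (dom x₀) := by
  have hv : ∀ {f h : Plane → ℝ}, ContDiffOn ℝ ∞ f (dom x₀) → ContDiffOn ℝ ∞ h (dom x₀) →
      ContDiffOn ℝ ∞ (fun y => (!₂[f y, h y] : Plane)) (dom x₀) := fun hf hh =>
    contDiffOn_euclidean.2 fun i => by
      fin_cases i
      · exact hf
      · exact hh
  intro y hy
  -- The sign is frozen at its value at `y`, to which it is equal near `y`; what remains is an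
  -- explicit smooth function of the metric coefficients.
  have h1 : ContDiffOn ℝ ∞ (fun y' => (chartSign o x₀ (pt x₀ y) / Real.sqrt (gMat g x₀ y').det) •
    ((EuclideanSpace.proj 0 : Plane →L[ℝ] ℝ).smulRight
        (!₂[-gMat g x₀ y' 0 1, gMat g x₀ y' 0 0] : Plane)
      + (EuclideanSpace.proj 1 : Plane →L[ℝ] ℝ).smulRight
        (!₂[-gMat g x₀ y' 1 1, gMat g x₀ y' 0 1] : Plane))) (dom x₀) := by
    refine ContDiffOn.smul (contDiffOn_const.div ((contDiffOn_gMat_det g x₀).sqrt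
      fun y hy => (gMat_det_pos g hy).ne') fun y hy => (Real.sqrt_pos.2 (gMat_det_pos g hy)).ne')
      (ContDiffOn.add (contDiffOn_const.smulRight (hv ?_ ?_))
        (contDiffOn_const.smulRight (hv ?_ ?_)))
    exacts [(contDiffOn_gMat g x₀ 0 1).neg, contDiffOn_gMat g x₀ 0 0,
      (contDiffOn_gMat g x₀ 1 1).neg, contDiffOn_gMat g x₀ 0 1]
  have h2 : ∀ᶠ y' in nhdsWithin y (dom x₀),
      chartSign o x₀ (pt x₀ y') = chartSign o x₀ (pt x₀ y) :=
    (continuousOn_extChartAt_symm x₀ y hy).eventually (chartSign_eventually o (pt_mem hy))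
  refine (h1 y hy).congr_of_eventuallyEq ?_ rfl
  filter_upwards [h2] with y' hy'
  rw [rotCoord, hy']

lemma localGeometry (g : Metric M) (o : SurfaceOrientation M) (x₀ : M) :
    LocalGeometry (dom x₀) (metricCoord g x₀) (chrisCoord g x₀) (rotCoord g o x₀) where
  uniqueDiff := uniqueDiffOn_extChartAt_target x₀
  dense _ hy := extChartAt_target_subset_closure_interior hy
  smoothG := contDiffOn_metricCoord g x₀
  smoothΓ := contDiffOn_chrisCoord g x₀
  smoothJ := contDiffOn_rotCoord g o x₀
  rotation _ hy := isRotation g o hy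
  symmΓ y _ := chrisCoord_symm g x₀ y
  compat _ hy := metricCoord_compat g hy

lemma metricCoord_transition (g : Metric M) {x₀ x₁ : M} {y : Plane} (hy : y ∈ dom x₀)
    (hy' : pt x₀ y ∈ (extChartAt (𝓡∂ 2) x₁).source) (a b : Plane) :
    metricCoord g x₁ (transition x₀ x₁ y) (jac x₀ x₁ y a) (jac x₀ x₁ y b) =
      metricCoord g x₀ y a b := by
  rw [metricCoord_apply, metricCoord_apply, pt_transition hy', vec_jac hy hy', vec_jac hy hy']

lemma metricCoord_entries (g : Metric M) (x₀ : M) (y a b : Plane) :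
    metricCoord g x₀ y a b = gMat g x₀ y 0 0 * a 0 * b 0 + gMat g x₀ y 0 1 * (a 0 * b 1 + a 1 * b 0)
      + gMat g x₀ y 1 1 * a 1 * b 1 := by
  rw [metricCoord, bilin_apply]
  simp only [Fin.sum_univ_two, smul_eq_mul, gMat_symm g x₀ y 1 0]
  ring

/-- The two Gram matrices are congruent through the Jacobian of the transition map. -/
lemma gMat_det_transition (g : Metric M) {x₀ x₁ : M} {y : Plane} (hy : y ∈ dom x₀)
    (hy' : pt x₀ y ∈ (extChartAt (𝓡∂ 2) x₁).source) :
    (gMat g x₀ y).det = (jac x₀ x₁ y).det ^ 2 * (gMat g x₁ (transition x₀ x₁ y)).det := by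
  rw [gMat_det g x₀, gMat_det g x₁, det_plane]
  simp only [gMat_eq g x₀, ← metricCoord_transition g hy hy']
  simp only [metricCoord_entries g x₁]
  ring

lemma plane_ext {a b : Plane} (h0 : a 0 = b 0) (h1 : a 1 = b 1) : a = b := by
  ext i
  fin_cases i
  · exact h0
  · exact h1

/-- The rotation was defined in the preferred chart at each point; this shows that the same formula
holds in every chart, with `chartSign` in place of `orientationSign`. -/
lemma rot_vec (g : Metric M) (o : SurfaceOrientation M) {x₀ : M} {y : Plane} (hy : y ∈ dom x₀)
    (a : Plane) :
    rot g o (pt x₀ y) (vec x₀ (pt x₀ y) a) = vec x₀ (pt x₀ y) (rotCoord g o x₀ y a) := by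
  set x := pt x₀ y with hx
  have hxx : pt x₀ y ∈ (extChartAt (𝓡∂ 2) x).source := mem_extChartAt_source x
  have hD : ∀ a, @Eq Plane (vec x₀ x a) (jac x₀ x y a) := fun a => by
    rw [jac_pt hy]
    exact vec_apply (pt_mem hy) a
  have hrot : rot g o x (vec x₀ x a) = rot g o x (jac x₀ x y a : Plane) :=
    congrArg (fun v : Plane => rot g o x v) (hD a)
  refine hrot.trans (Eq.trans ?_ (hD _).symm)
  have hd := gMat_det_transition g hy hxx
  have hs := chartSign_mul_abs o x₀ (pt x₀ y)
  rw [← jac_pt hy, ← hx] at hs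
  have hpos := gMat_det_pos g (mem_extChartAt_target (I := 𝓡∂ 2) x)
  have e1 : transition x₀ x y = extChartAt (𝓡∂ 2) x x := rfl
  have hG := metricCoord_transition g hy hxx
  rw [e1] at hd hG
  have hdne : (jac x₀ x y).det ≠ 0 := by
    rw [jac_pt hy]
    exact det_tangentCoordChange_ne_zero (pt_mem hy) hxx
  have hsq : Real.sqrt (gMat g x₀ y).det =
      |(jac x₀ x y).det| * Real.sqrt (gMat g x (extChartAt (𝓡∂ 2) x x)).det := by
    rw [hd, Real.sqrt_mul (sq_nonneg _), Real.sqrt_sq_eq_abs]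
  -- The root of det g scales by the absolute value of the Jacobian determinant, and `chartSign`
  -- carries its sign, so the scalar prefactors differ by exactly that determinant. The rest is a
  -- polynomial identity in the entries of the Jacobian and of the metric.
  have hc : chartSign o x₀ x / Real.sqrt (gMat g x₀ y).det * (jac x₀ x y).det =
      orientationSign (o.orient x) / Real.sqrt (gMat g x (extChartAt (𝓡∂ 2) x x)).det := by
    rw [hsq]
    have h1 := (Real.sqrt_pos.2 hpos).ne'
    have h2 := abs_ne_zero.2 hdne
    rw [div_mul_eq_mul_div, div_eq_div_iff (mul_ne_zero h2 h1) h1]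
    rcases lt_or_gt_of_ne hdne with h | h
    · rw [abs_of_neg h] at hs ⊢
      linear_combination (-Real.sqrt (gMat g x (extChartAt (𝓡∂ 2) x x)).det) * hs
    · rw [abs_of_pos h] at hs ⊢
      linear_combination (Real.sqrt (gMat g x (extChartAt (𝓡∂ 2) x x)).det) * hs
  have hG' : ∀ i j, gMat g x₀ y i j = _ := fun i j => by
    rw [gMat_eq, ← hG, metricCoord_entries]
  have hDa : ∀ (b : Plane) (i : Fin 2), jac x₀ x y b i =
      b 0 * jac x₀ x y (stdVec 0) i + b 1 * jac x₀ x y (stdVec 1) i := fun b i => by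
    conv_lhs => rw [plane_eq b]
    simp
  unfold rot
  simp only
  rw [← hc]
  refine plane_ext ?_ ?_
  · rw [hDa (rotCoord g o x₀ y a), rotCoord_zero, rotCoord_one]
    simp only [PiLp.smul_apply, smul_eq_mul, hDa a, hG', det_plane, ← hx]
    simp
    ring
  · rw [hDa (rotCoord g o x₀ y a), rotCoord_zero, rotCoord_one]
    simp only [PiLp.smul_apply, smul_eq_mul, hDa a, hG', det_plane, ← hx]
    simp
    ring

end Coordinates

section Coordinates

set_option linter.unusedSectionVars false

variable {M : Type*} [TopologicalSpace M] [ChartedSpace (EuclideanHalfSpace 2) M]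
  [IsManifold (𝓡∂ 2) ∞ M] {F : Type*}

/-! ### Functions on the unit tangent bundle in coordinates -/

section Ext

variable [Zero F]

lemma ext_of_ne_zero (g : Metric M) (u : SM g → F) {p : TM M} (hp : p.2 ≠ 0) :
    ext g u p = u (normalize g p hp) := by
  unfold ext
  rw [dif_pos hp]

lemma snd_ne_zero {g : Metric M} (p : SM g) : p.1.2 ≠ 0 := by
  intro h
  have := p.2
  rw [h] at this
  simp at this

lemma ext_coe (g : Metric M) (u : SM g → F) (p : SM g) : ext g u p.1 = u p := by
  rw [ext_of_ne_zero g u (snd_ne_zero p)]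
  congr 1
  apply Subtype.ext
  unfold normalize
  simp only [p.2, Real.sqrt_one, inv_one, one_smul]

lemma ext_smul (g : Metric M) (u : SM g → F) {c : ℝ} (hc : 0 < c) (x : M)
    (v : TangentSpace (𝓡∂ 2) x) : ext g u ⟨x, c • v⟩ = ext g u ⟨x, v⟩ := by
  by_cases hv : v = 0
  · rw [hv, smul_zero]
  · rw [ext_of_ne_zero g u (p := ⟨x, v⟩) hv,
      ext_of_ne_zero g u (p := ⟨x, c • v⟩) (smul_ne_zero hc.ne' hv)]
    congr 1
    apply Subtype.ext
    unfold normalize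
    simp only [map_smul, smul_apply, smul_eq_mul]
    congr 1
    rw [← mul_assoc, Real.sqrt_mul (mul_self_nonneg c), Real.sqrt_mul_self hc.le, smul_smul,
      mul_inv]
    congr 1
    field_simp

end Ext

/-- A function on the unit tangent bundle, extended by homogeneity and written in the coordinates
of the chart at `x₀`. -/
def loc [Zero F] (g : Metric M) (x₀ : M) (u : SM g → F) (z : Plane × Plane) : F :=
  ext g u (lift x₀ z)

lemma loc_smul [Zero F] (g : Metric M) (x₀ : M) (u : SM g → F) {c : ℝ} (hc : 0 < c)
    (y w : Plane) : loc g x₀ u (y, c • w) = loc g x₀ u (y, w) := by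
  unfold loc lift
  simp only [map_smul]
  exact ext_smul g u hc _ _

lemma lift_snd_ne_zero {x₀ : M} {z : Plane × Plane} (hz : z ∈ punctured (dom x₀)) :
    (lift x₀ z).2 ≠ 0 :=
  vec_ne_zero (pt_mem hz.1) hz.2

lemma inner_lift (g : Metric M) (x₀ : M) (z : Plane × Plane) :
    g.inner (lift x₀ z).1 (lift x₀ z).2 (lift x₀ z).2 = metricCoord g x₀ z.1 z.2 z.2 :=
  (metricCoord_apply g x₀ z.1 z.2 z.2).symm

/-- In the chart at `p` the fibre coordinate is a linear image of the vector and depends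
continuously on the point of `TM`, so it stays nonzero near `p`. -/
lemma isOpen_snd_ne_zero : IsOpen {p : TM M | p.2 ≠ 0} := by
  rw [isOpen_iff_mem_nhds]
  intro p hp
  have hc := continuousAt_extChartAt (I := (𝓡∂ 2).tangent) p
  have h0 : (extChartAt (𝓡∂ 2).tangent p p).2 ≠ 0 := by
    rw [extChartAt_tangent_self]
    exact hp
  have h1 : ∀ᶠ q in nhds p, (extChartAt (𝓡∂ 2).tangent p q).2 ≠ 0 :=
    (continuous_snd.continuousAt.comp hc).eventually_ne h0
  filter_upwards [h1] with q hq h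
  apply hq
  rw [extChartAt_tangent_apply]
  change tangentCoordChange (𝓡∂ 2) q.1 p.1 q.1 (q.2 : Plane) = 0
  have : (q.2 : Plane) = (0 : Plane) := h
  rw [this, map_zero]

lemma lift_extChartAt (p q : TM M) (hq : q.1 ∈ (extChartAt (𝓡∂ 2) p.1).source) :
    lift p.1 (extChartAt (𝓡∂ 2).tangent p q) = q := by
  have hs : q ∈ (extChartAt (𝓡∂ 2).tangent p).source := by
    rw [extChartAt_source] at hq ⊢
    rwa [TangentBundle.mem_chart_source_iff]
  have h1 := (extChartAt (𝓡∂ 2).tangent p).left_inv hs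
  have h2 := (extChartAt (𝓡∂ 2).tangent p).map_source hs
  rw [extChartAt_tangent_target] at h2
  rwa [extChartAt_tangent_symm p h2.1] at h1

variable [NormedAddCommGroup F] [NormedSpace ℝ F]

/-- Smoothness on the unit tangent bundle, in coordinates. -/
lemma isSmooth_iff (g : Metric M) (u : SM g → F) :
    IsSmooth g u ↔ ∀ x₀ : M, ContDiffOn ℝ ∞ (loc g x₀ u) (punctured (dom x₀)) := by
  constructor
  · intro h x₀
    rw [← contMDiffOn_iff_contDiffOn]
    exact ContMDiffOn.comp h ((contMDiffOn_lift x₀).mono (Set.prod_mono le_rfl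
      (Set.subset_univ _))) (fun z hz => lift_snd_ne_zero hz)
  · intro h p hp
    apply ContMDiffAt.contMDiffWithinAt
    have h1 := h p.1
    rw [← contMDiffOn_iff_contDiffOn] at h1
    have hpz : extChartAt (𝓡∂ 2).tangent p p ∈ punctured (dom p.1) := by
      rw [extChartAt_tangent_self]
      exact ⟨mem_extChartAt_target p.1, hp⟩
    have hnear : ∀ᶠ q in nhds p, q.1 ∈ (extChartAt (𝓡∂ 2) p.1).source ∧
        extChartAt (𝓡∂ 2).tangent p q ∈ punctured (dom p.1) := by
      have e1 : ∀ᶠ q in nhds p, (extChartAt (𝓡∂ 2).tangent p q).2 ≠ 0 :=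
        (continuous_snd.continuousAt.comp
          (continuousAt_extChartAt (I := (𝓡∂ 2).tangent) p)).eventually_ne hpz.2
      filter_upwards [extChartAt_source_mem_nhds (I := (𝓡∂ 2).tangent) p, e1] with q hq hq2
      have hq1 := (extChartAt (𝓡∂ 2).tangent p).map_source hq
      rw [extChartAt_tangent_target] at hq1
      rw [extChartAt_source, TangentBundle.mem_chart_source_iff] at hq
      rw [extChartAt_source]
      exact ⟨hq, hq1.1, hq2⟩
    have h2 : ContMDiffWithinAt (𝓡∂ 2).tangent 𝓘(ℝ, F) ∞
        (MagneticSurface.loc g p.1 u ∘ extChartAt (𝓡∂ 2).tangent p)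
        (extChartAt (𝓡∂ 2).tangent p ⁻¹' punctured (dom p.1)) p :=
      ContMDiffWithinAt.comp p (h1 _ hpz)
        (contMDiffAt_extChartAt (I := (𝓡∂ 2).tangent) (n := ∞) (x := p)).contMDiffWithinAt
        (Set.mapsTo_preimage _ _)
    replace h2 := h2.contMDiffAt (by filter_upwards [hnear] with q hq using hq.2)
    refine h2.congr_of_eventuallyEq ?_
    filter_upwards [hnear] with q hq
    simp only [Function.comp_apply, loc, lift_extChartAt p q hq.1]

lemma IsSmooth.loc {g : Metric M} {u : SM g → F} (hu : IsSmooth g u) (x₀ : M) :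
    ContDiffOn ℝ ∞ (loc g x₀ u) (punctured (dom x₀)) :=
  (isSmooth_iff g u).1 hu x₀

/-- The derivative of the relation u(y, c w) = u(y, w). -/
lemma fderivWithin_loc_smul {g : Metric M} (o : SurfaceOrientation M) {u : SM g → F}
    (hu : IsSmooth g u) {x₀ : M}
    {z : Plane × Plane} (hz : z ∈ punctured (dom x₀)) {c : ℝ} (hc : 0 < c) (v : Plane × Plane) :
    fderivWithin ℝ (loc g x₀ u) (punctured (dom x₀)) (z.1, c • z.2) (v.1, c • v.2) =
      fderivWithin ℝ (loc g x₀ u) (punctured (dom x₀)) z v := by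
  have hz' : (z.1, c • z.2) ∈ punctured (dom x₀) := ⟨hz.1, smul_ne_zero hc.ne' hz.2⟩
  have h1 : HasFDerivWithinAt (fun z : Plane × Plane => (z.1, c • z.2))
      ((ContinuousLinearMap.fst ℝ Plane Plane).prod (c • ContinuousLinearMap.snd ℝ Plane Plane))
      (punctured (dom x₀)) z :=
    hasFDerivWithinAt_fst.prodMk (hasFDerivWithinAt_snd.const_smul c)
  have hmaps : Set.MapsTo (fun z : Plane × Plane => (z.1, c • z.2)) (punctured (dom x₀))
      (punctured (dom x₀)) := fun z hz => ⟨hz.1, smul_ne_zero hc.ne' hz.2⟩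
  have h2 := (((hu.loc x₀) _ hz').differentiableWithinAt (by simp)).hasFDerivWithinAt.comp z h1 hmaps
  have h3 : loc g x₀ u ∘ (fun z : Plane × Plane => (z.1, c • z.2)) = loc g x₀ u := by
    funext z
    exact loc_smul g x₀ u hc z.1 z.2
  rw [h3] at h2
  rw [h2.fderivWithin ((localGeometry g o x₀).uniqueDiff_punctured z hz)]
  rfl

end Coordinates

section Coordinates

set_option linter.unusedSectionVars false

variable {M : Type*} [TopologicalSpace M] [ChartedSpace (EuclideanHalfSpace 2) M]
  [IsManifold (𝓡∂ 2) ∞ M] {F : Type*} [NormedAddCommGroup F] [NormedSpace ℝ F]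

/-! ### Change of chart -/

lemma tendsto_transition {x₀ x₁ : M} {y : Plane} (hy : y ∈ dom x₀)
    (hy' : pt x₀ y ∈ (extChartAt (𝓡∂ 2) x₁).source) :
    Filter.Tendsto (transition x₀ x₁) (nhdsWithin y (dom x₀))
      (nhdsWithin (transition x₀ x₁ y) (dom x₁)) := by
  refine tendsto_nhdsWithin_iff.2 ⟨(hasFDerivWithinAt_transition hy hy').continuousWithinAt, ?_⟩
  filter_upwards [eventually_mem_source hy hy'] with y' h using transition_mem h

lemma hasFDerivWithinAt_jac {x₀ x₁ : M} {y : Plane} (hy : y ∈ dom x₀)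
    (hy' : pt x₀ y ∈ (extChartAt (𝓡∂ 2) x₁).source) :
    HasFDerivWithinAt (jac x₀ x₁) (fderivWithin ℝ (jac x₀ x₁) (dom x₀) y) (dom x₀) y :=
  ((contDiffWithinAt_jac hy hy').differentiableWithinAt (by simp)).hasFDerivWithinAt

/-- The transformation law of the Christoffel symbols, on the diagonal. -/
lemma chrisCoord_transition (g : Metric M) {x₀ x₁ : M} {y : Plane} (hy : y ∈ dom x₀)
    (hy' : pt x₀ y ∈ (extChartAt (𝓡∂ 2) x₁).source) (w : Plane) :
    jac x₀ x₁ y (chrisCoord g x₀ y w w) =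
      chrisCoord g x₁ (transition x₀ x₁ y) (jac x₀ x₁ y w) (jac x₀ x₁ y w)
        + fderivWithin ℝ (jac x₀ x₁) (dom x₀) y w w := by
  have hu := uniqueDiffOn_extChartAt_target (I := 𝓡∂ 2) x₀ y hy
  have hy₁ := transition_mem hy'
  set D := jac x₀ x₁ y with hD
  set D2 := fderivWithin ℝ (jac x₀ x₁) (dom x₀) y with hD2
  set y₁ := transition x₀ x₁ y with hy₁_def
  -- the derivative of the transformation law of the metric
  have key : ∀ a b c, metricCoord g x₀ y (chrisCoord g x₀ y a b) c
      + metricCoord g x₀ y b (chrisCoord g x₀ y a c) =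
      metricCoord g x₁ y₁ (chrisCoord g x₁ y₁ (D a) (D b)) (D c)
      + metricCoord g x₁ y₁ (D b) (chrisCoord g x₁ y₁ (D a) (D c))
      + metricCoord g x₁ y₁ (D2 a b) (D c) + metricCoord g x₁ y₁ (D b) (D2 a c) := by
    intro a b c
    have hG1 : HasFDerivWithinAt (metricCoord g x₁)
        (fderivWithin ℝ (metricCoord g x₁) (dom x₁) (transition x₀ x₁ y))
        (dom x₁) (transition x₀ x₁ y) := ((contDiffOn_metricCoord g x₁ y₁ hy₁).differentiableWithinAt
          (by simp)).hasFDerivWithinAt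
    have hG0 := ((contDiffOn_metricCoord g x₀ y hy).differentiableWithinAt
      (by simp)).hasFDerivWithinAt
    have h1 := HasFDerivWithinAt.comp_of_tendsto (G := Plane →L[ℝ] Plane →L[ℝ] ℝ)
      (g := metricCoord g x₁) (f := transition x₀ x₁) y hG1 (hasFDerivWithinAt_transition hy hy')
      (tendsto_transition hy hy')
    have hJ := hasFDerivWithinAt_jac hy hy'
    have h2 := (h1.clm_apply (hJ.clm_apply (hasFDerivWithinAt_const b y _))).clm_apply
      (hJ.clm_apply (hasFDerivWithinAt_const c y _))
    have h3 := (hG0.clm_apply (hasFDerivWithinAt_const b y _)).clm_apply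
      (hasFDerivWithinAt_const c y _)
    have h4 := h2.congr_of_eventuallyEq (f₁ := fun y => metricCoord g x₀ y b c) (by
      filter_upwards [eventually_mem_source hy hy', self_mem_nhdsWithin] with y' h h'
      exact (metricCoord_transition g h' h b c).symm) (metricCoord_transition g hy hy' b c).symm
    have h5 := congrArg (fun L : Plane →L[ℝ] ℝ => L a) (hu.eq h3 h4)
    simp only [ContinuousLinearMap.comp_zero, zero_add, add_apply, ContinuousLinearMap.comp_apply,
      ContinuousLinearMap.flip_apply, metricCoord_compat g hy, Function.comp_apply] at h5
    rw [h5]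
    simp only [← hD, ← hD2, ← hy₁_def, metricCoord_compat g hy₁]
    ring
  -- The Koszul combination: `key` at (w, w, b) minus half of `key` at (b, w, w). The symmetry of Γ
  -- and of the second derivative of the transition map isolates the terms quadratic in `w`.
  have hne : ∀ b, metricCoord g x₁ y₁ (D (chrisCoord g x₀ y w w)
      - (chrisCoord g x₁ y₁ (D w) (D w) + D2 w w)) (D b) = 0 := by
    intro b
    have h1 := key w w b
    have h2 := key b w w
    have h3 := metricCoord_transition g hy hy' (chrisCoord g x₀ y w w) b
    have hs : D2 b w = D2 w b := fderivWithin_jac_symm hy hy' b w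
    rw [hs, chrisCoord_symm g x₀ y b w, chrisCoord_symm g x₁ y₁ (D b) (D w),
      metricCoord_symm g x₀ y (chrisCoord g x₀ y w b) w,
      metricCoord_symm g x₁ y₁ (chrisCoord g x₁ y₁ (D w) (D b)) (D w),
      metricCoord_symm g x₁ y₁ (D2 w b) (D w)] at h2
    simp only [map_sub, map_add, sub_apply, add_apply, ← hD, ← hy₁_def] at h3 ⊢
    linarith
  have hinj : Function.Injective D := jac_injective hy hy'
  -- The Jacobian is onto, so the difference may be paired with itself; positivity of the metric
  -- then makes it zero.
  obtain ⟨b, hb⟩ := (LinearMap.injective_iff_surjective (f := (D : Plane →ₗ[ℝ] Plane))).1 hinj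
    (D (chrisCoord g x₀ y w w) - (chrisCoord g x₁ y₁ (D w) (D w) + D2 w w))
  have h0 := hne b
  change D b = _ at hb
  rw [hb] at h0
  by_contra hcon
  exact (metricCoord_pos g hy₁ (sub_ne_zero.2 hcon)).ne' h0

/-- Change of chart for the derivative of a function on the tangent bundle. -/
lemma fderivWithin_loc_transition {g : Metric M} (o : SurfaceOrientation M) {u : SM g → F}
    (hu : IsSmooth g u) {x₀ x₁ : M} {z : Plane × Plane} (hz : z ∈ punctured (dom x₀))
    (hz' : pt x₀ z.1 ∈ (extChartAt (𝓡∂ 2) x₁).source) (v : Plane × Plane) :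
    fderivWithin ℝ (loc g x₀ u) (punctured (dom x₀)) z v =
      fderivWithin ℝ (loc g x₁ u) (punctured (dom x₁))
        (transition x₀ x₁ z.1, jac x₀ x₁ z.1 z.2)
        (jac x₀ x₁ z.1 v.1,
          fderivWithin ℝ (jac x₀ x₁) (dom x₀) z.1 v.1 z.2 + jac x₀ x₁ z.1 v.2) := by
  have hz1 : (transition x₀ x₁ z.1, jac x₀ x₁ z.1 z.2) ∈ punctured (dom x₁) :=
    ⟨transition_mem hz', fun h => hz.2 (jac_injective hz.1 hz' (by
      rw [map_zero]; exact h))⟩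
  have h1 := LocalGeometry.comp_fst (z := z) (hasFDerivWithinAt_transition hz.1 hz')
  have h2 := (LocalGeometry.comp_fst (z := z) (hasFDerivWithinAt_jac hz.1 hz')).clm_apply
    (hasFDerivWithinAt_snd (𝕜 := ℝ))
  have h3 := h1.prodMk h2
  have hev : ∀ᶠ z' in nhdsWithin z (punctured (dom x₀)),
      pt x₀ z'.1 ∈ (extChartAt (𝓡∂ 2) x₁).source := by
    have : Filter.Tendsto (fun z : Plane × Plane => z.1) (nhdsWithin z (punctured (dom x₀)))
        (nhdsWithin z.1 (dom x₀)) :=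
      continuous_fst.continuousWithinAt.tendsto_nhdsWithin (fun _ h => h.1)
    exact this.eventually (eventually_mem_source hz.1 hz')
  have ht : Filter.Tendsto
      (fun z : Plane × Plane => (transition x₀ x₁ z.1, jac x₀ x₁ z.1 z.2))
      (nhdsWithin z (punctured (dom x₀)))
      (nhdsWithin (transition x₀ x₁ z.1, jac x₀ x₁ z.1 z.2) (punctured (dom x₁))) := by
    refine tendsto_nhdsWithin_iff.2 ⟨h3.continuousWithinAt, ?_⟩
    filter_upwards [hev, self_mem_nhdsWithin] with z' h h'
    exact ⟨transition_mem h, fun h0 => h'.2 (jac_injective h'.1 h (by rw [map_zero]; exact h0))⟩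
  have h4 := HasFDerivWithinAt.comp_of_tendsto z
    ((hu.loc x₁ _ hz1).differentiableWithinAt (by simp)).hasFDerivWithinAt h3 ht
  have h5 := h4.congr_of_eventuallyEq (f₁ := loc g x₀ u) (by
    filter_upwards [hev, self_mem_nhdsWithin] with z' h h'
    simp only [Function.comp_apply, loc, lift_transition h'.1 h]) (by
    simp only [Function.comp_apply, loc, lift_transition hz.1 hz'])
  rw [h5.fderivWithin ((localGeometry g o x₀).uniqueDiff_punctured z hz)]
  simp only [ContinuousLinearMap.comp_apply, ContinuousLinearMap.prod_apply, add_apply,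
    ContinuousLinearMap.coe_fst', ContinuousLinearMap.coe_snd', ContinuousLinearMap.flip_apply]
  congr 2
  abel

/-- The geodesic spray does not depend on the chart. -/
lemma fderivWithin_loc_spray {g : Metric M} (o : SurfaceOrientation M) {u : SM g → F}
    (hu : IsSmooth g u) {x₀ x₁ : M} {z : Plane × Plane} (hz : z ∈ punctured (dom x₀))
    (hz' : pt x₀ z.1 ∈ (extChartAt (𝓡∂ 2) x₁).source) :
    fderivWithin ℝ (loc g x₀ u) (punctured (dom x₀)) z (sprayField (chrisCoord g x₀) z) =
      fderivWithin ℝ (loc g x₁ u) (punctured (dom x₁))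
        (transition x₀ x₁ z.1, jac x₀ x₁ z.1 z.2)
        (sprayField (chrisCoord g x₁) (transition x₀ x₁ z.1, jac x₀ x₁ z.1 z.2)) := by
  rw [fderivWithin_loc_transition o hu hz hz']
  congr 1
  simp only [sprayField, map_neg, chrisCoord_transition g hz.1 hz']
  congr 1
  abel

/-- The derivative along the spray in the preferred chart. -/
lemma mfderiv_spray {g : Metric M} {u : SM g → F} (hu : IsSmooth g u)
    (x : M) {v : Plane} (hv : v ≠ 0) :
    mfderiv (𝓡∂ 2).tangent 𝓘(ℝ, F) (ext g u) (⟨x, v⟩ : TM M) (spray g ⟨x, v⟩) =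
      fderivWithin ℝ (loc g x u) (punctured (dom x)) (extChartAt (𝓡∂ 2) x x, v)
        (sprayField (chrisCoord g x) (extChartAt (𝓡∂ 2) x x, v)) := by
  have hd : MDifferentiableAt (𝓡∂ 2).tangent 𝓘(ℝ, F) (ext g u) (⟨x, v⟩ : TM M) :=
    (ContMDiffOn.contMDiffAt hu (isOpen_snd_ne_zero.mem_nhds hv)).mdifferentiableAt (by simp)
  have hz : (extChartAt (𝓡∂ 2) x x, v) ∈ punctured (dom x) := ⟨mem_extChartAt_target x, hv⟩
  have h0 : extChartAt (𝓡∂ 2).tangent (⟨x, v⟩ : TM M) (⟨x, v⟩ : TM M) =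
      (extChartAt (𝓡∂ 2) x x, v) := extChartAt_tangent_self _
  -- Near a nonzero vector the punctured chart domain and the model range coincide as germs, so the
  -- manifold derivative is the derivative within `punctured (dom x)`.
  have hset : punctured (dom x) =ᶠ[nhds (extChartAt (𝓡∂ 2) x x, v)]
      Set.range (𝓡∂ 2).tangent := by
    have h1 := extChartAt_target_eventuallyEq (I := (𝓡∂ 2).tangent) (x := (⟨x, v⟩ : TM M))
    rw [extChartAt_tangent_target, h0] at h1
    refine Filter.EventuallyEq.trans ?_ h1
    have h2 : ∀ᶠ z : Plane × Plane in nhds (extChartAt (𝓡∂ 2) x x, v), z.2 ≠ 0 :=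
      continuous_snd.continuousAt.eventually_ne hv
    filter_upwards [h2] with z hz
    apply propext
    exact ⟨fun h => ⟨h.1, trivial⟩, fun h => ⟨h.1, hz⟩⟩
  have hfun : ∀ z ∈ punctured (dom x),
      writtenInExtChartAt (𝓡∂ 2).tangent 𝓘(ℝ, F) (⟨x, v⟩ : TM M) (ext g u) z = loc g x u z := by
    intro z hz
    simp only [writtenInExtChartAt, Function.comp_apply, extChartAt_model_space_eq_id,
      PartialEquiv.refl_coe, id, loc]
    exact congrArg (ext g u) (extChartAt_tangent_symm (⟨x, v⟩ : TM M) hz.1)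
  have hs : @Eq (Plane × Plane) (spray g ⟨x, v⟩)
      (sprayField (chrisCoord g x) (extChartAt (𝓡∂ 2) x x, v)) := by
    refine Prod.ext rfl ?_
    ext k
    exact congrArg Neg.neg (chrisCoord_apply g x (extChartAt (𝓡∂ 2) x x) v v k).symm
  have hD : fderivWithin ℝ
      (writtenInExtChartAt (𝓡∂ 2).tangent 𝓘(ℝ, F) (⟨x, v⟩ : TM M) (ext g u))
      (Set.range (𝓡∂ 2).tangent)
      (extChartAt (𝓡∂ 2).tangent (⟨x, v⟩ : TM M) (⟨x, v⟩ : TM M)) =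
      fderivWithin ℝ (loc g x u) (punctured (dom x)) (extChartAt (𝓡∂ 2) x x, v) := by
    rw [h0, ← fderivWithin_congr_set hset, fderivWithin_congr hfun (hfun _ hz)]
  rw [hd.mfderiv]
  exact (congrArg (fun L : Plane × Plane →L[ℝ] F => L (spray g ⟨x, v⟩)) hD).trans
    (congrArg (fderivWithin ℝ (loc g x u) (punctured (dom x)) (extChartAt (𝓡∂ 2) x x, v)) hs)

/-- The geodesic vector field in coordinates. -/
lemma loc_opX {g : Metric M} (o : SurfaceOrientation M) {u : SM g → F} (hu : IsSmooth g u)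
    (x₀ : M) {z : Plane × Plane} (hz : z ∈ punctured (dom x₀)) :
    loc g x₀ (opX g u) z = locX (dom x₀) (metricCoord g x₀) (chrisCoord g x₀) (loc g x₀ u) z := by
  have hz2 := lift_snd_ne_zero hz
  have hlen := (localGeometry g o x₀).len_pos hz
  have hl : Real.sqrt (g.inner (lift x₀ z).1 (lift x₀ z).2 (lift x₀ z).2) =
      len (metricCoord g x₀) z := by
    rw [inner_lift]
    rfl
  set x := pt x₀ z.1 with hx
  have hxx : pt x₀ z.1 ∈ (extChartAt (𝓡∂ 2) x).source := mem_extChartAt_source x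
  have hJ : @Eq Plane (vec x₀ x z.2) (jac x₀ x z.1 z.2) := by
    rw [jac_pt hz.1]
    exact vec_apply (pt_mem hz.1) z.2
  have hz1 : (transition x₀ x z.1, jac x₀ x z.1 z.2) ∈ punctured (dom x) :=
    ⟨transition_mem hxx, fun h => hz.2 (jac_injective hz.1 hxx (by
      rw [map_zero]; exact h))⟩
  have e : (normalize g (lift x₀ z) hz2).1 =
      (⟨x, (len (metricCoord g x₀) z)⁻¹ • jac x₀ x z.1 z.2⟩ : TM M) := by
    rw [← hl, ← hJ]
    rfl
  have h1 : loc g x₀ (opX g u) z = (fun p : TM M => (mfderiv (𝓡∂ 2).tangent 𝓘(ℝ, F) (ext g u) p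
      (spray g p) : F)) (normalize g (lift x₀ z) hz2).1 := by
    conv_lhs => unfold loc
    rw [ext_of_ne_zero g _ hz2]
    rfl
  rw [h1, e]
  have hne : (len (metricCoord g x₀) z)⁻¹ • jac x₀ x z.1 z.2 ≠ 0 :=
    smul_ne_zero (inv_pos.2 hlen).ne' hz1.2
  refine (mfderiv_spray hu x hne).trans ?_
  unfold locX
  rw [fderivWithin_loc_spray o hu hz hxx]
  -- Scaling the vector by c multiplies the base part of the spray by c and the fibre part by c².
  -- One factor c is the `len⁻¹` of `locX`; the remaining scaling is that of
  -- `fderivWithin_loc_smul`.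
  have e2 : sprayField (chrisCoord g x)
      (transition x₀ x z.1, (len (metricCoord g x₀) z)⁻¹ • jac x₀ x z.1 z.2) =
      (len (metricCoord g x₀) z)⁻¹ • ((jac x₀ x z.1 z.2), (len (metricCoord g x₀) z)⁻¹ •
        -(chrisCoord g x (transition x₀ x z.1) (jac x₀ x z.1 z.2) (jac x₀ x z.1 z.2))) := by
    simp [sprayField]
  change fderivWithin ℝ (loc g x u) (punctured (dom x))
    (transition x₀ x z.1, (len (metricCoord g x₀) z)⁻¹ • jac x₀ x z.1 z.2)
    (sprayField (chrisCoord g x)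
      (transition x₀ x z.1, (len (metricCoord g x₀) z)⁻¹ • jac x₀ x z.1 z.2)) = _
  rw [e2, map_smul]
  congr 1
  exact fderivWithin_loc_smul o hu hz1 (inv_pos.2 hlen)
    (sprayField (chrisCoord g x) (transition x₀ x z.1, jac x₀ x z.1 z.2))

lemma hasDerivAt_circle (a b : Plane) (t : ℝ) :
    HasDerivAt (fun t : ℝ => Real.cos t • a + Real.sin t • b)
      (-Real.sin t • a + Real.cos t • b) t :=
  ((Real.hasDerivAt_cos t).smul_const a).add ((Real.hasDerivAt_sin t).smul_const b)

lemma circle_ne_zero {G : Plane →L[ℝ] Plane →L[ℝ] ℝ} {J : Plane →L[ℝ] Plane} (h : IsRotation G J)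
    {w : Plane} (hw : w ≠ 0) (t : ℝ) : Real.cos t • w + Real.sin t • J w ≠ 0 := by
  intro h0
  have h1 := congrArg (fun v => G v v) h0
  simp only [map_add, map_smul, add_apply, smul_apply, smul_eq_mul, h.skew, h.isometry,
    h.symm w (J w), map_zero] at h1
  have := h.pos w hw
  have h2 : (Real.cos t ^ 2 + Real.sin t ^ 2) * G w w = 0 := by linarith
  rw [Real.cos_sq_add_sin_sq, one_mul] at h2
  exact this.ne' h2

lemma J_circle {G : Plane →L[ℝ] Plane →L[ℝ] ℝ} {J : Plane →L[ℝ] Plane} (h : IsRotation G J)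
    (w : Plane) (t : ℝ) : J (Real.cos t • w + Real.sin t • J w) =
      -Real.sin t • w + Real.cos t • J w := by
  simp only [map_add, map_smul, h.sq]
  module

/-- Functions along the fibres. -/
lemma hasDerivAt_loc_circle {g : Metric M} (o : SurfaceOrientation M) {u : SM g → F}
    (hu : IsSmooth g u)
    (x₀ : M) {z : Plane × Plane} (hz : z ∈ punctured (dom x₀)) (t : ℝ) :
    HasDerivAt (fun t : ℝ => loc g x₀ u
        (z.1, Real.cos t • z.2 + Real.sin t • rotCoord g o x₀ z.1 z.2))
      (locV (dom x₀) (rotCoord g o x₀) (loc g x₀ u)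
        (z.1, Real.cos t • z.2 + Real.sin t • rotCoord g o x₀ z.1 z.2)) t := by
  have hR := isRotation g o hz.1
  have hmem : ∀ t : ℝ, (z.1, Real.cos t • z.2 + Real.sin t • rotCoord g o x₀ z.1 z.2) ∈
      punctured (dom x₀) := fun t => ⟨hz.1, circle_ne_zero hR hz.2 t⟩
  have h1 := ((hu.loc x₀ _ (hmem t)).differentiableWithinAt (by simp)).hasFDerivWithinAt
  have h2 : HasDerivAt (fun t : ℝ => (z.1, Real.cos t • z.2 + Real.sin t • rotCoord g o x₀ z.1 z.2))
      ((0, -Real.sin t • z.2 + Real.cos t • rotCoord g o x₀ z.1 z.2) : Plane × Plane) t :=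
    (hasDerivAt_const t z.1).prodMk (hasDerivAt_circle z.2 _ t)
  have h3 := h1.comp_hasDerivAt t h2 (Filter.Eventually.of_forall hmem)
  unfold locV vertField
  rw [J_circle hR]
  exact h3

lemma rot_vec_circle (g : Metric M) (o : SurfaceOrientation M) {x₀ : M} {y : Plane}
    (hy : y ∈ dom x₀) (a : Plane) (t : ℝ) :
    (Real.cos t • vec x₀ (pt x₀ y) a + Real.sin t • rot g o (pt x₀ y) (vec x₀ (pt x₀ y) a)) =
      vec x₀ (pt x₀ y) (Real.cos t • a + Real.sin t • rotCoord g o x₀ y a) := by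
  rw [rot_vec g o hy, map_add, map_smul, map_smul]

/-- The vertical vector field in coordinates. -/
lemma loc_opV {g : Metric M} (o : SurfaceOrientation M) {u : SM g → F} (hu : IsSmooth g u)
    (x₀ : M) {z : Plane × Plane} (hz : z ∈ punctured (dom x₀)) :
    loc g x₀ (opV g o u) z = locV (dom x₀) (rotCoord g o x₀) (loc g x₀ u) z := by
  have hz2 := lift_snd_ne_zero hz
  have hlen := (localGeometry g o x₀).len_pos hz
  have hl : Real.sqrt (g.inner (lift x₀ z).1 (lift x₀ z).2 (lift x₀ z).2) =
      len (metricCoord g x₀) z := by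
    rw [inner_lift]
    rfl
  conv_lhs => unfold loc
  rw [ext_of_ne_zero g _ hz2]
  unfold opV
  have e : (fun t : ℝ => ext g u ⟨(normalize g (lift x₀ z) hz2).1.1,
      Real.cos t • (normalize g (lift x₀ z) hz2).1.2 + Real.sin t • rot g o
        (normalize g (lift x₀ z) hz2).1.1 (normalize g (lift x₀ z) hz2).1.2⟩) =
      fun t : ℝ => loc g x₀ u
        (z.1, Real.cos t • z.2 + Real.sin t • rotCoord g o x₀ z.1 z.2) := by
    funext t
    have e1 : (normalize g (lift x₀ z) hz2).1 =
        ⟨pt x₀ z.1, vec x₀ (pt x₀ z.1) ((len (metricCoord g x₀) z)⁻¹ • z.2)⟩ := by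
      rw [map_smul, ← hl]
      rfl
    rw [e1]
    simp only
    rw [rot_vec_circle g o hz.1, ← loc_smul g x₀ u (inv_pos.2 hlen)]
    unfold loc lift
    simp only
    congr 3
    rw [map_smul]
    module
  rw [e]
  have := (hasDerivAt_loc_circle o hu x₀ hz 0).deriv
  simpa using this

lemma IsSmooth.opX {g : Metric M} (o : SurfaceOrientation M) {u : SM g → F} (hu : IsSmooth g u) :
    IsSmooth g (opX g u) := by
  rw [isSmooth_iff]
  exact fun x₀ => ((localGeometry g o x₀).smooth_locX (hu.loc x₀)).congr
    fun z hz => loc_opX o hu x₀ hz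

lemma IsSmooth.opV {g : Metric M} (o : SurfaceOrientation M) {u : SM g → F} (hu : IsSmooth g u) :
    IsSmooth g (opV g o u) := by
  rw [isSmooth_iff]
  exact fun x₀ => ((localGeometry g o x₀).smooth_locV (hu.loc x₀)).congr
    fun z hz => loc_opV o hu x₀ hz

end Coordinates

/-! ### The divergence theorem in a half plane -/

section HalfPlane

open MeasureTheory Topology

/-- A point outside `T` has a neighbourhood missing `K`, where the extension by zero vanishes; a
point of `T` has `T` as a neighbourhood relative to `H`. This lets functions on a chart image be
extended to the whole half plane. -/
lemma continuousOn_indicator_of_support {α β : Type*} [TopologicalSpace α] [TopologicalSpace β]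
    [Zero β] {T H K : Set α} (hT : ∀ y ∈ T, T ∈ 𝓝[H] y) (hK : IsClosed K) (hKT : K ⊆ T) {f : α → β}
    (hf : ContinuousOn f T) (h0 : ∀ y ∈ T \ K, f y = 0) : ContinuousOn (T.indicator f) H := by
  intro y hy
  by_cases hyT : y ∈ T
  · have h1 : ContinuousWithinAt (T.indicator f) T y :=
      (hf y hyT).congr (fun x hx => Set.indicator_of_mem hx f) (Set.indicator_of_mem hyT f)
    exact h1.mono_of_mem_nhdsWithin (hT y hyT)
  · have h1 : T.indicator f =ᶠ[𝓝 y] fun _ => 0 := by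
      filter_upwards [hK.isOpen_compl.mem_nhds fun h => hyT (hKT h)] with x hx
      by_cases hxT : x ∈ T
      · rw [Set.indicator_of_mem hxT, h0 x ⟨hxT, hx⟩]
      · exact Set.indicator_of_notMem hxT f
    exact (h1.continuousAt).continuousWithinAt

variable {F : Type*} [NormedAddCommGroup F] [NormedSpace ℝ F]

/-- The identification of `ℝ × ℝ` with the Euclidean plane. -/
def prodPlane : (ℝ × ℝ) ≃L[ℝ] Plane :=
  (ContinuousLinearEquiv.finTwoArrow ℝ ℝ).symm.trans
    (PiLp.continuousLinearEquiv 2 ℝ (fun _ : Fin 2 => ℝ)).symm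

@[simp] lemma prodPlane_zero (p : ℝ × ℝ) : prodPlane p 0 = p.1 := rfl

@[simp] lemma prodPlane_one (p : ℝ × ℝ) : prodPlane p 1 = p.2 := rfl

lemma prodPlane_fst : prodPlane (1, 0) = stdVec 0 := by
  ext i; fin_cases i <;> simp

lemma prodPlane_snd : prodPlane (0, 1) = stdVec 1 := by
  ext i; fin_cases i <;> simp

lemma measurePreserving_prodPlane : MeasurePreserving prodPlane :=
  (PiLp.volume_preserving_toLp (Fin 2)).comp (volume_preserving_finTwoArrow ℝ).symm

lemma fderivWithin_eq_zero_of_support {T K : Set Plane} (hK : IsClosed K) {h : Plane → F}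
    (h0 : ∀ y ∈ T \ K, h y = 0) {y : Plane} (hy : y ∈ T \ K) : fderivWithin ℝ h T y = 0 := by
  have h1 : h =ᶠ[𝓝[T] y] fun _ => 0 := by
    filter_upwards [self_mem_nhdsWithin, mem_nhdsWithin_of_mem_nhds
      (hK.isOpen_compl.mem_nhds hy.2)] with x hx hx'
    exact h0 x ⟨hx, hx'⟩
  rw [h1.fderivWithin_eq (h0 y hy)]
  simp

/-- The extensions by zero are continuous on the closed half plane and differentiable inside it, so
the divergence theorem applies to a rectangle [0, R] × [−R, R]. Three of its sides miss `K`, and on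
the side y₀ = 0 only the component `h 0` contributes, which vanishes there. -/
lemma integral_divergence_eq_zero [CompleteSpace F] {T K : Set Plane} 
    (hTH : T ⊆ {y | 0 ≤ y 0}) (hT : ∀ y ∈ T, T ∈ 𝓝[{y | 0 ≤ y 0}] y)
    (hu : UniqueDiffOn ℝ T) (hTm : MeasurableSet T) (hK : IsCompact K) (hKT : K ⊆ T)
    {h : Fin 2 → Plane → F} (hh : ∀ i, ContDiffOn ℝ 1 (h i) T)
    (hh0 : ∀ i, ∀ y ∈ T \ K, h i y = 0) (hhb : ∀ y ∈ T, y 0 = 0 → h 0 y = 0) :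
    ∫ y in T, (fderivWithin ℝ (h 0) T y (stdVec 0) + fderivWithin ℝ (h 1) T y (stdVec 1)) = 0 := by
  classical
  set d : Plane → F := fun y =>
    fderivWithin ℝ (h 0) T y (stdVec 0) + fderivWithin ℝ (h 1) T y (stdVec 1) with hd
  have hdc : ContinuousOn d T :=
    (((hh 0).continuousOn_fderivWithin hu le_rfl).clm_apply continuousOn_const).add
      (((hh 1).continuousOn_fderivWithin hu le_rfl).clm_apply continuousOn_const)
  have hd0 : ∀ y ∈ T \ K, d y = 0 := by
    intro y hy
    simp only [hd]
    rw [fderivWithin_eq_zero_of_support hK.isClosed (hh0 0) hy,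
      fderivWithin_eq_zero_of_support hK.isClosed (hh0 1) hy]
    simp
  have hDc := continuousOn_indicator_of_support hT hK.isClosed hKT hdc hd0
  -- The strict bounds keep the sides where a coordinate equals ±R away from `K`.
  obtain ⟨R, hR, hKR⟩ : ∃ R : ℝ, 0 < R ∧ ∀ y ∈ K, |y 0| < R ∧ |y 1| < R := by
    obtain ⟨R, hR⟩ := hK.isBounded.exists_norm_le
    refine ⟨|R| + 1, by positivity, fun y hy => ⟨?_, ?_⟩⟩
    · have := (PiLp.norm_apply_le y 0).trans (hR y hy)
      rw [Real.norm_eq_abs] at this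
      linarith [le_abs_self R]
    · have := (PiLp.norm_apply_le y 1).trans (hR y hy)
      rw [Real.norm_eq_abs] at this
      linarith [le_abs_self R]
  have hzero : ∀ (k : Plane → F), (∀ y ∈ T \ K, k y = 0) → ∀ y, y ∉ K → T.indicator k y = 0 := by
    intro k hk y hy
    by_cases hyT : y ∈ T
    · rw [Set.indicator_of_mem hyT, hk y ⟨hyT, hy⟩]
    · exact Set.indicator_of_notMem hyT k
  let f' : Fin 2 → ℝ × ℝ → ℝ × ℝ →L[ℝ] F := fun i p =>
    if prodPlane p ∈ T then (fderivWithin ℝ (h i) T (prodPlane p)).comp prodPlane.toContinuousLinearMap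
    else 0
  let hf : Fin 2 → ℝ × ℝ → F := fun i p => T.indicator (h i) (prodPlane p)
  have hmaps : Set.MapsTo prodPlane (Set.Icc (0, -R) (R, R)) {y : Plane | 0 ≤ y 0} :=
    fun p hp => hp.1.1
  have hcont : ∀ i, ContinuousOn (hf i) (Set.Icc (0, -R) (R, R)) := fun i =>
    (continuousOn_indicator_of_support hT hK.isClosed hKT (hh i).continuousOn (hh0 i)).comp
      prodPlane.continuous.continuousOn hmaps
  have hder : ∀ i, ∀ p ∈ Set.Ioo (0 : ℝ) R ×ˢ Set.Ioo (-R) R, HasFDerivAt (hf i) (f' i p) p := by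
    intro i p hp
    have hpos : (0 : ℝ) < prodPlane p 0 := hp.1.1
    have hnH : {y : Plane | 0 ≤ y 0} ∈ 𝓝 (prodPlane p) := by
      have : Continuous fun y : Plane => y 0 := by fun_prop
      filter_upwards [this.continuousAt.eventually_const_lt hpos] with y hy using hy.le
    by_cases hpT : prodPlane p ∈ T
    · have hTn : T ∈ 𝓝 (prodPlane p) := by
        have := hT _ hpT
        rwa [nhdsWithin_eq_nhds.2 hnH] at this
      have h1 : HasFDerivAt (T.indicator (h i)) (fderivWithin ℝ (h i) T (prodPlane p))
          (prodPlane p) := by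
        have h2 := (((hh i) _ hpT).differentiableWithinAt one_ne_zero).hasFDerivWithinAt
        refine (h2.hasFDerivAt hTn).congr_of_eventuallyEq ?_
        filter_upwards [hTn] with y hy using Set.indicator_of_mem hy _
      simp only [f', if_pos hpT]
      exact h1.comp p prodPlane.hasFDerivAt
    · simp only [f', if_neg hpT]
      have h1 : hf i =ᶠ[𝓝 p] fun _ => 0 := by
        have : ∀ᶠ q in 𝓝 p, prodPlane q ∈ Kᶜ := prodPlane.continuous.continuousAt.eventually_mem
          (hK.isClosed.isOpen_compl.mem_nhds fun h => hpT (hKT h))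
        filter_upwards [this] with q hq using hzero _ (hh0 i) _ hq
      exact (hasFDerivAt_const 0 p).congr_of_eventuallyEq h1
  have hfd : ∀ p, f' 0 p (1, 0) + f' 1 p (0, 1) = T.indicator d (prodPlane p) := by
    intro p
    by_cases hpT : prodPlane p ∈ T
    · simp only [f', if_pos hpT, Set.indicator_of_mem hpT, hd]
      simp [prodPlane_fst, prodPlane_snd]
    · simp only [f', if_neg hpT, Set.indicator_of_notMem hpT]
      simp
  have hcd : ContinuousOn (fun p => T.indicator d (prodPlane p)) (Set.Icc (0, -R) (R, R)) :=
    hDc.comp prodPlane.continuous.continuousOn hmaps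
  have hdiv := integral_divergence_prod_Icc_of_hasFDerivAt_of_le (hf 0) (hf 1) (f' 0) (f' 1)
    (0, -R) (R, R) ⟨hR.le, by simp; linarith⟩ (hcont 0) (hcont 1) (hder 0) (hder 1) (by
      simp only [hfd]
      exact hcd.integrableOn_compact isCompact_Icc)
  have hb : ∀ i, ∀ p : ℝ × ℝ, (|p.1| = R ∨ |p.2| = R) → hf i p = 0 := by
    intro i p hp
    apply hzero _ (hh0 i)
    intro hpK
    have h1 := hKR _ hpK
    rw [prodPlane_zero, prodPlane_one] at h1
    rcases hp with hp | hp <;> rw [hp] at h1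
    · exact lt_irrefl _ h1.1
    · exact lt_irrefl _ h1.2
  have hb0 : ∀ t : ℝ, hf 0 (0, t) = 0 := by
    intro t
    by_cases hpT : prodPlane (0, t) ∈ T
    · exact (Set.indicator_of_mem hpT _).trans (hhb _ hpT rfl)
    · exact Set.indicator_of_notMem hpT _
  simp only [hb0] at hdiv
  rw [← integral_indicator hTm, ← measurePreserving_prodPlane.integral_comp
    prodPlane.toHomeomorph.measurableEmbedding]
  rw [← setIntegral_eq_integral_of_forall_compl_eq_zero (s := Set.Icc (0, -R) (R, R))]
  · simp only [hfd] at hdiv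
    rw [hdiv]
    simp [hb 0 (R, _) (Or.inl (abs_of_pos hR)), hb 1 (_, R) (Or.inr (abs_of_pos hR)),
      hb 1 (_, -R) (Or.inr (by rw [abs_neg, abs_of_pos hR]))]
  · intro p hp
    by_cases hpT : prodPlane p ∈ T
    · apply hzero _ hd0
      intro hpK
      have h1 := hKR _ hpK
      rw [prodPlane_zero, prodPlane_one] at h1
      have h2 : (0 : ℝ) ≤ p.1 := hTH hpT
      apply hp
      exact ⟨⟨h2, (abs_lt.1 h1.2).1.le⟩, ⟨(abs_lt.1 h1.1).2.le, (abs_lt.1 h1.2).2.le⟩⟩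
    · exact Set.indicator_of_notMem hpT _

end HalfPlane

/-! ### The geodesic vector field preserves the Liouville measure -/

/-- The density of the Riemannian area in coordinates. -/
def areaDensity (G : Plane → Plane →L[ℝ] Plane →L[ℝ] ℝ) (y : Plane) : ℝ :=
  Real.sqrt (G y (stdVec 0) (stdVec 0) * G y (stdVec 1) (stdVec 1) - G y (stdVec 0) (stdVec 1) ^ 2)

/-- The rotated frame field `cos t e + sin t J e`. -/
def frame (J : Plane → Plane →L[ℝ] Plane) (e : Plane → Plane) (t : ℝ) (y : Plane) : Plane :=
  Real.cos t • e y + Real.sin t • J y (e y)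

/-- The connection form of a unit vector field. -/
def frameForm (T : Set Plane) (G : Plane → Plane →L[ℝ] Plane →L[ℝ] ℝ)
    (Γ : Plane → Plane →L[ℝ] Plane →L[ℝ] Plane) (J : Plane → Plane →L[ℝ] Plane)
    (e : Plane → Plane) (y : Plane) (a : Plane) : ℝ :=
  G y (fderivWithin ℝ e T y a + Γ y a (e y)) (J y (e y))

namespace LocalGeometry

open MeasureTheory Topology

variable {T : Set Plane} {G : Plane → Plane →L[ℝ] Plane →L[ℝ] ℝ}
  {Γ : Plane → Plane →L[ℝ] Plane →L[ℝ] Plane} {J : Plane → Plane →L[ℝ] Plane}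
  {e : Plane → Plane} {y : Plane}
  {F : Type*} [NormedAddCommGroup F] [NormedSpace ℝ F]

lemma frame_ne_zero (h : LocalGeometry T G Γ J) (hy : y ∈ T) (he : G y (e y) (e y) = 1) (t : ℝ) :
    frame J e t y ≠ 0 :=
  circle_ne_zero (h.rotation y hy) (fun h0 => by simp [h0] at he) t

lemma frame_unit (h : LocalGeometry T G Γ J) (hy : y ∈ T) (he : G y (e y) (e y) = 1) (t : ℝ) :
    G y (frame J e t y) (frame J e t y) = 1 := by
  have hR := h.rotation y hy
  simp only [frame, map_add, map_smul, add_apply, smul_apply, smul_eq_mul, hR.skew, hR.isometry,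
    hR.symm (e y) (J y (e y)), he]
  linarith [Real.cos_sq_add_sin_sq t]

lemma frameForm_eq (y a : Plane) : frameForm T G Γ J e y a =
    a 0 * frameForm T G Γ J e y (stdVec 0) + a 1 * frameForm T G Γ J e y (stdVec 1) := by
  conv_lhs => rw [plane_eq a]
  simp only [frameForm, map_add, map_smul, add_apply, smul_apply, smul_eq_mul]
  ring

lemma contDiffOn_frame (h : LocalGeometry T G Γ J) (he : ContDiffOn ℝ ∞ e T) (t : ℝ) :
    ContDiffOn ℝ ∞ (frame J e t) T :=
  (he.const_smul (Real.cos t)).add ((h.smoothJ.clm_apply he).const_smul (Real.sin t))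

/-- Differentiating ⟨e, e⟩ = 1 shows that the covariant derivative of `e` is orthogonal to `e`,
hence a multiple of `J e`; the coefficient is the connection form. -/
lemma fderivWithin_unit (h : LocalGeometry T G Γ J) (he : ContDiffOn ℝ ∞ e T)
    (he1 : ∀ y ∈ T, G y (e y) (e y) = 1) (hy : y ∈ T) (a : Plane) :
    fderivWithin ℝ e T y a = -Γ y a (e y) + frameForm T G Γ J e y a • J y (e y) := by
  have hR := h.rotation y hy
  have hd := ((he y hy).differentiableWithinAt (by simp)).hasFDerivWithinAt
  have hne : e y ≠ 0 := fun h0 => by simpa [h0] using he1 y hy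
  have h1 := ((h.hasG hy).clm_apply hd).clm_apply hd
  have h2 : HasFDerivWithinAt (fun y => G y (e y) (e y)) (0 : Plane →L[ℝ] ℝ) T y :=
    (hasFDerivWithinAt_const (1 : ℝ) y T).congr he1 (he1 y hy)
  have h3 := congrArg (fun L : Plane →L[ℝ] ℝ => L a) ((h.uniqueDiff y hy).eq h1 h2)
  simp only [add_apply, ContinuousLinearMap.comp_apply, ContinuousLinearMap.flip_apply,
    zero_apply, h.compat y hy] at h3
  have h4 : G y (fderivWithin ℝ e T y a + Γ y a (e y)) (e y) = 0 := by
    rw [map_add, add_apply]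
    rw [hR.symm (e y) (fderivWithin ℝ e T y a), hR.symm (e y) (Γ y a (e y))] at h3
    linarith
  have h5 := hR.expand hne (fderivWithin ℝ e T y a + Γ y a (e y))
  rw [he1 y hy, h4, one_smul, zero_smul, zero_add] at h5
  rw [frameForm, ← h5]
  abel

/-- Because `J` is parallel, every rotated frame has the same connection form as `e`. -/
lemma hasFDeriv_frame (h : LocalGeometry T G Γ J) (he : ContDiffOn ℝ ∞ e T)
    (he1 : ∀ y ∈ T, G y (e y) (e y) = 1) (hy : y ∈ T) (t : ℝ) :
    ∃ W' : Plane →L[ℝ] Plane, HasFDerivWithinAt (frame J e t) W' T y ∧ ∀ a,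
      W' a = -Γ y a (frame J e t y) + frameForm T G Γ J e y a • J y (frame J e t y) := by
  have hd := ((he y hy).differentiableWithinAt (by simp)).hasFDerivWithinAt
  refine ⟨_, (hd.const_smul (Real.cos t)).add
    (((h.hasJ hy).clm_apply hd).const_smul (Real.sin t)), fun a => ?_⟩
  simp only [add_apply, smul_apply, ContinuousLinearMap.comp_apply, ContinuousLinearMap.flip_apply,
    h.parallel hy, h.fderivWithin_unit he he1 hy, frame, map_add, map_smul, map_neg]
  module

lemma areaDensity_pos (h : LocalGeometry T G Γ J) (hy : y ∈ T) : 0 < areaDensity G y := by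
  have hR := h.rotation y hy
  apply Real.sqrt_pos.2
  rw [← hR.area_sq]
  exact sq_pos_of_ne_zero hR.area_ne_zero

/-- The logarithmic derivative of the root of det g is the trace of Γ(a, ·). The computation
differentiates the determinant and uses metric compatibility. -/
lemma hasFDeriv_areaDensity (h : LocalGeometry T G Γ J) (hy : y ∈ T) :
    ∃ r' : Plane →L[ℝ] ℝ, HasFDerivWithinAt (areaDensity G) r' T y ∧
      ∀ a, r' a = areaDensity G y * (Γ y a (stdVec 0) 0 + Γ y a (stdVec 1) 1) := by
  have hR := h.rotation y hy
  have hentry : ∀ i j : Fin 2, HasFDerivWithinAt (fun y => G y (stdVec i) (stdVec j))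
      (((fderivWithin ℝ G T y).flip (stdVec i)).flip (stdVec j)) T y := fun i j => by
    have := ((h.hasG hy).clm_apply (hasFDerivWithinAt_const (stdVec i) y T)).clm_apply
      (hasFDerivWithinAt_const (stdVec j) y T)
    simpa using this
  have hpos := h.areaDensity_pos hy
  have hq := ((hentry 0 0).mul (hentry 1 1)).sub ((hentry 0 1).pow 2)
  refine ⟨_, hq.sqrt (Real.sqrt_pos.1 hpos).ne', fun a => ?_⟩
  have hsq : areaDensity G y ^ 2 = _ := Real.sq_sqrt (Real.sqrt_pos.1 hpos).le
  change 1 / (2 * areaDensity G y) * (G y (stdVec 0) (stdVec 0) *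
      fderivWithin ℝ G T y a (stdVec 1) (stdVec 1) + G y (stdVec 1) (stdVec 1) *
      fderivWithin ℝ G T y a (stdVec 0) (stdVec 0) - (2 • G y (stdVec 0) (stdVec 1) ^ (2 - 1)) *
      fderivWithin ℝ G T y a (stdVec 0) (stdVec 1)) = _
  rw [div_mul_eq_mul_div, one_mul, div_eq_iff (by positivity)]
  have hG : ∀ v w : Plane, G y v w = v 0 * G y (stdVec 0) w + v 1 * G y (stdVec 1) w := by
    intro v w
    conv_lhs => rw [plane_eq v]
    simp
  have : areaDensity G y * (Γ y a (stdVec 0) 0 + Γ y a (stdVec 1) 1) * (2 * areaDensity G y) =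
      2 * (Γ y a (stdVec 0) 0 + Γ y a (stdVec 1) 1) * areaDensity G y ^ 2 := by ring
  rw [this, hsq]
  simp only [h.compat y hy, hR.symm (stdVec _) (Γ y a (stdVec _)), hG (Γ y a _)]
  rw [hR.symm (stdVec 1) (stdVec 0)]
  simp only [Nat.add_one_sub_one, pow_one, nsmul_eq_mul, Nat.cast_ofNat]
  ring

lemma contDiffOn_areaDensity (h : LocalGeometry T G Γ J) : ContDiffOn ℝ ∞ (areaDensity G) T := by
  have hentry : ∀ i j : Fin 2, ContDiffOn ℝ ∞ (fun y => G y (stdVec i) (stdVec j)) T :=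
    fun i j => (h.smoothG.clm_apply contDiffOn_const).clm_apply contDiffOn_const
  exact (((hentry 0 0).mul (hentry 1 1)).sub ((hentry 0 1).pow 2)).sqrt
    fun y hy => (Real.sqrt_pos.1 (h.areaDensity_pos hy)).ne'

/-- The flux density of `U` along the rotated frame. -/
def flux (G : Plane → Plane →L[ℝ] Plane →L[ℝ] ℝ) (J : Plane → Plane →L[ℝ] Plane)
    (e : Plane → Plane) (U : Plane × Plane → F) (t : ℝ) (i : Fin 2) (y : Plane) : F :=
  (areaDensity G y * frame J e t y i) • U (y, frame J e t y)

lemma contDiffOn_comp_frame (h : LocalGeometry T G Γ J) (he : ContDiffOn ℝ ∞ e T)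
    (he1 : ∀ y ∈ T, G y (e y) (e y) = 1) {U : Plane × Plane → F}
    (hU : ContDiffOn ℝ ∞ U (punctured T)) (t : ℝ) :
    ContDiffOn ℝ ∞ (fun y => U (y, frame J e t y)) T :=
  hU.comp (contDiffOn_id.prodMk (h.contDiffOn_frame he t))
    fun y hy => ⟨hy, h.frame_ne_zero hy (he1 y hy) t⟩

lemma contDiffOn_flux (h : LocalGeometry T G Γ J) (he : ContDiffOn ℝ ∞ e T)
    (he1 : ∀ y ∈ T, G y (e y) (e y) = 1) {U : Plane × Plane → F}
    (hU : ContDiffOn ℝ ∞ U (punctured T)) (t : ℝ) (i : Fin 2) :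
    ContDiffOn ℝ ∞ (flux G J e U t i) T := by
  have h1 : ContDiffOn ℝ ∞ (fun y => frame J e t y i) T :=
    (EuclideanSpace.proj (𝕜 := ℝ) i).contDiff.comp_contDiffOn (h.contDiffOn_frame he t)
  exact (h.contDiffOn_areaDensity.mul h1).smul (h.contDiffOn_comp_frame he he1 hU t)

/-- Let W be the rotated frame and ω its connection form. The covariant derivative of W along a is
ω(a) J W, so the Riemannian divergence of W is ω(J W). Moving along W in the base, the point W of
the fibre follows the geodesic spray up to the vertical motion ω(W) J W. These two effects are the
extra terms; the trace of Γ from the density cancels the Christoffel symbols in the coordinate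
divergence. -/
lemma divergence_flux (h : LocalGeometry T G Γ J) (he : ContDiffOn ℝ ∞ e T)
    (he1 : ∀ y ∈ T, G y (e y) (e y) = 1) {U : Plane × Plane → F}
    (hU : ContDiffOn ℝ ∞ U (punctured T)) (hy : y ∈ T) (t : ℝ) :
    fderivWithin ℝ (flux G J e U t 0) T y (stdVec 0)
      + fderivWithin ℝ (flux G J e U t 1) T y (stdVec 1) =
    areaDensity G y • (locX T G Γ U (y, frame J e t y)
      + (frameForm T G Γ J e y (J y (frame J e t y)) • U (y, frame J e t y)
      + frameForm T G Γ J e y (frame J e t y) • locV T J U (y, frame J e t y))) := by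
  obtain ⟨W', hW, hW'⟩ := h.hasFDeriv_frame he he1 hy t
  obtain ⟨r', hr, hr'⟩ := h.hasFDeriv_areaDensity hy
  have hz : (y, frame J e t y) ∈ punctured T := ⟨hy, h.frame_ne_zero hy (he1 y hy) t⟩
  have hmaps : Set.MapsTo (fun y => (y, frame J e t y)) T (punctured T) :=
    fun x hx => ⟨hx, h.frame_ne_zero hx (he1 x hx) t⟩
  have hUd := ((hU _ hz).differentiableWithinAt (by simp)).hasFDerivWithinAt
  have hUW : HasFDerivWithinAt (fun y => U (y, frame J e t y))
      ((fderivWithin ℝ U (punctured T) (y, frame J e t y)).comp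
        ((ContinuousLinearMap.id ℝ Plane).prod W')) T y :=
    hUd.comp y ((hasFDerivWithinAt_id y T).prodMk hW) hmaps
  have hWi : ∀ i : Fin 2, HasFDerivWithinAt (fun y => frame J e t y i)
      ((EuclideanSpace.proj (𝕜 := ℝ) i).comp W') T y := fun i =>
    (EuclideanSpace.proj (𝕜 := ℝ) i).hasFDerivAt.comp_hasFDerivWithinAt y hW
  have hfl : ∀ i : Fin 2, fderivWithin ℝ (flux G J e U t i) T y = _ := fun i =>
    ((hr.mul (hWi i)).fun_smul hUW).fderivWithin (h.uniqueDiff y hy)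
  have hlen : len G (y, frame J e t y) = 1 := by
    rw [len, h.frame_unit hy (he1 y hy), Real.sqrt_one]
  rw [hfl 0, hfl 1, locX, locV, hlen, inv_one, one_smul, sprayField, vertField]
  rw [frameForm_eq y (J y _), frameForm_eq y (frame J e t y)]
  have hΓ := congrArg (fun v : Plane => v 1) (h.symmΓ y hy (stdVec 0) (stdVec 1))
  have hΓ' := congrArg (fun v : Plane => v 0) (h.symmΓ y hy (stdVec 0) (stdVec 1))
  simp only at hΓ hΓ'
  have hW0 := hW' (stdVec 0)
  have hW1 := hW' (stdVec 1)
  simp only [add_apply, smul_apply, ContinuousLinearMap.smulRight_apply, smul_eq_mul,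
    ContinuousLinearMap.comp_apply, ContinuousLinearMap.prod_apply, ContinuousLinearMap.id_apply,
    PiLp.proj_apply, Pi.mul_apply, hr', hW0, hW1]
  generalize frameForm T G Γ J e y (stdVec 0) = ω₀ at *
  generalize frameForm T G Γ J e y (stdVec 1) = ω₁ at *
  generalize areaDensity G y = ρ at *
  generalize fderivWithin ℝ U (punctured T) (y, frame J e t y) = L at *
  generalize U (y, frame J e t y) = u at *
  generalize frame J e t y = w at *
  generalize J y w = v at *
  have hw : ∀ a : Plane, Γ y a w = w 0 • Γ y a (stdVec 0) + w 1 • Γ y a (stdVec 1) := fun a => by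
    conv_lhs => rw [plane_eq w]
    simp
  have hL : L (w, -Γ y w w) = w 0 • L (stdVec 0, -Γ y (stdVec 0) w)
      + w 1 • L (stdVec 1, -Γ y (stdVec 1) w) := by
    rw [← map_smul, ← map_smul, ← map_add]
    congr 1
    ext1
    · exact plane_eq w
    · simp only [Prod.snd_add, Prod.smul_snd, smul_neg, ← neg_add]
      congr 1
      have h1 : Γ y w = w 0 • Γ y (stdVec 0) + w 1 • Γ y (stdVec 1) := by
        conv_lhs => rw [plane_eq w]
        simp
      conv_lhs => rw [h1]
      simp
  have hv : ∀ (a b : Plane) (c : ℝ), L (a, b + c • v) = L (a, b) + c • L (0, v) := fun a b c => by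
    rw [← map_smul, ← map_add]
    congr 1
    simp
  rw [hL, hv, hv]
  simp only [PiLp.add_apply, PiLp.neg_apply, PiLp.smul_apply, smul_eq_mul, hw, hΓ, hΓ']
  module

lemma hasDerivAt_frame (h : LocalGeometry T G Γ J) (hy : y ∈ T) (t : ℝ) :
    HasDerivAt (fun t => frame J e t y) (J y (frame J e t y)) t := by
  rw [frame, J_circle (h.rotation y hy)]
  exact hasDerivAt_circle (e y) (J y (e y)) t

lemma hasDerivAt_comp_frame (h : LocalGeometry T G Γ J) (he1 : ∀ y ∈ T, G y (e y) (e y) = 1)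
    {U : Plane × Plane → F} (hU : ContDiffOn ℝ ∞ U (punctured T)) (hy : y ∈ T) (t : ℝ) :
    HasDerivAt (fun t => U (y, frame J e t y)) (locV T J U (y, frame J e t y)) t := by
  have hmem : ∀ t : ℝ, (y, frame J e t y) ∈ punctured T :=
    fun t => ⟨hy, h.frame_ne_zero hy (he1 y hy) t⟩
  have h1 := ((hU _ (hmem t)).differentiableWithinAt (by simp)).hasFDerivWithinAt
  exact h1.comp_hasDerivAt t ((hasDerivAt_const t y).prodMk (h.hasDerivAt_frame hy t))
    (Filter.Eventually.of_forall hmem)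

lemma hasDerivAt_frameForm (h : LocalGeometry T G Γ J) (hy : y ∈ T) (t : ℝ) :
    HasDerivAt (fun t => frameForm T G Γ J e y (frame J e t y))
      (frameForm T G Γ J e y (J y (frame J e t y))) t :=
  (((G y).flip (J y (e y))).comp (fderivWithin ℝ e T y + (Γ y).flip (e y))).hasFDerivAt.comp_hasDerivAt
    t (h.hasDerivAt_frame hy t)

lemma continuousOn_frame (h : LocalGeometry T G Γ J) (he : ContDiffOn ℝ ∞ e T) :
    ContinuousOn (fun p : Plane × ℝ => frame J e p.2 p.1) (T ×ˢ Set.univ) := by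
  have h1 : ContinuousOn (fun p : Plane × ℝ => e p.1) (T ×ˢ Set.univ) :=
    he.continuousOn.comp continuousOn_fst fun p hp => hp.1
  have h2 : ContinuousOn (fun p : Plane × ℝ => J p.1) (T ×ˢ Set.univ) :=
    h.smoothJ.continuousOn.comp continuousOn_fst fun p hp => hp.1
  exact ((Real.continuous_cos.comp continuous_snd).continuousOn.smul h1).add
    ((Real.continuous_sin.comp continuous_snd).continuousOn.smul (h2.clm_apply h1))

lemma continuousOn_comp_frame {E : Type*} [TopologicalSpace E] (h : LocalGeometry T G Γ J)
    (he : ContDiffOn ℝ ∞ e T) (he1 : ∀ y ∈ T, G y (e y) (e y) = 1) {U : Plane × Plane → E}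
    (hU : ContinuousOn U (punctured T)) :
    ContinuousOn (fun p : Plane × ℝ => U (p.1, frame J e p.2 p.1)) (T ×ˢ Set.univ) :=
  hU.comp (continuousOn_fst.prodMk (h.continuousOn_frame he))
    fun p hp => ⟨hp.1, h.frame_ne_zero hp.1 (he1 _ hp.1) p.2⟩

lemma continuousOn_frameForm (h : LocalGeometry T G Γ J) (he : ContDiffOn ℝ ∞ e T) :
    ContinuousOn (fun p : Plane × Plane => frameForm T G Γ J e p.1 p.2) (T ×ˢ Set.univ) := by
  have hm : Set.MapsTo (Prod.fst : Plane × Plane → Plane) (T ×ˢ Set.univ) T := fun p hp => hp.1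
  have h1 := he.continuousOn.comp continuousOn_fst hm
  have h2 := h.smoothJ.continuousOn.comp continuousOn_fst hm
  have h3 := h.smoothG.continuousOn.comp continuousOn_fst hm
  have h4 := h.smoothΓ.continuousOn.comp continuousOn_fst hm
  have h5 := (he.continuousOn_fderivWithin h.uniqueDiff (by simp)).comp continuousOn_fst hm
  exact (h3.clm_apply ((h5.clm_apply continuousOn_snd).add
    ((h4.clm_apply continuousOn_snd).clm_apply h1))).clm_apply (h2.clm_apply h1)

/-- The geodesic vector field is divergence free. -/
theorem integral_locX_eq_zero [CompleteSpace F] (h : LocalGeometry T G Γ J)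
    (hTH : T ⊆ {y | 0 ≤ y 0}) (hT : ∀ y ∈ T, T ∈ 𝓝[{y | 0 ≤ y 0}] y) (hTm : MeasurableSet T)
    {K : Set Plane} (hK : IsCompact K) (hKT : K ⊆ T)
    (he : ContDiffOn ℝ ∞ e T) (he1 : ∀ y ∈ T, G y (e y) (e y) = 1) {U : Plane × Plane → F}
    (hU : ContDiffOn ℝ ∞ U (punctured T)) (hU0 : ∀ z ∈ punctured T, z.1 ∉ K → U z = 0)
    (hUb : ∀ z ∈ punctured T, z.1 0 = 0 → U z = 0) :
    ∫ y in T, areaDensity G y • ∫ t in (0 : ℝ)..(2 * Real.pi),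
      locX T G Γ U (y, frame J e t y) = 0 := by
  have hpi := Real.two_pi_pos.le
  set Q : Plane → ℝ → F := fun y t => areaDensity G y • (locX T G Γ U (y, frame J e t y)
      + (frameForm T G Γ J e y (J y (frame J e t y)) • U (y, frame J e t y)
      + frameForm T G Γ J e y (frame J e t y) • locV T J U (y, frame J e t y))) with hQ
  have hfl0 : ∀ t i, ∀ y ∈ T \ K, flux G J e U t i y = 0 := by
    intro t i y hy
    rw [flux, hU0 (y, frame J e t y) ⟨hy.1, h.frame_ne_zero hy.1 (he1 y hy.1) t⟩ hy.2, smul_zero]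
  have hQdiv : ∀ y ∈ T, ∀ t, Q y t = fderivWithin ℝ (flux G J e U t 0) T y (stdVec 0)
      + fderivWithin ℝ (flux G J e U t 1) T y (stdVec 1) :=
    fun y hy t => (h.divergence_flux he he1 hU hy t).symm
  have hQ0 : ∀ y ∈ T \ K, ∀ t, Q y t = 0 := by
    intro y hy t
    rw [hQdiv y hy.1, fderivWithin_eq_zero_of_support hK.isClosed (hfl0 t 0) hy,
      fderivWithin_eq_zero_of_support hK.isClosed (hfl0 t 1) hy]
    simp
  have hQT : ∀ t, ∫ y in T, Q y t = 0 := by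
    intro t
    rw [setIntegral_congr_fun hTm fun y hy => hQdiv y hy t]
    refine integral_divergence_eq_zero hTH hT h.uniqueDiff hTm hK hKT
      (h := fun i => flux G J e U t i)
      (fun i => (h.contDiffOn_flux he he1 hU t i).of_le (by simp)) (fun i => hfl0 t i) ?_
    intro y hy hy0
    rw [flux, hUb (y, frame J e t y) ⟨hy, h.frame_ne_zero hy (he1 y hy) t⟩ hy0, smul_zero]
  have hfr := h.continuousOn_frame he
  have hmf : Set.MapsTo (Prod.fst : Plane × ℝ → Plane) (T ×ˢ Set.univ) T := fun p hp => hp.1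
  have hc1 := h.continuousOn_comp_frame he he1 (h.smooth_locX hU).continuousOn
  have hc2 := h.continuousOn_comp_frame he he1 (h.smooth_locV hU).continuousOn
  have hc3 := h.continuousOn_comp_frame he he1 hU.continuousOn
  have hc4 : ContinuousOn (fun p : Plane × ℝ => frameForm T G Γ J e p.1 (frame J e p.2 p.1))
      (T ×ˢ Set.univ) := (h.continuousOn_frameForm he).comp (continuousOn_fst.prodMk hfr)
        fun p hp => ⟨hp.1, trivial⟩
  have hc5 : ContinuousOn (fun p : Plane × ℝ =>
      frameForm T G Γ J e p.1 (J p.1 (frame J e p.2 p.1))) (T ×ˢ Set.univ) :=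
    (h.continuousOn_frameForm he).comp (continuousOn_fst.prodMk
      ((h.smoothJ.continuousOn.comp continuousOn_fst hmf).clm_apply hfr)) fun p hp => ⟨hp.1, trivial⟩
  have hQc : ContinuousOn (Function.uncurry Q) (T ×ˢ Set.univ) :=
    (h.contDiffOn_areaDensity.continuousOn.comp continuousOn_fst hmf).smul
      (hc1.add ((hc5.smul hc3).add (hc4.smul hc2)))
  have hQi : Integrable (Function.uncurry Q)
      ((volume.restrict T).prod (volume.restrict (Set.Ioc 0 (2 * Real.pi)))) := by
    rw [Measure.prod_restrict]
    have h1 : IntegrableOn (Function.uncurry Q) (K ×ˢ Set.Icc 0 (2 * Real.pi))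
        (volume.prod volume) := (hQc.mono (Set.prod_mono hKT (Set.subset_univ _))).integrableOn_compact
          (hK.prod isCompact_Icc)
    refine h1.of_forall_sdiff_eq_zero (hTm.prod measurableSet_Ioc) ?_
    rintro ⟨y, t⟩ ⟨⟨hy, ht⟩, hn⟩
    exact hQ0 y ⟨hy, fun hyK => hn ⟨hyK, Set.Ioc_subset_Icc_self ht⟩⟩ t
  have hslice : ∀ {f : Plane × ℝ → F}, ContinuousOn f (T ×ˢ Set.univ) → ∀ y ∈ T,
      Continuous fun t => f (y, t) := by
    intro f hf y hy
    rw [← continuousOn_univ]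
    exact hf.comp (Continuous.continuousOn (by fun_prop)) fun t _ => ⟨hy, trivial⟩
  have hfib : ∀ y ∈ T, areaDensity G y • ∫ t in (0 : ℝ)..(2 * Real.pi),
      locX T G Γ U (y, frame J e t y) = ∫ t in Set.Ioc 0 (2 * Real.pi), Q y t := by
    intro y hy
    rw [← intervalIntegral.integral_of_le hpi, hQ, intervalIntegral.integral_smul]
    congr 1
    have hc7 : Continuous fun t => locX T G Γ U (y, frame J e t y) := hslice hc1 y hy
    have hc6 : Continuous fun t => frameForm T G Γ J e y (J y (frame J e t y)) •
        U (y, frame J e t y) + frameForm T G Γ J e y (frame J e t y) •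
          locV T J U (y, frame J e t y) := hslice ((hc5.smul hc3).add (hc4.smul hc2)) y hy
    rw [intervalIntegral.integral_add (hc7.intervalIntegrable _ _)
      (hc6.intervalIntegrable _ _)]
    -- The two extra terms form the angular derivative of ω(W_t) U(W_t), which has equal values at 0
    -- and 2π.
    rw [intervalIntegral.integral_eq_sub_of_hasDerivAt (f := fun t =>
      frameForm T G Γ J e y (frame J e t y) • U (y, frame J e t y))
      (fun t _ => by
        have := (h.hasDerivAt_frameForm (e := e) hy t).fun_smul (h.hasDerivAt_comp_frame he1 hU hy t)
        rwa [add_comm] at this) (hc6.intervalIntegrable _ _)]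
    simp [frame]
  -- After exchanging the integrals, each fixed angle contributes the integral of a divergence,
  -- which is zero.
  rw [setIntegral_congr_fun hTm hfib, integral_integral_swap hQi]
  simp [hQT]

end LocalGeometry

section Coordinates

set_option linter.unusedSectionVars false

open MeasureTheory Topology

variable {M : Type*} [TopologicalSpace M] [ChartedSpace (EuclideanHalfSpace 2) M]
  [IsManifold (𝓡∂ 2) ∞ M]

/-! ### The area measure in coordinates -/

lemma sqrt_gMat_det (g : Metric M) (x₀ : M) (y : Plane) :
    Real.sqrt (gMat g x₀ y).det = areaDensity (metricCoord g x₀) y := by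
  rw [gMat_det]
  simp only [gMat_eq]
  rfl

lemma measurableSet_dom (x₀ : M) : MeasurableSet (dom x₀) := by
  rw [dom, extChartAt_target]
  exact ((chartAt (EuclideanHalfSpace 2) x₀).open_target.preimage
    (𝓡∂ 2).continuous_symm).measurableSet.inter (𝓡∂ 2).isClosed_range.measurableSet

lemma contDiffOn_areaDensity_metricCoord (g : Metric M) (x₀ : M) :
    ContDiffOn ℝ ∞ (areaDensity (metricCoord g x₀)) (dom x₀) := by
  have h := (contDiffOn_gMat_det g x₀).sqrt fun y hy => (gMat_det_pos g hy).ne'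
  exact h.congr fun y _ => (sqrt_gMat_det g x₀ y).symm

variable [MeasurableSpace M] [BorelSpace M]

lemma aemeasurable_pt (x₀ : M) (μ : Measure Plane) :
    AEMeasurable (pt x₀) (μ.restrict (dom x₀)) :=
  (continuousOn_extChartAt_symm x₀).aemeasurable (measurableSet_dom x₀)

/-- The Riemannian area measure of the domain of the chart at `x₀`. -/
def chartMeasure (g : Metric M) (x₀ : M) : Measure M :=
  Measure.map (pt x₀) ((volume.restrict (dom x₀)).withDensity
    fun y => ENNReal.ofReal (areaDensity (metricCoord g x₀) y))

lemma areaMeasure_eq (g : Metric M) : areaMeasure g = ⨆ x₀ : M, chartMeasure g x₀ := by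
  unfold areaMeasure chartMeasure
  simp only [sqrt_gMat_det]

lemma measurableSet_inter_pt (x₀ : M) {B : Set M} (hB : MeasurableSet B) :
    MeasurableSet (dom x₀ ∩ pt x₀ ⁻¹' B) := by
  have h1 : Measurable ((dom x₀).domRestrict (pt x₀)) :=
    (continuousOn_iff_continuous_domRestrict.1 (continuousOn_extChartAt_symm x₀)).measurable
  have h2 := (measurableSet_dom x₀).subtype_image (h1 hB)
  rwa [show (Subtype.val '' ((dom x₀).domRestrict (pt x₀) ⁻¹' B)) = dom x₀ ∩ pt x₀ ⁻¹' B by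
    ext y
    simp only [Set.mem_image, Set.mem_preimage, Subtype.exists, exists_and_right, exists_eq_right,
      Set.mem_inter_iff]
    exact ⟨fun ⟨h, h'⟩ => ⟨h, h'⟩, fun ⟨h, h'⟩ => ⟨h, h'⟩⟩] at h2

lemma chartMeasure_apply (g : Metric M) (x₀ : M) {B : Set M} (hB : MeasurableSet B) :
    chartMeasure g x₀ B = ∫⁻ y in dom x₀ ∩ pt x₀ ⁻¹' B,
      ENNReal.ofReal (areaDensity (metricCoord g x₀) y) := by
  rw [chartMeasure, Measure.map_apply_of_aemeasurable ((aemeasurable_pt x₀ volume).mono_ac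
    (withDensity_absolutelyContinuous _ _)) hB, withDensity_apply',
    Measure.restrict_restrict' (measurableSet_dom x₀), Set.inter_comm]

lemma areaDensity_transition (g : Metric M) {x₀ x₁ : M} {y : Plane} (hy : y ∈ dom x₀)
    (hy' : pt x₀ y ∈ (extChartAt (𝓡∂ 2) x₁).source) :
    areaDensity (metricCoord g x₀) y =
      |(jac x₀ x₁ y).det| * areaDensity (metricCoord g x₁) (transition x₀ x₁ y) := by
  rw [← sqrt_gMat_det, ← sqrt_gMat_det, gMat_det_transition g hy hy', Real.sqrt_mul (sq_nonneg _),
    Real.sqrt_sq_eq_abs]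

/-- The area measures of two charts agree on the overlap. -/
lemma chartMeasure_overlap (g : Metric M) (x₀ x₁ : M) {B : Set M} (hB : MeasurableSet B)
    (h₀ : B ⊆ (extChartAt (𝓡∂ 2) x₀).source) (h₁ : B ⊆ (extChartAt (𝓡∂ 2) x₁).source) :
    chartMeasure g x₁ B = chartMeasure g x₀ B := by
  rw [chartMeasure_apply g x₁ hB, chartMeasure_apply g x₀ hB]
  have himg : dom x₁ ∩ pt x₁ ⁻¹' B = transition x₀ x₁ '' (dom x₀ ∩ pt x₀ ⁻¹' B) := by
    ext y
    constructor
    · rintro ⟨hy, hyB⟩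
      refine ⟨transition x₁ x₀ y, ⟨transition_mem (h₀ hyB), ?_⟩, ?_⟩
      · rw [Set.mem_preimage, pt_transition (h₀ hyB)]
        exact hyB
      · change extChartAt (𝓡∂ 2) x₁ (pt x₀ (transition x₁ x₀ y)) = y
        rw [pt_transition (h₀ hyB)]
        exact (extChartAt (𝓡∂ 2) x₁).right_inv hy
    · rintro ⟨y, ⟨hy, hyB⟩, rfl⟩
      refine ⟨transition_mem (h₁ hyB), ?_⟩
      rw [Set.mem_preimage, pt_transition (h₁ hyB)]
      exact hyB
  have hinj : Set.InjOn (transition x₀ x₁) (dom x₀ ∩ pt x₀ ⁻¹' B) := by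
    rintro a ⟨ha, haB⟩ b ⟨hb, hbB⟩ hab
    have h := congrArg (pt x₁) hab
    rw [pt_transition (h₁ haB), pt_transition (h₁ hbB)] at h
    rw [← (extChartAt (𝓡∂ 2) x₀).right_inv ha, ← (extChartAt (𝓡∂ 2) x₀).right_inv hb]
    exact congrArg _ h
  have hm := measurableSet_inter_pt x₀ hB
  rw [himg, lintegral_image_eq_lintegral_abs_det_fderiv_mul volume hm
    (fun y hy => (hasFDerivWithinAt_transition hy.1 (h₁ hy.2)).mono Set.inter_subset_left) hinj]
  refine setLIntegral_congr_fun hm fun y hy => ?_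
  rw [areaDensity_transition g hy.1 (h₁ hy.2), ENNReal.ofReal_mul (abs_nonneg _)]

lemma chartMeasure_compl_source (g : Metric M) (x₀ : M) :
    chartMeasure g x₀ (extChartAt (𝓡∂ 2) x₀).sourceᶜ = 0 := by
  rw [chartMeasure_apply g x₀ (isOpen_extChartAt_source x₀).measurableSet.compl]
  have : dom x₀ ∩ pt x₀ ⁻¹' (extChartAt (𝓡∂ 2) x₀).sourceᶜ = ∅ := by
    ext y
    simp only [Set.mem_inter_iff, Set.mem_preimage, Set.mem_compl_iff, Set.mem_empty_iff_false,
      iff_false, not_and, not_not]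
    exact fun hy => pt_mem hy
  rw [this]
  simp

/-- The area measure is given by the area density in every chart. -/
lemma areaMeasure_restrict (g : Metric M) (x₀ : M) :
    (areaMeasure g).restrict (extChartAt (𝓡∂ 2) x₀).source = chartMeasure g x₀ := by
  set S := (extChartAt (𝓡∂ 2) x₀).source with hS
  have hSm : MeasurableSet S := (isOpen_extChartAt_source x₀).measurableSet
  have hres : (chartMeasure g x₀).restrict S = chartMeasure g x₀ :=
    Measure.restrict_eq_self_of_ae_mem (by
      rw [ae_iff]
      exact chartMeasure_compl_source g x₀)
  apply le_antisymm
  -- To bound the supremum it suffices to bound every chart measure by one explicit measure. Inside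
  -- `S` each of them is at most that of `x₀`, by agreement on overlaps; outside `S` the bound is
  -- infinity times the counting measure, which restriction to `S` discards.
  · have hle : areaMeasure g ≤ chartMeasure g x₀ + ((⊤ : ENNReal) • Measure.count).restrict Sᶜ := by
      rw [areaMeasure_eq]
      refine iSup_le fun x₁ => Measure.le_iff.2 fun B hB => ?_
      rw [← measure_inter_add_sdiff B hSm, Measure.add_apply]
      refine add_le_add ?_ ?_
      · have hS1 : MeasurableSet (extChartAt (𝓡∂ 2) x₁).source :=
          (isOpen_extChartAt_source x₁).measurableSet
        rw [← measure_inter_add_sdiff (B ∩ S) hS1]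
        have h0 : chartMeasure g x₁ ((B ∩ S) \ (extChartAt (𝓡∂ 2) x₁).source) = 0 :=
          measure_mono_null (fun y hy => hy.2) (chartMeasure_compl_source g x₁)
        rw [h0, add_zero, chartMeasure_overlap g x₀ x₁ ((hB.inter hSm).inter hS1)
          (fun y hy => hy.1.2) (fun y hy => hy.2)]
        exact measure_mono fun y hy => hy.1.1
      · rw [Measure.restrict_apply hB, ← Set.sdiff_eq]
        rcases Set.eq_empty_or_nonempty (B \ S) with h | h
        · rw [h]; simp
        · rw [Measure.smul_apply, smul_eq_mul, ENNReal.top_mul]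
          · exact le_top
          · exact (Measure.count_ne_zero h)
    calc (areaMeasure g).restrict S
        ≤ (chartMeasure g x₀ + ((⊤ : ENNReal) • Measure.count).restrict Sᶜ).restrict S :=
          Measure.restrict_mono le_rfl hle
      _ = chartMeasure g x₀ := by
          rw [Measure.restrict_add, hres, Measure.restrict_restrict hSm, Set.inter_compl_self,
            Measure.restrict_empty, add_zero]
  · rw [← hres, areaMeasure_eq]
    exact Measure.restrict_mono le_rfl (le_iSup (chartMeasure g) x₀)

/-- Each point has a neighbourhood whose coordinates fill part of a compact subset of the chart
image, on which the density is integrable. On a compact surface this makes continuous functions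
integrable. -/
instance (g : Metric M) : IsLocallyFiniteMeasure (areaMeasure g) := by
  refine ⟨fun x => ?_⟩
  have hx := mem_extChartAt_target (I := 𝓡∂ 2) x
  have hloc : LocallyCompactSpace (Set.range (𝓡∂ 2)) :=
    (𝓡∂ 2).isClosed_range.isClosedEmbedding_subtypeVal.locallyCompactSpace
  obtain ⟨K, hKn, hKT, hK⟩ : ∃ K ∈ 𝓝[Set.range (𝓡∂ 2)] (extChartAt (𝓡∂ 2) x x),
      K ⊆ dom x ∧ IsCompact K := by
    obtain ⟨U, hU, hUT⟩ := mem_nhdsWithin_iff_exists_mem_nhds_inter.1 (dom_mem_nhdsWithin hx)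
    obtain ⟨K, hKn, hKU, hK⟩ := local_compact_nhds hU
    refine ⟨K ∩ Set.range (𝓡∂ 2), Filter.inter_mem (mem_nhdsWithin_of_mem_nhds hKn)
      self_mem_nhdsWithin, fun y hy => hUT ⟨hKU hy.1, hy.2⟩, hK.inter_right (𝓡∂ 2).isClosed_range⟩
  set B : Set M := (extChartAt (𝓡∂ 2) x).source ∩ extChartAt (𝓡∂ 2) x ⁻¹' K with hB
  have hBn : B ∈ 𝓝 x := by
    refine Filter.inter_mem (extChartAt_source_mem_nhds x) ?_
    have h1 := (continuousAt_extChartAt (I := 𝓡∂ 2) x).tendsto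
    have h2 : Filter.Tendsto (extChartAt (𝓡∂ 2) x) (𝓝 x)
        (𝓝[Set.range (𝓡∂ 2)] (extChartAt (𝓡∂ 2) x x)) :=
      tendsto_nhdsWithin_iff.2 ⟨h1, Filter.Eventually.of_forall fun y => Set.mem_range_self _⟩
    exact h2 hKn
  obtain ⟨O, hOB, hO, hxO⟩ := mem_nhds_iff.1 hBn
  refine ⟨O, hO.mem_nhds hxO, ?_⟩
  have h1 : areaMeasure g O = chartMeasure g x O := by
    rw [← areaMeasure_restrict g x, Measure.restrict_apply hO.measurableSet,
      Set.inter_eq_left.2 fun y hy => (hOB hy).1]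
  rw [h1, chartMeasure_apply g x hO.measurableSet]
  refine lt_of_le_of_lt (lintegral_mono_set (t := K) ?_) ?_
  · rintro y ⟨hy, hyO⟩
    have := (hOB hyO).2
    rwa [Set.mem_preimage, (extChartAt (𝓡∂ 2) x).right_inv hy] at this
  · have h2 := (((contDiffOn_areaDensity_metricCoord g x).continuousOn.mono
      hKT).integrableOn_compact (μ := volume) hK)
    exact h2.lintegral_lt_top

/-- Integration over `M` in coordinates. -/
lemma integral_areaMeasure {F : Type*} [NormedAddCommGroup F] [NormedSpace ℝ F]
    [SecondCountableTopologyEither M F]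
    (g : Metric M) (x₀ : M) {f : M → F} (hf : Continuous f)
    (h0 : ∀ x ∉ (extChartAt (𝓡∂ 2) x₀).source, f x = 0) :
    ∫ x, f x ∂(areaMeasure g) =
      ∫ y in dom x₀, areaDensity (metricCoord g x₀) y • f (pt x₀ y) := by
  have hd : AEMeasurable (fun y => ENNReal.ofReal (areaDensity (metricCoord g x₀) y))
      (volume.restrict (dom x₀)) :=
    ((contDiffOn_areaDensity_metricCoord g x₀).continuousOn.aemeasurable
      (measurableSet_dom x₀)).ennreal_ofReal
  rw [← setIntegral_eq_integral_of_forall_compl_eq_zero h0, areaMeasure_restrict, chartMeasure,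
    integral_map ((aemeasurable_pt x₀ volume).mono_ac (withDensity_absolutelyContinuous _ _))
      hf.aestronglyMeasurable,
    integral_withDensity_eq_integral_toReal_smul₀ hd
      (Filter.Eventually.of_forall fun _ => ENNReal.ofReal_lt_top)]
  refine integral_congr_ae (Filter.Eventually.of_forall fun y => ?_)
  simp only
  rw [ENNReal.toReal_ofReal (show 0 ≤ areaDensity (metricCoord g x₀) y from Real.sqrt_nonneg _)]

end Coordinates

/-! ### Integration over the fibres -/

/-- With w = αb + βJb and z = α + iβ, rotating `w` by t gives |z| times the rotation of `b` by t +
arg z. Homogeneity removes the modulus, and 2π-periodicity removes the shift. -/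
lemma integral_circle_eq {E : Type*} [NormedAddCommGroup E] [NormedSpace ℝ E]
    {G : Plane →L[ℝ] Plane →L[ℝ] ℝ} {J : Plane →L[ℝ] Plane} (hR : IsRotation G J)
    {U : Plane → E} (hU : ∀ (c : ℝ) (w : Plane), 0 < c → U (c • w) = U w) {b w : Plane}
    (hb : b ≠ 0) (hw : w ≠ 0) :
    ∫ t in (0 : ℝ)..(2 * Real.pi), U (Real.cos t • w + Real.sin t • J w) =
      ∫ t in (0 : ℝ)..(2 * Real.pi), U (Real.cos t • b + Real.sin t • J b) := by
  obtain ⟨α, β, rfl⟩ := hR.mem_span hb w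
  set z : ℂ := ⟨α, β⟩ with hz
  have hz0 : z ≠ 0 := by
    intro h
    have h1 : α = 0 := congrArg Complex.re h
    have h2 : β = 0 := congrArg Complex.im h
    simp [h1, h2] at hw
  have hα : α = ‖z‖ * Real.cos z.arg := (Complex.norm_mul_cos_arg z).symm
  have hβ : β = ‖z‖ * Real.sin z.arg := (Complex.norm_mul_sin_arg z).symm
  have key : ∀ t : ℝ, U (Real.cos t • (α • b + β • J b) + Real.sin t • J (α • b + β • J b)) =
      U (Real.cos (t + z.arg) • b + Real.sin (t + z.arg) • J b) := by
    intro t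
    rw [← hU ‖z‖ (Real.cos (t + z.arg) • b + _) (norm_pos_iff.2 hz0), Real.cos_add, Real.sin_add,
      map_add, map_smul, map_smul, hR.sq]
    congr 1
    rw [hα, hβ]
    module
  simp only [key]
  rw [intervalIntegral.integral_comp_add_right
    (fun t => U (Real.cos t • b + Real.sin t • J b)), zero_add, add_comm (2 * Real.pi)]
  have hper : Function.Periodic (fun t : ℝ => U (Real.cos t • b + Real.sin t • J b))
      (2 * Real.pi) := fun t => by
    simp only [Real.cos_add_two_pi, Real.sin_add_two_pi]
  have := hper.intervalIntegral_add_eq z.arg 0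
  rwa [zero_add] at this

section Coordinates

set_option linter.unusedSectionVars false

open MeasureTheory Topology

variable {M : Type*} [TopologicalSpace M] [ChartedSpace (EuclideanHalfSpace 2) M]
  [IsManifold (𝓡∂ 2) ∞ M] {F : Type*} [NormedAddCommGroup F] [NormedSpace ℝ F]

/-- The integral over the fibre at `x`. -/
def fibreIntegral (g : Metric M) (o : SurfaceOrientation M) (f : SM g → F) (x : M) : F :=
  ∫ t in (0 : ℝ)..(2 * Real.pi),
    ext g f ⟨x, Real.cos t • baseVec g x + Real.sin t • rot g o x (baseVec g x)⟩

lemma baseVec_eq (g : Metric M) (x : M) : ∃ c : ℝ, 0 < c ∧ baseVec g x = c • vec x x (stdVec 0) :=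
  ⟨_, inv_pos.2 (Real.sqrt_pos.2 (g.pos x _
    (vec_ne_zero (mem_extChartAt_source x) (stdVec_ne_zero 0)))), rfl⟩

lemma baseVec_ne_zero (g : Metric M) (x : M) : baseVec g x ≠ 0 := by
  obtain ⟨c, hc, h⟩ := baseVec_eq g x
  rw [h]
  exact smul_ne_zero hc.ne' (vec_ne_zero (mem_extChartAt_source x) (stdVec_ne_zero 0))

/-- `baseVec` comes from the preferred chart and need not vary continuously; the fibre integral may
be started from any nonzero vector instead, in particular from the smooth `unitField`. -/
lemma fibreIntegral_pt (g : Metric M) (o : SurfaceOrientation M) (f : SM g → F) {x₀ : M} {y : Plane}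
    (hy : y ∈ dom x₀) {w : Plane} (hw : w ≠ 0) :
    fibreIntegral g o f (pt x₀ y) = ∫ t in (0 : ℝ)..(2 * Real.pi),
      loc g x₀ f (y, Real.cos t • w + Real.sin t • rotCoord g o x₀ y w) := by
  obtain ⟨b, hb⟩ := vec_surjective (pt_mem hy) (baseVec g (pt x₀ y))
  have hb0 : b ≠ 0 := by
    rintro rfl
    rw [map_zero] at hb
    exact baseVec_ne_zero g _ hb.symm
  rw [integral_circle_eq (U := fun w => loc g x₀ f (y, w)) (isRotation g o hy)
    (fun c w hc => loc_smul g x₀ f hc y w) hb0 hw]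
  unfold fibreIntegral
  rw [← hb]
  simp only [rot_vec_circle g o hy]
  rfl

/-- The unit vector field along the first coordinate direction. -/
def unitField (g : Metric M) (x₀ : M) (y : Plane) : Plane :=
  (Real.sqrt (metricCoord g x₀ y (stdVec 0) (stdVec 0)))⁻¹ • stdVec 0

lemma unitField_unit (g : Metric M) {x₀ : M} {y : Plane} (hy : y ∈ dom x₀) :
    metricCoord g x₀ y (unitField g x₀ y) (unitField g x₀ y) = 1 := by
  have h := metricCoord_pos g hy (stdVec_ne_zero 0)
  have h2 := Real.mul_self_sqrt h.le
  have h3 := (Real.sqrt_pos.2 h).ne'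
  simp only [unitField, map_smul, smul_apply, smul_eq_mul]
  field_simp
  rw [sq, h2]

lemma contDiffOn_unitField (g : Metric M) (x₀ : M) :
    ContDiffOn ℝ ∞ (unitField g x₀) (dom x₀) := by
  have h1 : ContDiffOn ℝ ∞ (fun y => metricCoord g x₀ y (stdVec 0) (stdVec 0)) (dom x₀) :=
    ((contDiffOn_metricCoord g x₀).clm_apply contDiffOn_const).clm_apply contDiffOn_const
  exact ((h1.sqrt fun y hy => (metricCoord_pos g hy (stdVec_ne_zero 0)).ne').inv
    fun y hy => (Real.sqrt_pos.2 (metricCoord_pos g hy (stdVec_ne_zero 0))).ne').smul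
      contDiffOn_const

lemma unitField_ne_zero (g : Metric M) {x₀ : M} {y : Plane} (hy : y ∈ dom x₀) :
    unitField g x₀ y ≠ 0 := fun h => by simpa [h] using unitField_unit g hy

lemma fibreIntegral_frame (g : Metric M) (o : SurfaceOrientation M) (f : SM g → F) {x₀ : M}
    {y : Plane} (hy : y ∈ dom x₀) :
    fibreIntegral g o f (pt x₀ y) = ∫ t in (0 : ℝ)..(2 * Real.pi),
      loc g x₀ f (y, frame (rotCoord g o x₀) (unitField g x₀) t y) :=
  fibreIntegral_pt g o f hy (unitField_ne_zero g hy)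

lemma IsSmooth.continuousOn_loc_frame {g : Metric M} (o : SurfaceOrientation M) {f : SM g → F}
    (hf : IsSmooth g f) (x₀ : M) :
    ContinuousOn (fun p : Plane × ℝ =>
      MagneticSurface.loc g x₀ f (p.1, frame (rotCoord g o x₀) (unitField g x₀) p.2 p.1)) (dom x₀ ×ˢ Set.univ) :=
  (localGeometry g o x₀).continuousOn_comp_frame (contDiffOn_unitField g x₀)
    (fun _ hy => unitField_unit g hy) (hf.loc x₀).continuousOn

lemma IsSmooth.continuous_fibreIntegral {g : Metric M} (o : SurfaceOrientation M) {f : SM g → F}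
    (hf : IsSmooth g f) : Continuous (fibreIntegral g o f) := by
  rw [continuous_iff_continuousAt]
  intro x
  have h1 : ContinuousOn (fun y => fibreIntegral g o f (pt x y)) (dom x) := by
    rw [continuousOn_iff_continuous_domRestrict]
    have h2 : Continuous fun y : dom x => ∫ t in (0 : ℝ)..(2 * Real.pi),
        MagneticSurface.loc g x f (y, frame (rotCoord g o x) (unitField g x) t y) := by
      apply intervalIntegral.continuous_parametric_intervalIntegral_of_continuous'
      have h3 : Continuous fun p : dom x × ℝ => ((p.1 : Plane), p.2) := by fun_prop
      have h4 := ContinuousOn.comp_continuous (hf.continuousOn_loc_frame o x) h3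
        fun p => ⟨p.1.2, trivial⟩
      exact h4
    exact h2.congr fun y => (fibreIntegral_frame g o f y.2).symm
  have h2 : ContinuousWithinAt (fun y => fibreIntegral g o f (pt x y)) (dom x)
      (extChartAt (𝓡∂ 2) x x) := h1 _ (mem_extChartAt_target x)
  have h3 : Filter.Tendsto (extChartAt (𝓡∂ 2) x) (𝓝 x) (𝓝[dom x] (extChartAt (𝓡∂ 2) x x)) := by
    refine tendsto_nhdsWithin_iff.2 ⟨(continuousAt_extChartAt x).tendsto, ?_⟩
    filter_upwards [extChartAt_source_mem_nhds (I := 𝓡∂ 2) x] with x' hx'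
    exact (extChartAt (𝓡∂ 2) x).map_source hx'
  have h4 := h2.tendsto.comp h3
  have h5 : fibreIntegral g o f =ᶠ[𝓝 x]
      (fun y => fibreIntegral g o f (pt x y)) ∘ extChartAt (𝓡∂ 2) x := by
    filter_upwards [extChartAt_source_mem_nhds (I := 𝓡∂ 2) x] with x' hx'
    rw [Function.comp_apply, pt, (extChartAt (𝓡∂ 2) x).left_inv hx']
  refine (h4.congr' h5.symm).trans ?_
  rw [pt, (extChartAt (𝓡∂ 2) x).left_inv (mem_extChartAt_source x)]

lemma integralSM_eq [MeasurableSpace M] (g : Metric M) (o : SurfaceOrientation M) (f : SM g → F) :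
    integralSM g o f = ∫ x, fibreIntegral g o f x ∂(areaMeasure g) := rfl

lemma exists_pt (x : M) : ∃ y ∈ dom x, pt x y = x :=
  ⟨_, mem_extChartAt_target x, (extChartAt (𝓡∂ 2) x).left_inv (mem_extChartAt_source x)⟩

lemma fibreIntegral_add {g : Metric M} (o : SurfaceOrientation M) {f h : SM g → F}
    (hf : IsSmooth g f) (hh : IsSmooth g h) (x : M) :
    fibreIntegral g o (fun p => f p + h p) x = fibreIntegral g o f x + fibreIntegral g o h x := by
  obtain ⟨y, hy, hyx⟩ := exists_pt x
  have hs : ∀ {f : SM g → F}, IsSmooth g f → Continuous fun t =>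
      loc g x f (y, frame (rotCoord g o x) (unitField g x) t y) := by
    intro f hf
    exact (hf.continuousOn_loc_frame o x).comp_continuous
      (f := fun t : ℝ => ((y, t) : Plane × ℝ)) (by fun_prop) fun t => ⟨hy, trivial⟩
  rw [← hyx, fibreIntegral_frame g o _ hy, fibreIntegral_frame g o _ hy,
    fibreIntegral_frame g o _ hy, ← intervalIntegral.integral_add
      ((hs hf).intervalIntegrable _ _) ((hs hh).intervalIntegrable _ _)]
  congr 1
  funext t
  unfold loc ext
  split_ifs <;> simp

/-- The integral of a vertical derivative over a fibre vanishes. -/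
lemma fibreIntegral_opV [CompleteSpace F] {g : Metric M} (o : SurfaceOrientation M) {f : SM g → F}
    (hf : IsSmooth g f) (x : M) : fibreIntegral g o (opV g o f) x = 0 := by
  obtain ⟨y, hy, hyx⟩ := exists_pt x
  rw [← hyx, fibreIntegral_frame g o _ hy]
  have hne : ∀ t, (y, frame (rotCoord g o x) (unitField g x) t y) ∈ punctured (dom x) := fun t =>
    ⟨hy, (localGeometry g o x).frame_ne_zero hy (unitField_unit g hy) t⟩
  have hc : Continuous fun t =>
      loc g x (opV g o f) (y, frame (rotCoord g o x) (unitField g x) t y) :=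
    ((hf.opV o).continuousOn_loc_frame o x).comp_continuous
      (f := fun t : ℝ => ((y, t) : Plane × ℝ)) (by fun_prop) fun t => ⟨hy, trivial⟩
  rw [intervalIntegral.integral_eq_sub_of_hasDerivAt (f := fun t =>
      loc g x f (y, frame (rotCoord g o x) (unitField g x) t y)) (fun t _ => by
      rw [loc_opV o hf x (hne t)]
      exact (localGeometry g o x).hasDerivAt_comp_frame (fun y hy => unitField_unit g hy)
        (hf.loc x) hy t) (hc.intervalIntegrable _ _)]
  simp [frame]

end Coordinates

section Coordinates

set_option linter.unusedSectionVars false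

open Topology

variable {M : Type*} [TopologicalSpace M] [ChartedSpace (EuclideanHalfSpace 2) M]
  [IsManifold (𝓡∂ 2) ∞ M]
  {E : Type*} [NormedAddCommGroup E] [NormedSpace ℝ E]
  {E' : Type*} [NormedAddCommGroup E'] [NormedSpace ℝ E']
  {F : Type*} [NormedAddCommGroup F] [NormedSpace ℝ F]

/-! ### Differential calculus on the unit tangent bundle -/

/-- The coordinates of a unit tangent vector in the chart at its base point. -/
def coords {g : Metric M} (p : SM g) : Plane × Plane := (extChartAt (𝓡∂ 2) p.1.1 p.1.1, p.1.2)

lemma coords_mem {g : Metric M} (p : SM g) : coords p ∈ punctured (dom p.1.1) :=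
  ⟨mem_extChartAt_target p.1.1, snd_ne_zero p⟩

lemma lift_coords {g : Metric M} (p : SM g) : lift p.1.1 (coords p) = p.1 := by
  have := lift_extChartAt p.1 p.1 (mem_extChartAt_source _)
  rwa [extChartAt_tangent_self] at this

lemma loc_coords {F : Type*} [Zero F] {g : Metric M} (u : SM g → F) (p : SM g) :
    loc g p.1.1 u (coords p) = u p := by
  rw [loc, lift_coords, ext_coe]

lemma len_coords {g : Metric M} (p : SM g) : len (metricCoord g p.1.1) (coords p) = 1 := by
  rw [len, ← inner_lift, lift_coords, p.2, Real.sqrt_one]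

/-- The directional derivative of a function on the unit tangent bundle. -/
def dirDeriv {g : Metric M} (p : SM g) (ξ : Plane × Plane) (u : SM g → F) : F :=
  fderivWithin ℝ (loc g p.1.1 u) (punctured (dom p.1.1)) (coords p) ξ

lemma opX_eq {g : Metric M} (o : SurfaceOrientation M) {u : SM g → F} (hu : IsSmooth g u)
    (p : SM g) : opX g u p = dirDeriv p (sprayField (chrisCoord g p.1.1) (coords p)) u := by
  rw [← loc_coords (opX g u) p, loc_opX o hu _ (coords_mem p), locX, len_coords, inv_one, one_smul,
    dirDeriv]

lemma opV_eq {g : Metric M} (o : SurfaceOrientation M) {u : SM g → F} (hu : IsSmooth g u)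
    (p : SM g) : opV g o u p = dirDeriv p (vertField (rotCoord g o p.1.1) (coords p)) u := by
  rw [← loc_coords (opV g o u) p, loc_opV o hu _ (coords_mem p)]
  rfl

lemma locX_congr {T : Set Plane} {G : Plane → Plane →L[ℝ] Plane →L[ℝ] ℝ}
    {Γ : Plane → Plane →L[ℝ] Plane →L[ℝ] Plane} {U W : Plane × Plane → F}
    (h : Set.EqOn U W (punctured T)) {z : Plane × Plane} (hz : z ∈ punctured T) :
    locX T G Γ U z = locX T G Γ W z := by
  rw [locX, locX, fderivWithin_congr h (h hz)]

lemma locV_congr {T : Set Plane} {J : Plane → Plane →L[ℝ] Plane} {U W : Plane × Plane → F}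
    (h : Set.EqOn U W (punctured T)) {z : Plane × Plane} (hz : z ∈ punctured T) :
    locV T J U z = locV T J W z := by
  rw [locV, locV, fderivWithin_congr h (h hz)]

lemma locXperp_congr {T : Set Plane} {G : Plane → Plane →L[ℝ] Plane →L[ℝ] ℝ}
    {Γ : Plane → Plane →L[ℝ] Plane →L[ℝ] Plane} {J : Plane → Plane →L[ℝ] Plane}
    {U W : Plane × Plane → F}
    (h : Set.EqOn U W (punctured T)) {z : Plane × Plane} (hz : z ∈ punctured T) :
    locXperp T G Γ J U z = locXperp T G Γ J W z := by
  rw [locXperp, locXperp, fderivWithin_congr h (h hz)]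

lemma loc_sub (g : Metric M) (x₀ : M) (u w : SM g → F) (z : Plane × Plane) :
    loc g x₀ (fun p => u p - w p) z = loc g x₀ u z - loc g x₀ w z := by
  unfold loc ext
  split_ifs <;> simp

lemma loc_add (g : Metric M) (x₀ : M) (u w : SM g → F) (z : Plane × Plane) :
    loc g x₀ (fun p => u p + w p) z = loc g x₀ u z + loc g x₀ w z := by
  unfold loc ext
  split_ifs <;> simp

lemma loc_clm (g : Metric M) (x₀ : M) (L : E →L[ℝ] F) (u : SM g → E) (z : Plane × Plane) :
    loc g x₀ (fun p => L (u p)) z = L (loc g x₀ u z) := by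
  unfold loc ext
  split_ifs <;> simp

lemma loc_bilin (g : Metric M) (x₀ : M) (B : E →L[ℝ] E' →L[ℝ] F) (u : SM g → E) (w : SM g → E')
    (z : Plane × Plane) :
    loc g x₀ (fun p => B (u p) (w p)) z = B (loc g x₀ u z) (loc g x₀ w z) := by
  unfold loc ext
  split_ifs <;> simp

lemma IsSmooth.add {g : Metric M} {u w : SM g → F} (hu : IsSmooth g u) (hw : IsSmooth g w) :
    IsSmooth g (fun p => u p + w p) := by
  rw [isSmooth_iff] at *
  exact fun x₀ => ((hu x₀).add (hw x₀)).congr fun z _ => loc_add g x₀ u w z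

lemma IsSmooth.sub {g : Metric M} {u w : SM g → F} (hu : IsSmooth g u) (hw : IsSmooth g w) :
    IsSmooth g (fun p => u p - w p) := by
  rw [isSmooth_iff] at *
  exact fun x₀ => ((hu x₀).sub (hw x₀)).congr fun z _ => loc_sub g x₀ u w z

lemma IsSmooth.clm {g : Metric M} (L : E →L[ℝ] F) {u : SM g → E} (hu : IsSmooth g u) :
    IsSmooth g (fun p => L (u p)) := by
  rw [isSmooth_iff] at *
  exact fun x₀ => (L.contDiff.comp_contDiffOn (hu x₀)).congr fun z _ => loc_clm g x₀ L u z

lemma IsSmooth.neg {g : Metric M} {u : SM g → F} (hu : IsSmooth g u) :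
    IsSmooth g (fun p => -u p) := hu.clm (-ContinuousLinearMap.id ℝ F)

lemma IsSmooth.bilin {g : Metric M} (B : E →L[ℝ] E' →L[ℝ] F) {u : SM g → E} {w : SM g → E'}
    (hu : IsSmooth g u) (hw : IsSmooth g w) : IsSmooth g (fun p => B (u p) (w p)) := by
  rw [isSmooth_iff] at *
  exact fun x₀ => ((B.contDiff.comp_contDiffOn (hu x₀)).clm_apply (hw x₀)).congr
    fun z _ => loc_bilin g x₀ B u w z

lemma isSmooth_zero (g : Metric M) : IsSmooth g (fun _ => (0 : F)) := by
  rw [isSmooth_iff]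
  refine fun x₀ => (contDiffOn_const (c := (0 : F))).congr fun z _ => ?_
  unfold loc ext
  split_ifs <;> rfl

lemma IsSmooth.sum {ι : Type*} {g : Metric M} (s : Finset ι) {u : ι → SM g → F}
    (hu : ∀ i, IsSmooth g (u i)) : IsSmooth g (fun p => ∑ i ∈ s, u i p) := by
  classical
  induction s using Finset.induction_on with
  | empty => simpa using isSmooth_zero g
  | insert a s ha ih =>
    simp only [Finset.sum_insert ha]
    exact (hu a).add ih

lemma IsSmooth.opXperp {g : Metric M} (o : SurfaceOrientation M) {u : SM g → F}
    (hu : IsSmooth g u) : IsSmooth g (opXperp g o u) :=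
  ((hu.opV o).opX o).sub ((hu.opX o).opV o)

section DirDeriv

variable {g : Metric M} (p : SM g) (ξ : Plane × Plane)

lemma IsSmooth.differentiableWithinAt {u : SM g → F} (hu : IsSmooth g u) :
    DifferentiableWithinAt ℝ (MagneticSurface.loc g p.1.1 u) (punctured (dom p.1.1)) (coords p) :=
  ((isSmooth_iff g u).1 hu p.1.1 _ (coords_mem p)).differentiableWithinAt (by simp)

lemma uniqueDiffWithinAt_coords :
    UniqueDiffWithinAt ℝ (punctured (dom p.1.1)) (coords p) :=
  ((uniqueDiffOn_extChartAt_target p.1.1).prod isOpen_compl_singleton.uniqueDiffOn) _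
    (coords_mem p)

lemma dirDeriv_add {u w : SM g → F} (hu : IsSmooth g u) (hw : IsSmooth g w) :
    dirDeriv p ξ (fun q => u q + w q) = dirDeriv p ξ u + dirDeriv p ξ w := by
  unfold dirDeriv
  rw [show loc g p.1.1 (fun q => u q + w q) = _ from funext (loc_add g p.1.1 u w),
    fderivWithin_fun_add (uniqueDiffWithinAt_coords p) (hu.differentiableWithinAt p)
      (hw.differentiableWithinAt p)]
  rfl

lemma dirDeriv_clm (L : E →L[ℝ] F) {u : SM g → E} (hu : IsSmooth g u) :
    dirDeriv p ξ (fun q => L (u q)) = L (dirDeriv p ξ u) := by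
  unfold dirDeriv
  rw [show loc g p.1.1 (fun q => L (u q)) = _ from funext (loc_clm g p.1.1 L u),
    HasFDerivWithinAt.fderivWithin (f := fun z => L (MagneticSurface.loc g p.1.1 u z))
      (L.hasFDerivAt.comp_hasFDerivWithinAt _ (hu.differentiableWithinAt p).hasFDerivWithinAt)
      (uniqueDiffWithinAt_coords p)]
  rfl

lemma dirDeriv_bilin (B : E →L[ℝ] E' →L[ℝ] F) {u : SM g → E} {w : SM g → E'}
    (hu : IsSmooth g u) (hw : IsSmooth g w) :
    dirDeriv p ξ (fun q => B (u q) (w q)) = B (dirDeriv p ξ u) (w p) + B (u p) (dirDeriv p ξ w) := by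
  unfold dirDeriv
  rw [show loc g p.1.1 (fun q => B (u q) (w q)) = _ from funext (loc_bilin g p.1.1 B u w),
    HasFDerivWithinAt.fderivWithin
      (f := fun z => B (MagneticSurface.loc g p.1.1 u z) (MagneticSurface.loc g p.1.1 w z))
      ((B.hasFDerivAt.comp_hasFDerivWithinAt _
      (hu.differentiableWithinAt p).hasFDerivWithinAt).clm_apply
      (hw.differentiableWithinAt p).hasFDerivWithinAt) (uniqueDiffWithinAt_coords p)]
  simp only [add_apply, ContinuousLinearMap.comp_apply, ContinuousLinearMap.flip_apply,
    Function.comp_apply, loc_coords]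
  rw [add_comm]

end DirDeriv

variable {g : Metric M} (o : SurfaceOrientation M)

lemma opX_add (o : SurfaceOrientation M) {u w : SM g → F} (hu : IsSmooth g u) (hw : IsSmooth g w) (p : SM g) :
    opX g (fun q => u q + w q) p = opX g u p + opX g w p := by
  rw [opX_eq o hu, opX_eq o hw, opX_eq o (hu.add hw), dirDeriv_add p _ hu hw]

lemma opV_add {u w : SM g → F} (hu : IsSmooth g u) (hw : IsSmooth g w) (p : SM g) :
    opV g o (fun q => u q + w q) p = opV g o u p + opV g o w p := by
  rw [opV_eq o hu, opV_eq o hw, opV_eq o (hu.add hw), dirDeriv_add p _ hu hw]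

lemma opX_clm (o : SurfaceOrientation M) (L : E →L[ℝ] F) {u : SM g → E} (hu : IsSmooth g u) (p : SM g) :
    opX g (fun q => L (u q)) p = L (opX g u p) := by
  rw [opX_eq o hu, opX_eq o (hu.clm L), dirDeriv_clm p _ L hu]

lemma opV_clm (L : E →L[ℝ] F) {u : SM g → E} (hu : IsSmooth g u) (p : SM g) :
    opV g o (fun q => L (u q)) p = L (opV g o u p) := by
  rw [opV_eq o hu, opV_eq o (hu.clm L), dirDeriv_clm p _ L hu]

lemma opX_bilin (o : SurfaceOrientation M) (B : E →L[ℝ] E' →L[ℝ] F)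
    {u : SM g → E} {w : SM g → E'}
    (hu : IsSmooth g u) (hw : IsSmooth g w) (p : SM g) :
    opX g (fun q => B (u q) (w q)) p = B (opX g u p) (w p) + B (u p) (opX g w p) := by
  rw [opX_eq o hu, opX_eq o hw, opX_eq o (hu.bilin B hw), dirDeriv_bilin p _ B hu hw]

lemma opV_bilin (B : E →L[ℝ] E' →L[ℝ] F) {u : SM g → E} {w : SM g → E'}
    (hu : IsSmooth g u) (hw : IsSmooth g w) (p : SM g) :
    opV g o (fun q => B (u q) (w q)) p = B (opV g o u p) (w p) + B (u p) (opV g o w p) := by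
  rw [opV_eq o hu, opV_eq o hw, opV_eq o (hu.bilin B hw), dirDeriv_bilin p _ B hu hw]

/-! ### The structure equations of the unit tangent bundle -/

/-- By definition X_⊥ is a commutator of two operators. This identifies it in a chart with a single
directional derivative, from which its linearity and Leibniz rules follow. -/
lemma loc_opXperp {u : SM g → F} (hu : IsSmooth g u) (x₀ : M) {z : Plane × Plane}
    (hz : z ∈ punctured (dom x₀)) :
    loc g x₀ (opXperp g o u) z =
      locXperp (dom x₀) (metricCoord g x₀) (chrisCoord g x₀) (rotCoord g o x₀) (loc g x₀ u) z := by
  have hG := localGeometry g o x₀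
  rw [← hG.locX_locV (hu.loc x₀) hz]
  rw [show opXperp g o u = fun p => opX g (opV g o u) p - opV g o (opX g u) p from rfl, loc_sub,
    loc_opX o (hu.opV o) x₀ hz, loc_opV o (hu.opX o) x₀ hz,
    locX_congr (fun z hz => loc_opV o hu x₀ hz) hz, locV_congr (fun z hz => loc_opX o hu x₀ hz) hz]

lemma opXperp_eq {u : SM g → F} (hu : IsSmooth g u) (p : SM g) :
    opXperp g o u p =
      -dirDeriv p (horField (chrisCoord g p.1.1) (rotCoord g o p.1.1) (coords p)) u := by
  rw [← loc_coords (opXperp g o u) p, loc_opXperp o hu _ (coords_mem p), locXperp, len_coords,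
    inv_one, one_smul, dirDeriv]

lemma opXperp_clm (L : E →L[ℝ] F) {u : SM g → E} (hu : IsSmooth g u) (p : SM g) :
    opXperp g o (fun q => L (u q)) p = L (opXperp g o u p) := by
  rw [opXperp_eq o hu, opXperp_eq o (hu.clm L), dirDeriv_clm p _ L hu, map_neg]

lemma opXperp_add {u w : SM g → F} (hu : IsSmooth g u) (hw : IsSmooth g w) (p : SM g) :
    opXperp g o (fun q => u q + w q) p = opXperp g o u p + opXperp g o w p := by
  rw [opXperp_eq o hu, opXperp_eq o hw, opXperp_eq o (hu.add hw), dirDeriv_add p _ hu hw, neg_add]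

lemma opXperp_bilin (B : E →L[ℝ] E' →L[ℝ] F) {u : SM g → E} {w : SM g → E'}
    (hu : IsSmooth g u) (hw : IsSmooth g w) (p : SM g) :
    opXperp g o (fun q => B (u q) (w q)) p =
      B (opXperp g o u p) (w p) + B (u p) (opXperp g o w p) := by
  rw [opXperp_eq o hu, opXperp_eq o hw, opXperp_eq o (hu.bilin B hw), dirDeriv_bilin p _ B hu hw,
    map_neg, map_neg, neg_apply, neg_add]

/-- `[V, X_⊥] = X`. -/
lemma opV_opXperp {u : SM g → F} (hu : IsSmooth g u) (p : SM g) :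
    opV g o (opXperp g o u) p - opXperp g o (opV g o u) p = opX g u p := by
  have hG := localGeometry g o p.1.1
  have hp := coords_mem p
  rw [← loc_coords (opX g u) p, loc_opX o hu _ hp, ← hG.locV_locXperp (hu.loc _) hp,
    ← loc_coords (opV g o (opXperp g o u)) p, loc_opV o (hu.opXperp o) _ hp,
    locV_congr (fun z hz => loc_opXperp o hu _ hz) hp,
    ← loc_coords (opXperp g o (opV g o u)) p, loc_opXperp o (hu.opV o) _ hp,
    locXperp_congr (fun z hz => loc_opV o hu _ hz) hp]

end Coordinates

/-! ### One-forms as functions on the unit tangent bundle -/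

/-- The function of degree zero on the nonzero tangent vectors defined by a 1-form. -/
def formFun {F : Type*} [NormedAddCommGroup F] [NormedSpace ℝ F]
    (G : Plane → Plane →L[ℝ] Plane →L[ℝ] ℝ) (α : Plane → Plane →L[ℝ] F)
    (z : Plane × Plane) : F :=
  (len G z)⁻¹ • α z.1 z.2

namespace LocalGeometry

variable {T : Set Plane} {G : Plane → Plane →L[ℝ] Plane →L[ℝ] ℝ}
  {Γ : Plane → Plane →L[ℝ] Plane →L[ℝ] Plane} {J : Plane → Plane →L[ℝ] Plane}
  {F : Type*} [NormedAddCommGroup F] [NormedSpace ℝ F] {α : Plane → Plane →L[ℝ] F}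
  {z : Plane × Plane}

lemma smooth_formFun (h : LocalGeometry T G Γ J) (hα : ContDiffOn ℝ ∞ α T) :
    ContDiffOn ℝ ∞ (formFun G α) (punctured T) :=
  h.smooth_len_inv.smul ((hα.comp contDiffOn_fst fun _ hx => hx.1).clm_apply contDiffOn_snd)

lemma fderivWithin_formFun (h : LocalGeometry T G Γ J) (hα : ContDiffOn ℝ ∞ α T)
    (hz : z ∈ punctured T) {v : Plane × Plane}
    (hv : v = sprayField Γ z ∨ v = vertField J z ∨ v = horField Γ J z) :
    fderivWithin ℝ (formFun G α) (punctured T) z v =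
      (len G z)⁻¹ • (fderivWithin ℝ α T z.1 v.1 z.2 + α z.1 v.2) := by
  have h1 := (comp_fst ((hα z.1 hz.1).differentiableWithinAt (by simp)).hasFDerivWithinAt).clm_apply
    (hasFDerivWithinAt_snd (𝕜 := ℝ) (s := punctured T) (p := z))
  unfold formFun
  rw [h.fderivWithin_len_smul hz h1.differentiableWithinAt hv,
    h1.fderivWithin (h.uniqueDiff_punctured z hz)]
  simp [add_comm]

lemma locV_formFun (h : LocalGeometry T G Γ J) (hα : ContDiffOn ℝ ∞ α T) (hz : z ∈ punctured T) :
    locV T J (formFun G α) z = formFun G (fun y => (α y).comp (J y)) z := by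
  rw [locV, h.fderivWithin_formFun hα hz (Or.inr (Or.inl rfl))]
  simp [vertField, formFun]

/-- The exterior derivative of a 1-form, expressed by horizontal derivatives. -/
lemma locXperp_formFun_add (h : LocalGeometry T G Γ J) (hα : ContDiffOn ℝ ∞ α T)
    (hz : z ∈ punctured T) :
    locXperp T G Γ J (formFun G α) z + locX T G Γ (formFun G (fun y => (α y).comp (J y))) z =
      (len G z ^ 2)⁻¹ • (fderivWithin ℝ α T z.1 z.2 (J z.1 z.2)
        - fderivWithin ℝ α T z.1 (J z.1 z.2) z.2) := by
  have hβ : ContDiffOn ℝ ∞ (fun y => (α y).comp (J y)) T := hα.clm_comp h.smoothJ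
  -- The derivative of `J` is rewritten by `parallel`. Its Christoffel terms then cancel those of
  -- the spray and of the horizontal lift, leaving the antisymmetrized derivative of `α`.
  have hd : fderivWithin ℝ (fun y => (α y).comp (J y)) T z.1 z.2 z.2 =
      fderivWithin ℝ α T z.1 z.2 (J z.1 z.2)
        + α z.1 (J z.1 (Γ z.1 z.2 z.2) - Γ z.1 z.2 (J z.1 z.2)) := by
    have h1 := ((hα z.1 hz.1).differentiableWithinAt (by simp)).hasFDerivWithinAt.clm_comp
      (h.hasJ hz.1)
    rw [h1.fderivWithin (h.uniqueDiff z.1 hz.1), ← h.parallel hz.1]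
    simp [add_comm]
  rw [locXperp, locX, h.fderivWithin_formFun hα hz (Or.inr (Or.inr rfl)),
    h.fderivWithin_formFun hβ hz (Or.inl rfl)]
  simp only [horField, sprayField, hd, ContinuousLinearMap.comp_apply, map_neg, map_sub]
  rw [sq, mul_inv]
  module

end LocalGeometry

section Coordinates

set_option linter.unusedSectionVars false

open Topology

variable {M : Type*} [TopologicalSpace M] [ChartedSpace (EuclideanHalfSpace 2) M]
  [IsManifold (𝓡∂ 2) ∞ M]
  {F : Type*} [NormedAddCommGroup F] [NormedSpace ℝ F]

/-! ### The Gaussian curvature -/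

lemma pd_eq {x₀ : M} {y : Plane} (hy : y ∈ dom x₀) (i : Fin 2) (f : Plane → F) :
    pd i f y = fderivWithin ℝ f (dom x₀) y (stdVec i) := by
  rw [pd, fderivWithin_dom hy]

lemma chrisCoord_stdVec (g : Metric M) (x₀ : M) (y : Plane) (i j k : Fin 2) :
    chrisCoord g x₀ y (stdVec i) (stdVec j) k = christoffel g x₀ k i j y := by
  rw [chrisCoord, bilin_stdVec]

lemma pd_christoffel (g : Metric M) (o : SurfaceOrientation M) {x₀ : M} {y : Plane}
    (hy : y ∈ dom x₀) (i j k l : Fin 2) :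
    pd i (christoffel g x₀ l j k) y =
      fderivWithin ℝ (chrisCoord g x₀) (dom x₀) y (stdVec i) (stdVec j) (stdVec k) l := by
  have hG := localGeometry g o x₀
  have h1 := (EuclideanSpace.proj (𝕜 := ℝ) l).hasFDerivAt.comp_hasFDerivWithinAt y
    (((hG.hasΓ hy).clm_apply (hasFDerivWithinAt_const (stdVec j) y _)).clm_apply
      (hasFDerivWithinAt_const (stdVec k) y _))
  have h2 : christoffel g x₀ l j k =
      (EuclideanSpace.proj (𝕜 := ℝ) l) ∘ fun y => chrisCoord g x₀ y (stdVec j) (stdVec k) :=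
    funext fun y => (chrisCoord_stdVec g x₀ y j k l).symm
  rw [pd_eq hy, h2, h1.fderivWithin (hG.uniqueDiff y hy)]
  simp

lemma riemann_eq (g : Metric M) (o : SurfaceOrientation M) {x₀ : M} {y : Plane}
    (hy : y ∈ dom x₀) (l k i j : Fin 2) :
    riemann g x₀ l k i j y =
      curvTensor (dom x₀) (chrisCoord g x₀) y (stdVec i) (stdVec j) (stdVec k) l := by
  have h : ∀ i j k : Fin 2, chrisCoord g x₀ y (stdVec i) (chrisCoord g x₀ y (stdVec j) (stdVec k)) l
      = ∑ m, christoffel g x₀ l i m y * christoffel g x₀ m j k y := fun i j k => by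
    conv_lhs => rw [plane_eq (chrisCoord g x₀ y (stdVec j) (stdVec k))]
    simp only [map_add, map_smul, PiLp.add_apply, PiLp.smul_apply, chrisCoord_stdVec,
      Fin.sum_univ_two, smul_eq_mul]
    ring
  rw [riemann, pd_christoffel g o hy, pd_christoffel g o hy, curvTensor]
  simp only [PiLp.add_apply, PiLp.sub_apply, h, Finset.sum_sub_distrib]
  ring

lemma gaussCurv_eq (g : Metric M) (o : SurfaceOrientation M) (x : M) :
    gaussCurv g x =
      metricCoord g x (extChartAt (𝓡∂ 2) x x)
        (curvTensor (dom x) (chrisCoord g x) (extChartAt (𝓡∂ 2) x x)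
          (stdVec 0) (stdVec 1) (stdVec 1)) (stdVec 0) /
      (metricCoord g x (extChartAt (𝓡∂ 2) x x) (stdVec 0) (stdVec 0) *
        metricCoord g x (extChartAt (𝓡∂ 2) x x) (stdVec 1) (stdVec 1) -
        metricCoord g x (extChartAt (𝓡∂ 2) x x) (stdVec 0) (stdVec 1) ^ 2) := by
  have hy := mem_extChartAt_target (I := 𝓡∂ 2) x
  rw [gaussCurv, gMat_det, metricCoord_symm]
  simp only [riemann_eq g o hy, Fin.sum_univ_two]
  conv_rhs => rw [plane_eq (curvTensor _ _ _ _ _ _)]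
  simp only [gMat_eq, map_add, map_smul, smul_eq_mul]
  ring

variable {g : Metric M} (o : SurfaceOrientation M)

/-- `[X, X_⊥] = -K V`. -/
lemma opX_opXperp {u : SM g → F} (hu : IsSmooth g u) (p : SM g) :
    opX g (opXperp g o u) p - opXperp g o (opX g u) p = -(gaussCurv g p.1.1 • opV g o u p) := by
  have hG := localGeometry g o p.1.1
  have hp := coords_mem p
  have h1 : metricCoord g p.1.1 (coords p).1 (coords p).2 (coords p).2 = 1 := by
    rw [← hG.len_sq hp, len_coords, one_pow]
  have hc : curvTensor (dom p.1.1) (chrisCoord g p.1.1) (coords p).1 (coords p).2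
      (rotCoord g o p.1.1 (coords p).1 (coords p).2) (coords p).2 =
      (-gaussCurv g p.1.1) • rotCoord g o p.1.1 (coords p).1 (coords p).2 := by
    rw [hG.curvTensor_rotation hp.1, h1, mul_one, gaussCurv_eq g o]
    rfl
  rw [← loc_coords (opX g (opXperp g o u)) p, loc_opX o (hu.opXperp o) _ hp,
    locX_congr (fun z hz => loc_opXperp o hu _ hz) hp,
    ← loc_coords (opXperp g o (opX g u)) p, loc_opXperp o (hu.opX o) _ hp,
    locXperp_congr (fun z hz => loc_opX o hu _ hz) hp, hG.locX_locXperp (hu.loc _) hp, len_coords,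
    hc, opV_eq o hu, one_pow, inv_one, one_smul, dirDeriv, ← neg_smul]
  refine Eq.trans (congrArg _ ?_) (ContinuousLinearMap.map_smul _ _ _)
  ext1
  · simp [vertField]
  · rfl

/-! ### Functions on the base -/

lemma loc_base (f : M → F) (x₀ : M) {z : Plane × Plane} (hz : z ∈ punctured (dom x₀)) :
    loc g x₀ (fun q => f q.1.1) z = f (pt x₀ z.1) := by
  rw [loc, ext_of_ne_zero g _ (lift_snd_ne_zero hz)]
  rfl

lemma contDiffOn_comp_pt {f : M → F} (hf : ContMDiff (𝓡∂ 2) 𝓘(ℝ, F) ∞ f) (x₀ : M) :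
    ContDiffOn ℝ ∞ (fun y => f (pt x₀ y)) (dom x₀) := by
  rw [← contMDiffOn_iff_contDiffOn]
  exact hf.comp_contMDiffOn (contMDiffOn_extChartAt_symm x₀)

lemma isSmooth_base (g : Metric M) {f : M → F} (hf : ContMDiff (𝓡∂ 2) 𝓘(ℝ, F) ∞ f) :
    IsSmooth g (fun q : SM g => f q.1.1) := by
  rw [isSmooth_iff]
  exact fun x₀ => ((contDiffOn_comp_pt hf x₀).comp contDiffOn_fst fun _ hz => hz.1).congr
    fun z hz => loc_base f x₀ hz

lemma dirDeriv_base {f : M → F} (hf : ContMDiff (𝓡∂ 2) 𝓘(ℝ, F) ∞ f) (p : SM g)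
    (ξ : Plane × Plane) :
    dirDeriv p ξ (fun q : SM g => f q.1.1) = mfderiv (𝓡∂ 2) 𝓘(ℝ, F) f p.1.1 ξ.1 := by
  have hp := coords_mem p
  have hd : MDifferentiableAt (𝓡∂ 2) 𝓘(ℝ, F) f p.1.1 := (hf p.1.1).mdifferentiableAt (by simp)
  have h1 := LocalGeometry.comp_fst (((contDiffOn_comp_pt hf p.1.1) _ hp.1).differentiableWithinAt
    (by simp)).hasFDerivWithinAt
  rw [dirDeriv, fderivWithin_congr (fun z hz => loc_base f p.1.1 hz) (loc_base f p.1.1 hp),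
    h1.fderivWithin (uniqueDiffWithinAt_coords p), hd.mfderiv, fderivWithin_dom hp.1]
  rfl

lemma opV_base {f : M → F} (hf : ContMDiff (𝓡∂ 2) 𝓘(ℝ, F) ∞ f) (p : SM g) :
    opV g o (fun q : SM g => f q.1.1) p = 0 := by
  rw [opV_eq o (isSmooth_base g hf), dirDeriv_base hf]
  exact map_zero _

lemma rot_coords (p : SM g) :
    @Eq Plane (rot g o p.1.1 p.1.2) (rotCoord g o p.1.1 (coords p).1 (coords p).2) := by
  have h := rot_vec g o (coords_mem p).1 (coords p).2
  have hx : pt p.1.1 (coords p).1 = p.1.1 :=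
    (extChartAt (𝓡∂ 2) p.1.1).left_inv (mem_extChartAt_source _)
  rw [hx] at h
  have e : vec p.1.1 p.1.1 (coords p).2 = p.1.2 := vec_self p.1.1 _
  rw [e] at h
  exact h.trans (vec_self p.1.1 _)

lemma opXperp_base {f : M → F} (hf : ContMDiff (𝓡∂ 2) 𝓘(ℝ, F) ∞ f) (p : SM g) :
    opXperp g o (fun q : SM g => f q.1.1) p =
      -(mfderiv (𝓡∂ 2) 𝓘(ℝ, F) f p.1.1 (rot g o p.1.1 p.1.2) : F) := by
  rw [opXperp_eq o (isSmooth_base g hf), dirDeriv_base hf]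
  exact congrArg (fun v : Plane => -(mfderiv (𝓡∂ 2) 𝓘(ℝ, F) f p.1.1 v : F)) (rot_coords o p).symm

end Coordinates

section Coordinates

set_option linter.unusedSectionVars false

open Topology

variable {M : Type*} [TopologicalSpace M] [ChartedSpace (EuclideanHalfSpace 2) M]
  [IsManifold (𝓡∂ 2) ∞ M] {n : ℕ}

/-! ### Connections in coordinates -/

/-- A matrix entry of a connection as a 1-form in the chart at `x₀`. -/
def connForm (A : UnitaryConnection M n) (x₀ : M) (a b : Fin n) (y : Plane) : Plane →L[ℝ] ℂ :=
  (EuclideanSpace.proj 0 : Plane →L[ℝ] ℝ).smulRight (connCoord A x₀ 0 y a b)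
    + (EuclideanSpace.proj 1 : Plane →L[ℝ] ℝ).smulRight (connCoord A x₀ 1 y a b)

lemma connForm_stdVec (A : UnitaryConnection M n) (x₀ : M) (a b : Fin n) (y : Plane) (i : Fin 2) :
    connForm A x₀ a b y (stdVec i) = connCoord A x₀ i y a b := by
  fin_cases i <;> simp [connForm]

lemma connForm_apply (A : UnitaryConnection M n) (x₀ : M) (a b : Fin n) (y w : Plane) :
    connForm A x₀ a b y w = A.form (pt x₀ y) (vec x₀ (pt x₀ y) w) a b := by
  conv_rhs => rw [plane_eq w]
  rw [map_add, map_smul, map_smul, map_add, map_smul, map_smul]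
  simp only [connForm, connCoord, coordVec_eq, add_apply, ContinuousLinearMap.smulRight_apply,
    PiLp.proj_apply, Matrix.add_apply, Matrix.smul_apply]

lemma contDiffOn_connForm (A : UnitaryConnection M n) (x₀ : M) (a b : Fin n) :
    ContDiffOn ℝ ∞ (connForm A x₀ a b) (dom x₀) := by
  have h : ∀ i : Fin 2, ContDiffOn ℝ ∞ (fun y => connCoord A x₀ i y a b) (dom x₀) := by
    intro i
    have h1 := (A.smooth a b).comp_contMDiffOn (contMDiffOn_lift x₀)
    rw [contMDiffOn_iff_contDiffOn] at h1
    exact h1.comp (contDiffOn_id.prodMk (contDiffOn_const (c := stdVec i)))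
      fun y hy => ⟨hy, trivial⟩
  exact (contDiffOn_const.smulRight (h 0)).add (contDiffOn_const.smulRight (h 1))

lemma loc_conn (g : Metric M) (A : UnitaryConnection M n) (a b : Fin n) (x₀ : M)
    {z : Plane × Plane} (hz : z ∈ punctured (dom x₀)) :
    loc g x₀ (fun q => A.form q.1.1 q.1.2 a b) z =
      formFun (metricCoord g x₀) (connForm A x₀ a b) z := by
  have hl : Real.sqrt (g.inner (lift x₀ z).1 (lift x₀ z).2 (lift x₀ z).2) =
      len (metricCoord g x₀) z := by
    rw [inner_lift]
    rfl
  rw [loc, ext_of_ne_zero g _ (lift_snd_ne_zero hz), formFun, connForm_apply, ← hl]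
  change A.form (pt x₀ z.1) ((Real.sqrt (g.inner (lift x₀ z).1 (lift x₀ z).2 (lift x₀ z).2))⁻¹ •
    (vec x₀ (pt x₀ z.1) z.2)) a b = _
  rw [map_smul]
  rfl

variable {g : Metric M} (o : SurfaceOrientation M) (A : UnitaryConnection M n) (a b : Fin n)

lemma isSmooth_conn (g : Metric M) (o : SurfaceOrientation M) (A : UnitaryConnection M n)
    (a b : Fin n) : IsSmooth g (fun q : SM g => A.form q.1.1 q.1.2 a b) := by
  rw [isSmooth_iff]
  exact fun x₀ => ((localGeometry g o x₀).smooth_formFun (contDiffOn_connForm A x₀ a b)).congr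
    fun z hz => loc_conn g A a b x₀ hz

lemma loc_opV_conn (x₀ : M) {z : Plane × Plane} (hz : z ∈ punctured (dom x₀)) :
    loc g x₀ (opV g o (fun q : SM g => A.form q.1.1 q.1.2 a b)) z =
      formFun (metricCoord g x₀) (fun y => (connForm A x₀ a b y).comp (rotCoord g o x₀ y)) z := by
  rw [loc_opV o (isSmooth_conn g o A a b) _ hz,
    locV_congr (fun z hz => loc_conn g A a b _ hz) hz,
    (localGeometry g o x₀).locV_formFun (contDiffOn_connForm A x₀ a b) hz]

lemma pt_coords (p : SM g) : pt p.1.1 (coords p).1 = p.1.1 :=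
  (extChartAt (𝓡∂ 2) p.1.1).left_inv (mem_extChartAt_source _)

lemma connForm_coords (p : SM g) (w : Plane) :
    connForm A p.1.1 a b (coords p).1 w = A.form p.1.1 w a b := by
  rw [connForm_apply, pt_coords]
  exact congrArg (fun v : Plane => A.form p.1.1 v a b) (vec_self p.1.1 w)

lemma opV_conn (p : SM g) :
    opV g o (fun q : SM g => A.form q.1.1 q.1.2 a b) p =
      A.form p.1.1 (rot g o p.1.1 p.1.2) a b := by
  rw [← loc_coords (opV g o _) p, loc_opV_conn o A a b _ (coords_mem p), formFun, len_coords,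
    inv_one, one_smul]
  refine (connForm_coords A a b p _).trans ?_
  exact congrArg (fun v : Plane => A.form p.1.1 v a b) (rot_coords o p).symm

lemma opV_opV_conn (p : SM g) :
    opV g o (opV g o (fun q : SM g => A.form q.1.1 q.1.2 a b)) p = -A.form p.1.1 p.1.2 a b := by
  have hp := coords_mem p
  have hG := localGeometry g o p.1.1
  rw [← loc_coords (opV g o (opV g o _)) p, loc_opV o ((isSmooth_conn g o A a b).opV o) _ hp,
    locV_congr (fun z hz => loc_opV_conn o A a b _ hz) hp,
    hG.locV_formFun ((contDiffOn_connForm A _ a b).clm_comp hG.smoothJ) hp, formFun, len_coords,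
    inv_one, one_smul]
  simp only [ContinuousLinearMap.comp_apply]
  rw [(hG.rotation _ hp.1).sq, map_neg]
  exact congrArg Neg.neg (connForm_coords A a b p _)

/-- For a unit vector v the pair (v, iv) is orthonormal and positively oriented, so its coordinate
determinant is the reciprocal of the signed area coefficient. This turns the components of a 2-form
into its Hodge star. -/
lemma wedge_rot (p : SM g) :
    (coords p).2 0 * (rotCoord g o p.1.1 (coords p).1 (coords p).2) 1 -
      (coords p).2 1 * (rotCoord g o p.1.1 (coords p).1 (coords p).2) 0 =
      orientationSign (o.orient p.1.1) / Real.sqrt (gMat g p.1.1 (coords p).1).det := by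
  have hp := coords_mem p
  have hG := localGeometry g o p.1.1
  have hlen : metricCoord g p.1.1 (coords p).1 (coords p).2 (coords p).2 = 1 := by
    rw [← hG.len_sq hp, len_coords, one_pow]
  have hd := gMat_det_pos g hp.1
  have hs := Real.sqrt_pos.2 hd
  have hsq := Real.sq_sqrt hd.le
  rw [← chartSign_self]
  set r := Real.sqrt (gMat g p.1.1 (coords p).1).det with hr
  rw [rotCoord_zero, rotCoord_one, pt_coords, ← hr]
  rw [metricCoord_entries] at hlen
  linear_combination (chartSign o p.1.1 p.1.1 / r) * hlen

lemma pd_connCoord (x₀ : M) {y : Plane} (hy : y ∈ dom x₀) (i j : Fin 2) :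
    pd i (fun z => connCoord A x₀ j z a b) y =
      fderivWithin ℝ (connForm A x₀ a b) (dom x₀) y (stdVec i) (stdVec j) := by
  have h1 := (((contDiffOn_connForm A x₀ a b) y hy).differentiableWithinAt
    (by simp)).hasFDerivWithinAt.clm_apply (hasFDerivWithinAt_const (stdVec j) y _)
  simp only [← connForm_stdVec A x₀ a b]
  rw [pd_eq hy, h1.fderivWithin (uniqueDiffOn_extChartAt_target x₀ y hy)]
  simp

/-- The structure equation `⋆F_A = X_⊥ A + X (V A) + [A, V A]`. -/
lemma starCurvature_eq (p : SM g) :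
    starCurvature g o A p.1.1 a b =
      opXperp g o (fun q : SM g => A.form q.1.1 q.1.2 a b) p
        + opX g (opV g o (fun q : SM g => A.form q.1.1 q.1.2 a b)) p
        + (A.form p.1.1 p.1.2 * A.form p.1.1 (rot g o p.1.1 p.1.2)
          - A.form p.1.1 (rot g o p.1.1 p.1.2) * A.form p.1.1 p.1.2) a b := by
  have hp := coords_mem p
  have hG := localGeometry g o p.1.1
  have hA := isSmooth_conn g o A a b
  rw [← loc_coords (opXperp g o _) p, ← loc_coords (opX g (opV g o _)) p,
    loc_opXperp o hA _ hp, loc_opX o (hA.opV o) _ hp,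
    locXperp_congr (fun z hz => loc_conn g A a b _ hz) hp,
    locX_congr (fun z hz => loc_opV_conn o A a b _ hz) hp,
    hG.locXperp_formFun_add (contDiffOn_connForm A _ a b) hp, len_coords, one_pow, inv_one, one_smul]
  have hw := wedge_rot o p
  have hrot : ∀ c d, A.form p.1.1 (rot g o p.1.1 p.1.2) c d = connForm A p.1.1 c d (coords p).1
      (rotCoord g o p.1.1 (coords p).1 (coords p).2) := fun c d => by
    rw [connForm_coords]
    exact congrArg (fun v : Plane => A.form p.1.1 v c d) (rot_coords o p)
  have hid : ∀ c d, A.form p.1.1 p.1.2 c d = connForm A p.1.1 c d (coords p).1 (coords p).2 :=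
    fun c d => (connForm_coords A c d p _).symm
  have hexp : ∀ c d (w : Plane), connForm A p.1.1 c d (coords p).1 w =
      w 0 • connCoord A p.1.1 0 (coords p).1 c d + w 1 • connCoord A p.1.1 1 (coords p).1 c d :=
    fun c d w => by simp [connForm]
  have hmul : (A.form p.1.1 p.1.2 * A.form p.1.1 (rot g o p.1.1 p.1.2)
      - A.form p.1.1 (rot g o p.1.1 p.1.2) * A.form p.1.1 p.1.2) a b =
      (orientationSign (o.orient p.1.1) / Real.sqrt (gMat g p.1.1 (coords p).1).det) •
      (connCoord A p.1.1 0 (coords p).1 * connCoord A p.1.1 1 (coords p).1 -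
        connCoord A p.1.1 1 (coords p).1 * connCoord A p.1.1 0 (coords p).1) a b := by
    rw [← hw]
    simp only [Matrix.sub_apply, Matrix.mul_apply, hrot, hid, hexp, ← Finset.sum_sub_distrib,
      Finset.smul_sum]
    refine Finset.sum_congr rfl fun c _ => ?_
    simp only [Complex.real_smul]
    push_cast
    ring
  rw [hmul]
  have hD : ∀ v w : Plane, fderivWithin ℝ (connForm A p.1.1 a b) (dom p.1.1) (coords p).1 v w -
      fderivWithin ℝ (connForm A p.1.1 a b) (dom p.1.1) (coords p).1 w v =
      (v 0 * w 1 - v 1 * w 0) •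
        (pd 0 (fun z => connCoord A p.1.1 1 z a b) (coords p).1
          - pd 1 (fun z => connCoord A p.1.1 0 z a b) (coords p).1) := by
    intro v w
    rw [pd_connCoord A a b _ hp.1, pd_connCoord A a b _ hp.1]
    conv_lhs => rw [plane_eq v, plane_eq w]
    simp only [map_add, map_smul, add_apply, smul_apply]
    module
  rw [hD, hw, ← smul_add]
  rfl

end Coordinates

section Coordinates

set_option linter.unusedSectionVars false

open MeasureTheory Topology

variable {M : Type*} [TopologicalSpace M] [ChartedSpace (EuclideanHalfSpace 2) M]
  [IsManifold (𝓡∂ 2) ∞ M]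
  {F : Type*} [NormedAddCommGroup F] [NormedSpace ℝ F]

/-! ### Integration by parts on the unit tangent bundle -/

/-- A point with vanishing first coordinate is not interior to the half plane, hence lies on the
frontier of the chart image. Thus the Dirichlet condition on `M` supplies the edge condition of the
divergence theorem. -/
lemma pt_mem_boundary {x₀ : M} {y : Plane} (hy : y ∈ dom x₀) (h0 : y 0 = 0) :
    pt x₀ y ∈ (𝓡∂ 2).boundary M := by
  have hs := pt_mem hy
  rw [extChartAt_source] at hs
  refine (ModelWithCorners.isBoundaryPoint_iff_of_mem_atlas (n := ∞) (by simp)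
    (chart_mem_atlas _ x₀) hs).2 ?_
  change extChartAt (𝓡∂ 2) x₀ (pt x₀ y) ∈ frontier (dom x₀)
  rw [pt, (extChartAt (𝓡∂ 2) x₀).right_inv hy]
  refine ⟨subset_closure hy, fun h => ?_⟩
  have h1 := interior_mono (extChartAt_target_subset_range x₀) h
  rw [interior_range_modelWithCornersEuclideanHalfSpace] at h1
  exact h1.ne' h0

lemma fibreIntegral_eq_zero (g : Metric M) (o : SurfaceOrientation M) {f : SM g → F} {x : M}
    (h : ∀ p : SM g, p.1.1 = x → f p = 0) : fibreIntegral g o f x = 0 := by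
  unfold fibreIntegral
  have : ∀ t : ℝ, ext g f ⟨x, Real.cos t • baseVec g x + Real.sin t • rot g o x (baseVec g x)⟩ = 0 := by
    intro t
    unfold ext
    split_ifs
    · exact h _ rfl
    · rfl
  simp [this]

lemma dirDeriv_eq_zero {g : Metric M} {f : SM g → F} {K : Set M} (hK : IsClosed K)
    (h0 : ∀ p : SM g, p.1.1 ∉ K → f p = 0) (p : SM g) (hp : p.1.1 ∉ K) (ξ : Plane × Plane) :
    dirDeriv p ξ f = 0 := by
  have hmem := coords_mem p
  have hpK : pt p.1.1 (coords p).1 ∉ K := by rwa [pt_coords]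
  have hzero : ∀ z ∈ punctured (dom p.1.1), pt p.1.1 z.1 ∉ K →
      MagneticSurface.loc g p.1.1 f z = 0 := by
    intro z hz hzK
    rw [MagneticSurface.loc, ext_of_ne_zero g _ (lift_snd_ne_zero hz)]
    exact h0 _ hzK
  have hc : ContinuousWithinAt (fun z : Plane × Plane => pt p.1.1 z.1) (punctured (dom p.1.1))
      (coords p) :=
    (continuousOn_extChartAt_symm p.1.1 _ hmem.1).comp continuous_fst.continuousWithinAt
      fun z hz => hz.1
  have h1 : MagneticSurface.loc g p.1.1 f =ᶠ[𝓝[punctured (dom p.1.1)] coords p] fun _ => 0 := by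
    filter_upwards [self_mem_nhdsWithin, hc.eventually (hK.isOpen_compl.mem_nhds hpK)] with z hz hz'
    exact hzero z hz hz'
  rw [dirDeriv, h1.fderivWithin_eq (hzero _ hmem hpK)]
  simp

variable [T2Space M] [MeasurableSpace M] [BorelSpace M]

/-- The support lies over a single chart, so `LocalGeometry.integral_locX_eq_zero` applies with the
coordinate image of `K`; outside the chart the fibre integrals vanish. -/
lemma integralSM_opX_of_support [SecondCountableTopologyEither M F] [CompleteSpace F]
    {g : Metric M} (o : SurfaceOrientation M) {f : SM g → F} (hf : IsSmooth g f) (x₀ : M)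
    {K : Set M} (hK : IsCompact K) (hKs : K ⊆ (extChartAt (𝓡∂ 2) x₀).source)
    (h0 : ∀ p : SM g, p.1.1 ∉ K → f p = 0)
    (hb : ∀ p : SM g, p.1.1 ∈ (𝓡∂ 2).boundary M → f p = 0) :
    integralSM g o (opX g f) = 0 := by
  have hG := localGeometry g o x₀
  rw [integralSM_eq, integral_areaMeasure g x₀ ((hf.opX o).continuous_fibreIntegral o)]
  · have hrange : Set.range (𝓡∂ 2) = {y : Plane | 0 ≤ y 0} :=
      range_modelWithCornersEuclideanHalfSpace 2
    have hloc0 : ∀ z ∈ punctured (dom x₀), ∀ P : M → Prop, (∀ p : SM g, P p.1.1 → f p = 0) →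
        P (pt x₀ z.1) → loc g x₀ f z = 0 := by
      intro z hz P hP hPz
      rw [loc, ext_of_ne_zero g _ (lift_snd_ne_zero hz)]
      exact hP _ hPz
    have key := hG.integral_locX_eq_zero (K := extChartAt (𝓡∂ 2) x₀ '' K)
      (e := unitField g x₀) (U := loc g x₀ f)
      (hrange ▸ extChartAt_target_subset_range x₀)
      (fun y hy => hrange ▸ dom_mem_nhdsWithin hy) (measurableSet_dom x₀)
      (hK.image_of_continuousOn ((continuousOn_extChartAt x₀).mono hKs))
      (by rintro _ ⟨x, hx, rfl⟩; exact (extChartAt (𝓡∂ 2) x₀).map_source (hKs hx))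
      (contDiffOn_unitField g x₀) (fun y hy => unitField_unit g hy) (hf.loc x₀)
      (fun z hz hzK => hloc0 z hz (fun x => x ∉ K) h0 fun hx =>
        hzK ⟨_, hx, (extChartAt (𝓡∂ 2) x₀).right_inv hz.1⟩)
      (fun z hz hz0 => hloc0 z hz _ hb (pt_mem_boundary hz.1 hz0))
    rw [← key]
    refine setIntegral_congr_fun (measurableSet_dom x₀) fun y hy => ?_
    rw [fibreIntegral_frame g o _ hy]
    congr 2
    funext t
    exact loc_opX o hf x₀ ⟨hy, hG.frame_ne_zero hy (unitField_unit g hy) t⟩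
  · intro x hx
    refine fibreIntegral_eq_zero g o fun p hp => ?_
    rw [opX_eq o hf]
    exact dirDeriv_eq_zero hK.isClosed h0 p (fun h => hx (hKs (hp ▸ h))) _

variable [CompactSpace M]

lemma IsSmooth.integrable_fibreIntegral [SecondCountableTopologyEither M F] {g : Metric M}
    (o : SurfaceOrientation M) {f : SM g → F} (hf : IsSmooth g f) :
    Integrable (fibreIntegral g o f) (areaMeasure g) := by
  have := (hf.continuous_fibreIntegral o).continuousOn.integrableOn_compact
    (μ := areaMeasure g) isCompact_univ
  rwa [integrableOn_univ] at this

lemma integralSM_add [SecondCountableTopologyEither M F] {g : Metric M} (o : SurfaceOrientation M)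
    {f h : SM g → F} (hf : IsSmooth g f) (hh : IsSmooth g h) :
    integralSM g o (fun p => f p + h p) = integralSM g o f + integralSM g o h := by
  rw [integralSM_eq, integralSM_eq, integralSM_eq,
    ← integral_add (hf.integrable_fibreIntegral o) (hh.integrable_fibreIntegral o)]
  exact integral_congr_ae (Filter.Eventually.of_forall fun x => fibreIntegral_add o hf hh x)

lemma integralSM_zero (g : Metric M) (o : SurfaceOrientation M) :
    integralSM g o (fun _ => (0 : F)) = 0 := by
  rw [integralSM_eq]
  have : fibreIntegral g o (fun _ => (0 : F)) = fun _ => 0 :=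
    funext fun x => fibreIntegral_eq_zero g o fun _ _ => rfl
  rw [this, integral_zero]

/-- The vertical vector field preserves the volume of the unit tangent bundle. -/
theorem integralSM_opV [CompleteSpace F] {g : Metric M} (o : SurfaceOrientation M) {f : SM g → F}
    (hf : IsSmooth g f) : integralSM g o (opV g o f) = 0 := by
  rw [integralSM_eq]
  simp [funext (fibreIntegral_opV o hf)]

lemma opX_zero {g : Metric M} (o : SurfaceOrientation M) (p : SM g) :
    opX g (fun _ => (0 : F)) p = 0 := by
  have := opX_clm (F := F) (u := fun _ : SM g => (0 : F)) o 0 (isSmooth_zero g) p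
  simpa using this

lemma integralSM_opX_sum [SecondCountableTopologyEither M F] {ι : Type*} {g : Metric M}
    (o : SurfaceOrientation M) (s : Finset ι) {f : ι → SM g → F} (hf : ∀ i, IsSmooth g (f i)) :
    integralSM g o (opX g fun p => ∑ i ∈ s, f i p) = ∑ i ∈ s, integralSM g o (opX g (f i)) := by
  classical
  induction s using Finset.induction_on with
  | empty =>
    simp only [Finset.sum_empty]
    rw [show opX g (fun _ : SM g => (0 : F)) = fun _ => 0 from funext (opX_zero o), integralSM_zero]
  | insert a s ha ih =>
    simp only [Finset.sum_insert ha]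
    rw [← ih, ← integralSM_add o ((hf a).opX o) ((IsSmooth.sum s hf).opX o)]
    congr 1
    exact funext (opX_add o (hf a) (IsSmooth.sum s hf))

/-- The geodesic vector field preserves the volume of the unit tangent bundle. -/
theorem integralSM_opX [SecondCountableTopologyEither M F] [CompleteSpace F] {g : Metric M}
    (o : SurfaceOrientation M) {f : SM g → F} (hf : IsSmooth g f)
    (hb : ∀ p : SM g, p.1.1 ∈ (𝓡∂ 2).boundary M → f p = 0) :
    integralSM g o (opX g f) = 0 := by
  -- Each product ρᵢ f is supported over one chart and still vanishes over the boundary; compactness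
  -- leaves finitely many nonzero ones.
  obtain ⟨ρ, hρ⟩ := SmoothPartitionOfUnity.exists_isSubordinate_chartAt_source (𝓡∂ 2) M
  have hfin := ρ.locallyFinite.finite_nonempty_of_compact
  set s : Finset M := hfin.toFinset
  let fi : M → SM g → F := fun i p => ρ i p.1.1 • f p
  have hfi : ∀ i, IsSmooth g (fi i) := fun i =>
    (isSmooth_base g (ρ i).contMDiff).bilin (ContinuousLinearMap.lsmul ℝ ℝ) hf
  have hsum : f = fun p => ∑ i ∈ s, fi i p := by
    funext p
    have h1 := ρ.sum_eq_one (Set.mem_univ p.1.1)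
    rw [finsum_eq_sum_of_support_subset (s := s)] at h1
    · simp only [fi, ← Finset.sum_smul, h1, one_smul]
    · intro i hi
      simp only [s, Set.Finite.coe_toFinset, Set.mem_ofPred_eq]
      exact ⟨p.1.1, hi⟩
  rw [hsum, integralSM_opX_sum o s hfi]
  refine Finset.sum_eq_zero fun i _ => ?_
  refine integralSM_opX_of_support o (hfi i) i (K := tsupport (ρ i)) (isClosed_tsupport _).isCompact
    ?_ ?_ ?_
  · rw [extChartAt_source]
    exact hρ i
  · intro p hp
    simp only [fi]
    rw [image_eq_zero_of_notMem_tsupport hp, zero_smul]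
  · intro p hp
    simp only [fi]
    rw [hb p hp, smul_zero]

end Coordinates

/-! ### Matrices acting on vectors -/

section MatVec

variable {n : ℕ}

/-- A matrix applied to a vector of the Euclidean space. -/
def matVec (B : Matrix (Fin n) (Fin n) ℂ) (v : EuclideanSpace ℂ (Fin n)) :
    EuclideanSpace ℂ (Fin n) :=
  WithLp.toLp 2 (B.mulVec v.ofLp)

variable (B C : Matrix (Fin n) (Fin n) ℂ) (v w : EuclideanSpace ℂ (Fin n))

lemma matVec_add : matVec B (v + w) = matVec B v + matVec B w := by
  simp [matVec, Matrix.mulVec_add]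

lemma matVec_sub : matVec B (v - w) = matVec B v - matVec B w := by
  simp [matVec, Matrix.mulVec_sub]

lemma matVec_smul (c : ℝ) : matVec B (c • v) = c • matVec B v := by
  simp [matVec, Matrix.mulVec_smul]

lemma matVec_neg : matVec B (-v) = -matVec B v := by
  simp [matVec, Matrix.mulVec_neg]

lemma add_matVec : matVec (B + C) v = matVec B v + matVec C v := by
  simp [matVec, Matrix.add_mulVec]

lemma sub_matVec : matVec (B - C) v = matVec B v - matVec C v := by
  simp [matVec, Matrix.sub_mulVec]

lemma neg_matVec : matVec (-B) v = -matVec B v := by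
  simp [matVec, Matrix.neg_mulVec]

lemma zero_matVec : matVec 0 v = 0 := by
  simp [matVec]

lemma mul_matVec : matVec (B * C) v = matVec B (matVec C v) := by
  simp [matVec, Matrix.mulVec_mulVec]

lemma inner_matVec : inner ℂ w (matVec B v) = inner ℂ (matVec B.conjTranspose w) v := by
  simp only [matVec, EuclideanSpace.inner_eq_star_dotProduct, Matrix.star_mulVec,
    Matrix.conjTranspose_conjTranspose]
  rw [dotProduct_comm, Matrix.dotProduct_mulVec, dotProduct_comm]

/-- The bilinear map `(c, v) ↦ c v_j e_i`. -/
def entryMap (i j : Fin n) :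
    ℂ →L[ℝ] EuclideanSpace ℂ (Fin n) →L[ℝ] EuclideanSpace ℂ (Fin n) :=
  ((ContinuousLinearMap.lsmul ℝ ℂ (E := EuclideanSpace ℂ (Fin n))).flip.comp
    (((EuclideanSpace.proj j : EuclideanSpace ℂ (Fin n) →L[ℂ] ℂ).smulRight
      (EuclideanSpace.single i (1 : ℂ))).restrictScalars ℝ)).flip

lemma entryMap_apply (i j : Fin n) (c : ℂ) : entryMap i j c v =
    c • v j • EuclideanSpace.single i (1 : ℂ) := rfl

/-- Writing the matrix action as a finite sum of constant bilinear maps reduces smoothness and the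
Leibniz rule to the bilinear case. -/
lemma matVec_eq_sum : matVec B v = ∑ i, ∑ j, entryMap i j (B i j) v := by
  ext k
  have h : (∑ i, ∑ j, entryMap i j (B i j) v) k =
      (EuclideanSpace.proj k : EuclideanSpace ℂ (Fin n) →L[ℂ] ℂ)
        (∑ i, ∑ j, entryMap i j (B i j) v) := rfl
  rw [h]
  simp only [map_sum, entryMap_apply, map_smul, PiLp.proj_apply, PiLp.single_apply,
    smul_eq_mul, mul_ite, mul_one, mul_zero]
  rw [Finset.sum_eq_single k (fun i _ hi => Finset.sum_eq_zero fun j _ => by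
    rw [if_neg hi.symm]) (by simp)]
  simp [matVec, Matrix.mulVec, dotProduct]

/-- The Hermitian inner product as a real bilinear map. -/
def innerR (n : ℕ) :
    EuclideanSpace ℂ (Fin n) →L[ℝ] EuclideanSpace ℂ (Fin n) →L[ℝ] ℂ :=
  LinearMap.mkContinuous₂ (LinearMap.mk₂ ℝ (fun v w : EuclideanSpace ℂ (Fin n) => inner ℂ v w)
    (fun _ _ _ => inner_add_left _ _ _) (fun c v w => by
      rw [RCLike.real_smul_eq_coe_smul (K := ℂ), inner_smul_left]; simp)
    (fun _ _ _ => inner_add_right _ _ _) (fun c v w => by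
      rw [RCLike.real_smul_eq_coe_smul (K := ℂ), inner_smul_right]; simp)) 1
    (fun v w => by simpa using norm_inner_le_norm v w)

end MatVec

section Coordinates

set_option linter.unusedSectionVars false

variable {M : Type*} [TopologicalSpace M] [ChartedSpace (EuclideanHalfSpace 2) M]
  [IsManifold (𝓡∂ 2) ∞ M] {F : Type*} [NormedAddCommGroup F] [NormedSpace ℝ F] {n : ℕ}
  {g : Metric M} (o : SurfaceOrientation M)

/-! ### Matrix-valued functions on the unit tangent bundle -/

lemma dirDeriv_zero (p : SM g) (ξ : Plane × Plane) : dirDeriv p ξ (fun _ => (0 : F)) = 0 := by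
  have := dirDeriv_clm (F := F) p ξ 0 (isSmooth_zero (F := F) g)
  simpa using this

lemma dirDeriv_sum {ι : Type*} (p : SM g) (ξ : Plane × Plane) (s : Finset ι) {f : ι → SM g → F}
    (hf : ∀ i, IsSmooth g (f i)) :
    dirDeriv p ξ (fun q => ∑ i ∈ s, f i q) = ∑ i ∈ s, dirDeriv p ξ (f i) := by
  classical
  induction s using Finset.induction_on with
  | empty => simpa using dirDeriv_zero p ξ
  | insert a s ha ih =>
    simp only [Finset.sum_insert ha]
    rw [dirDeriv_add p ξ (hf a) (IsSmooth.sum s hf), ih]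

lemma mulMat_eq (B : SM g → Matrix (Fin n) (Fin n) ℂ) (u : SM g → EuclideanSpace ℂ (Fin n)) :
    mulMat g B u = fun p => ∑ i, ∑ j, entryMap i j (B p i j) (u p) :=
  funext fun p => matVec_eq_sum (B p) (u p)

variable {B : SM g → Matrix (Fin n) (Fin n) ℂ} {u : SM g → EuclideanSpace ℂ (Fin n)}

lemma IsSmooth.mulMat (hB : ∀ i j, IsSmooth g fun p => B p i j) (hu : IsSmooth g u) :
    IsSmooth g (mulMat g B u) := by
  rw [mulMat_eq]
  exact IsSmooth.sum _ fun i => IsSmooth.sum _ fun j => (hB i j).bilin (entryMap i j) hu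

lemma dirDeriv_mulMat (p : SM g) (ξ : Plane × Plane) (hB : ∀ i j, IsSmooth g fun p => B p i j)
    (hu : IsSmooth g u) :
    dirDeriv p ξ (mulMat g B u) =
      matVec (Matrix.of fun i j => dirDeriv p ξ fun q => B q i j) (u p)
        + matVec (B p) (dirDeriv p ξ u) := by
  rw [mulMat_eq, dirDeriv_sum p ξ _ fun i => IsSmooth.sum _ fun j =>
    (hB i j).bilin (entryMap i j) hu, matVec_eq_sum, matVec_eq_sum, ← Finset.sum_add_distrib]
  refine Finset.sum_congr rfl fun i _ => ?_
  rw [dirDeriv_sum p ξ _ fun j => (hB i j).bilin (entryMap i j) hu, ← Finset.sum_add_distrib]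
  exact Finset.sum_congr rfl fun j _ => dirDeriv_bilin p ξ (entryMap i j) (hB i j) hu

lemma opX_mulMat (o : SurfaceOrientation M) (hB : ∀ i j, IsSmooth g fun p => B p i j) (hu : IsSmooth g u) (p : SM g) :
    opX g (mulMat g B u) p = matVec (Matrix.of fun i j => opX g (fun q => B q i j) p) (u p)
      + matVec (B p) (opX g u p) := by
  rw [opX_eq o (hu.mulMat hB), dirDeriv_mulMat p _ hB hu, opX_eq o hu]
  simp only [opX_eq o (hB _ _)]

lemma opV_mulMat (hB : ∀ i j, IsSmooth g fun p => B p i j) (hu : IsSmooth g u) (p : SM g) :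
    opV g o (mulMat g B u) p = matVec (Matrix.of fun i j => opV g o (fun q => B q i j) p) (u p)
      + matVec (B p) (opV g o u p) := by
  rw [opV_eq o (hu.mulMat hB), dirDeriv_mulMat p _ hB hu, opV_eq o hu]
  simp only [opV_eq o (hB _ _)]

lemma opXperp_mulMat (hB : ∀ i j, IsSmooth g fun p => B p i j) (hu : IsSmooth g u) (p : SM g) :
    opXperp g o (mulMat g B u) p =
      matVec (Matrix.of fun i j => opXperp g o (fun q => B q i j) p) (u p)
        + matVec (B p) (opXperp g o u p) := by
  rw [opXperp_eq o (hu.mulMat hB), dirDeriv_mulMat p _ hB hu, opXperp_eq o hu]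
  simp only [opXperp_eq o (hB _ _)]
  rw [neg_add, ← neg_matVec, matVec_neg]
  rfl

end Coordinates

section Coordinates

set_option linter.unusedSectionVars false

open MeasureTheory

variable {M : Type*} [TopologicalSpace M] [ChartedSpace (EuclideanHalfSpace 2) M]
  [IsManifold (𝓡∂ 2) ∞ M] {n : ℕ}
  {g : Metric M} (o : SurfaceOrientation M)

/-! ### The Hermitian pairing -/

section Pairing

variable [MeasurableSpace M]

lemma fibreIntegral_conj (g : Metric M) (o : SurfaceOrientation M) (f : SM g → ℂ) (x : M) :
    fibreIntegral g o (fun p => starRingEnd ℂ (f p)) x = starRingEnd ℂ (fibreIntegral g o f x) := by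
  unfold fibreIntegral
  rw [intervalIntegral.integral_of_le Real.two_pi_pos.le,
    intervalIntegral.integral_of_le Real.two_pi_pos.le, ← integral_conj]
  congr 1
  funext t
  unfold ext
  split_ifs <;> simp

lemma integralSM_conj (g : Metric M) (o : SurfaceOrientation M) (f : SM g → ℂ) :
    integralSM g o (fun p => starRingEnd ℂ (f p)) = starRingEnd ℂ (integralSM g o f) := by
  rw [integralSM_eq, integralSM_eq, ← integral_conj]
  simp only [fibreIntegral_conj]

lemma integralSM_ofReal (g : Metric M) (o : SurfaceOrientation M) (f : SM g → ℝ) :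
    ((integralSM g o f : ℝ) : ℂ) = integralSM g o (fun p => (f p : ℂ)) := by
  rw [integralSM_eq, integralSM_eq]
  refine (integral_ofReal (𝕜 := ℂ)).symm.trans ?_
  congr 1
  funext x
  unfold fibreIntegral
  refine (intervalIntegral.integral_ofReal).symm.trans ?_
  congr 1
  funext t
  unfold ext
  split_ifs <;> simp

variable (u w : SM g → EuclideanSpace ℂ (Fin n))

lemma pairing_conj : pairing g o w u = starRingEnd ℂ (pairing g o u w) := by
  unfold pairing
  rw [← integralSM_conj]
  simp only [inner_conj_symm]

lemma normSq_eq : (normSq g o u : ℂ) = pairing g o u u := by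
  unfold normSq pairing
  rw [integralSM_ofReal]
  congr 1
  funext p
  rw [inner_self_eq_norm_sq_to_K]
  simp

lemma pairing_congr {u u' w w' : SM g → EuclideanSpace ℂ (Fin n)}
    (h : ∀ p, inner ℂ (w p) (u p) = inner ℂ (w' p) (u' p)) : pairing g o u w = pairing g o u' w' := by
  unfold pairing
  simp only [h]

variable [T2Space M] [CompactSpace M] [BorelSpace M]
variable {u w} {u' w' : SM g → EuclideanSpace ℂ (Fin n)}

lemma IsSmooth.inner (hu : IsSmooth g u) (hw : IsSmooth g w) :
    IsSmooth g (fun p => inner ℂ (u p) (w p)) :=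
  hu.bilin (innerR n) hw

lemma pairing_add_left (hu : IsSmooth g u) (hu' : IsSmooth g u') (hw : IsSmooth g w) :
    pairing g o (fun p => u p + u' p) w = pairing g o u w + pairing g o u' w := by
  unfold pairing
  rw [← integralSM_add o (hw.inner hu) (hw.inner hu')]
  simp only [inner_add_right]

lemma pairing_add_right (hu : IsSmooth g u) (hw : IsSmooth g w) (hw' : IsSmooth g w') :
    pairing g o u (fun p => w p + w' p) = pairing g o u w + pairing g o u w' := by
  rw [pairing_conj, pairing_add_left o hw hw' hu, map_add, ← pairing_conj, ← pairing_conj]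

/-- The vertical vector field is skew-adjoint. -/
lemma pairing_opV (hu : IsSmooth g u) (hw : IsSmooth g w) :
    pairing g o (opV g o u) w = -pairing g o u (opV g o w) := by
  have h := integralSM_opV o (hw.inner hu)
  rw [show opV g o (fun p => inner ℂ (w p) (u p)) = fun p => inner ℂ (opV g o w p) (u p) +
    inner ℂ (w p) (opV g o u p) from funext fun p => opV_bilin o (innerR n) hw hu p,
    integralSM_add o ((hw.opV o).inner hu) (hw.inner (hu.opV o))] at h
  exact eq_neg_of_add_eq_zero_right h

/-- The geodesic vector field is skew-adjoint under the Dirichlet condition. -/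
lemma pairing_opX (hu : IsSmooth g u) (hw : IsSmooth g w)
    (hu0 : ∀ p : SM g, p.1.1 ∈ (𝓡∂ 2).boundary M → u p = 0) :
    pairing g o (opX g u) w = -pairing g o u (opX g w) := by
  have h := integralSM_opX o (hw.inner hu) fun p hp => by rw [hu0 p hp, inner_zero_right]
  rw [show opX g (fun p => inner ℂ (w p) (u p)) = fun p => inner ℂ (opX g w p) (u p) +
    inner ℂ (w p) (opX g u p) from funext fun p => opX_bilin o (innerR n) hw hu p,
    integralSM_add o ((hw.opX o).inner hu) (hw.inner (hu.opX o))] at h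
  exact eq_neg_of_add_eq_zero_right h

end Pairing

/-- Vertical differentiation preserves the Dirichlet condition. -/
lemma opV_boundary {F : Type*} [NormedAddCommGroup F] [NormedSpace ℝ F] {u : SM g → F} {P : M → Prop}
    (h : ∀ p : SM g, P p.1.1 → u p = 0) (p : SM g) (hp : P p.1.1) : opV g o u p = 0 := by
  unfold opV
  have : (fun t : ℝ =>
    ext g u ⟨p.1.1, Real.cos t • p.1.2 + Real.sin t • rot g o p.1.1 p.1.2⟩) = fun _ => 0 := by
    funext t
    unfold ext
    split_ifs
    · exact h _ hp
    · rfl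
  rw [this, deriv_const]

/-! ### Commutators of the magnetic vector field -/

variable {u : SM g → EuclideanSpace ℂ (Fin n)} {lam : M → ℝ} (A : UnitaryConnection M n)
  (Φ : HiggsField M n)

/-- The connection evaluated on the rotated vector. -/
def rotConn (g : Metric M) (o : SurfaceOrientation M) (A : UnitaryConnection M n) (p : SM g) :
    Matrix (Fin n) (Fin n) ℂ :=
  A.form p.1.1 (rot g o p.1.1 p.1.2)

lemma rotConn_apply (i j : Fin n) : (fun p : SM g => rotConn g o A p i j) =
    opV g o (fun p => A.form p.1.1 p.1.2 i j) :=
  funext fun p => (opV_conn o A i j p).symm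

lemma isSmooth_rotConn (i j : Fin n) : IsSmooth g (fun p : SM g => rotConn g o A p i j) := by
  rw [rotConn_apply]
  exact (isSmooth_conn g o A i j).opV o

lemma isSmooth_higgs (g : Metric M) (Φ : HiggsField M n) (i j : Fin n) :
    IsSmooth g (fun p : SM g => Φ.mat p.1.1 i j) := isSmooth_base g (Φ.smooth i j)

lemma IsSmooth.lam_smul {F : Type*} [NormedAddCommGroup F] [NormedSpace ℝ F] {u : SM g → F}
    (hlam : ContMDiff (𝓡∂ 2) 𝓘(ℝ, ℝ) ∞ lam) (hu : IsSmooth g u) :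
    IsSmooth g (fun p => lam p.1.1 • u p) :=
  (isSmooth_base g hlam).bilin (ContinuousLinearMap.lsmul ℝ ℝ) hu

lemma opV_lam_smul (hlam : ContMDiff (𝓡∂ 2) 𝓘(ℝ, ℝ) ∞ lam) (hu : IsSmooth g u) (p : SM g) :
    opV g o (fun p => lam p.1.1 • u p) p = lam p.1.1 • opV g o u p := by
  have := opV_bilin o (ContinuousLinearMap.lsmul ℝ ℝ) (isSmooth_base g hlam) hu p
  rw [opV_base o hlam] at this
  simpa using this

lemma opXperp_lam_smul (hlam : ContMDiff (𝓡∂ 2) 𝓘(ℝ, ℝ) ∞ lam) (hu : IsSmooth g u) (p : SM g) :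
    opXperp g o (fun p => lam p.1.1 • u p) p =
      opXperp g o (fun p : SM g => lam p.1.1) p • u p + lam p.1.1 • opXperp g o u p :=
  opXperp_bilin o (ContinuousLinearMap.lsmul ℝ ℝ) (isSmooth_base g hlam) hu p

lemma IsSmooth.opHiggs (hu : IsSmooth g u) : IsSmooth g (opHiggs g Φ u) :=
  hu.mulMat (isSmooth_higgs g Φ)

lemma IsSmooth.connection (o : SurfaceOrientation M) (hu : IsSmooth g u) :
    IsSmooth g (MagneticSurface.mulMat g (fun q => A.form q.1.1 q.1.2) u) :=
  IsSmooth.mulMat (isSmooth_conn g o A) hu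

lemma IsSmooth.opMagnetic (hlam : ContMDiff (𝓡∂ 2) 𝓘(ℝ, ℝ) ∞ lam) (hu : IsSmooth g u) :
    IsSmooth g (opMagnetic g o lam A Φ u) :=
  (((hu.opX o).add ((hu.opV o).lam_smul hlam)).add (hu.connection A o)).add (hu.opHiggs Φ)

/-- The commutator `[X + λV + A + Φ, V] = X_⊥ - VA`. -/
def opComm (g : Metric M) (o : SurfaceOrientation M) (A : UnitaryConnection M n)
    (u : SM g → EuclideanSpace ℂ (Fin n)) (p : SM g) : EuclideanSpace ℂ (Fin n) :=
  opXperp g o u p - matVec (rotConn g o A p) (u p)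

lemma IsSmooth.opComm (hu : IsSmooth g u) : IsSmooth g (opComm g o A u) :=
  (hu.opXperp o).sub (IsSmooth.mulMat (isSmooth_rotConn o A) hu)

lemma of_opV_conn (p : SM g) :
    (Matrix.of fun i j => opV g o (fun q => A.form q.1.1 q.1.2 i j) p) = rotConn g o A p := by
  ext i j
  exact opV_conn o A i j p

lemma of_opV_rotConn (p : SM g) :
    (Matrix.of fun i j => opV g o (fun q => rotConn g o A q i j) p) = -A.form p.1.1 p.1.2 := by
  ext i j
  rw [Matrix.of_apply, rotConn_apply, opV_opV_conn]
  rfl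

lemma of_opV_higgs (p : SM g) :
    (Matrix.of fun i j => opV g o (fun q => Φ.mat q.1.1 i j) p) = 0 := by
  ext i j
  exact opV_base o (Φ.smooth i j) p

lemma of_starCurvature (p : SM g) :
    (Matrix.of fun i j => opXperp g o (fun q => A.form q.1.1 q.1.2 i j) p)
      + (Matrix.of fun i j => opX g (fun q => rotConn g o A q i j) p) =
    starCurvature g o A p.1.1 - (A.form p.1.1 p.1.2 * rotConn g o A p
      - rotConn g o A p * A.form p.1.1 p.1.2) := by
  ext i j
  rw [Matrix.add_apply, Matrix.of_apply, Matrix.of_apply, Matrix.sub_apply, starCurvature_eq o A i j p,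
    rotConn_apply]
  unfold rotConn
  abel

/-- X_⊥Φ is v ↦ −dΦ(iv), the part of ⋆d_AΦ without the bracket; the commutator term restores −[A,
Φ](iv). -/
lemma of_opXperp_higgs (p : SM g) :
    (Matrix.of fun i j => opXperp g o (fun q => Φ.mat q.1.1 i j) p) =
      starCovDerivHiggs g o A Φ p
        + (rotConn g o A p * Φ.mat p.1.1 - Φ.mat p.1.1 * rotConn g o A p) := by
  ext i j
  rw [Matrix.of_apply, opXperp_base o (Φ.smooth i j) p]
  simp only [starCovDerivHiggs, covDerivHiggs, Matrix.add_apply, Matrix.neg_apply,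
    rotConn]
  abel

lemma mulMat_apply (B : SM g → Matrix (Fin n) (Fin n) ℂ) (p : SM g) :
    mulMat g B u p = matVec (B p) (u p) := rfl

lemma opV_opMagnetic (hlam : ContMDiff (𝓡∂ 2) 𝓘(ℝ, ℝ) ∞ lam) (hu : IsSmooth g u) (p : SM g) :
    opV g o (opMagnetic g o lam A Φ u) p = opV g o (opX g u) p
      + lam p.1.1 • opV g o (opV g o u) p
      + (matVec (rotConn g o A p) (u p) + matVec (A.form p.1.1 p.1.2) (opV g o u p))
      + matVec (Φ.mat p.1.1) (opV g o u p) := by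
  have h1 := hu.opX o
  have h2 := (hu.opV o).lam_smul hlam
  have h3 := hu.connection A o
  have h4 := hu.opHiggs Φ
  refine (opV_add o ((h1.add h2).add h3) h4 p).trans ?_
  rw [opV_add o (h1.add h2) h3, opV_add o h1 h2, opV_lam_smul o hlam (hu.opV o),
    opV_mulMat o (isSmooth_conn g o A) hu, of_opV_conn]
  congr 1
  refine (opV_mulMat o (isSmooth_higgs g Φ) hu p).trans ?_
  rw [of_opV_higgs, zero_matVec, zero_add]

/-- λ and Φ are constant on the fibres, so only X and A fail to commute with V. -/
lemma opMagnetic_opV_sub (hlam : ContMDiff (𝓡∂ 2) 𝓘(ℝ, ℝ) ∞ lam) (hu : IsSmooth g u) (p : SM g) :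
    opMagnetic g o lam A Φ (opV g o u) p - opV g o (opMagnetic g o lam A Φ u) p =
      opComm g o A u p := by
  rw [opV_opMagnetic o A Φ hlam hu]
  simp only [opMagnetic, opComm, opHiggs, mulMat_apply, opXperp]
  abel

/-- `[V, X_⊥ - VA] = X + A`. -/
lemma opV_opComm_sub (hu : IsSmooth g u) (p : SM g) :
    opV g o (opComm g o A u) p - opComm g o A (opV g o u) p =
      opX g u p + matVec (A.form p.1.1 p.1.2) (u p) := by
  have h1 := hu.opXperp o
  have h2 : IsSmooth g (mulMat g (rotConn g o A) u) := IsSmooth.mulMat (isSmooth_rotConn o A) hu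
  have h3 : opV g o (opComm g o A u) p =
      opV g o (opXperp g o u) p + opV g o (fun q => -mulMat g (rotConn g o A) u q) p := by
    rw [← opV_add o h1 h2.neg]
    congr 1
  have h4 := opV_clm o (-ContinuousLinearMap.id ℝ _) h2 p
  simp only [neg_apply, ContinuousLinearMap.id_apply] at h4
  rw [h3, h4, opV_mulMat o (isSmooth_rotConn o A) hu, of_opV_rotConn, neg_matVec,
    ← opV_opXperp o hu, opComm]
  abel

lemma opMagnetic_sub {w : SM g → EuclideanSpace ℂ (Fin n)}
    (hu : IsSmooth g u) (hw : IsSmooth g w) (p : SM g) :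
    opMagnetic g o lam A Φ (fun q => u q - w q) p =
      opMagnetic g o lam A Φ u p - opMagnetic g o lam A Φ w p := by
  have e : (fun q => u q - w q) = fun q => u q + -w q := funext fun q => sub_eq_add_neg _ _
  have hX := opX_clm o (-ContinuousLinearMap.id ℝ _) hw p
  have hV := opV_clm o (-ContinuousLinearMap.id ℝ _) hw p
  simp only [neg_apply, ContinuousLinearMap.id_apply] at hX hV
  simp only [opMagnetic, opHiggs, mulMat_apply, matVec_sub]
  rw [e, opX_add o hu hw.neg, opV_add o hu hw.neg, hX, hV]
  module

/-- The commutator of `X_⊥ - VA` with the magnetic vector field. -/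
lemma opComm_opMagnetic_sub (hlam : ContMDiff (𝓡∂ 2) 𝓘(ℝ, ℝ) ∞ lam) (hu : IsSmooth g u)
    (p : SM g) :
    opComm g o A (opMagnetic g o lam A Φ u) p - opMagnetic g o lam A Φ (opComm g o A u) p =
      (gaussCurv g p.1.1 + opXperp g o (fun q : SM g => lam q.1.1) p) • opV g o u p
        - lam p.1.1 • (opX g u p + matVec (A.form p.1.1 p.1.2) (u p))
        + matVec (starCurvature g o A p.1.1) (u p)
        + matVec (starCovDerivHiggs g o A Φ p) (u p) := by
  have h1 := hu.opX o
  have h2 := (hu.opV o).lam_smul hlam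
  have h3 := hu.connection A o
  have h4 := hu.opHiggs Φ
  have h5 := hu.opXperp o
  have h6 : IsSmooth g (mulMat g (rotConn g o A) u) := IsSmooth.mulMat (isSmooth_rotConn o A) hu
  have e1 : opXperp g o (opMagnetic g o lam A Φ u) p =
      opXperp g o (opX g u) p + (opXperp g o (fun q : SM g => lam q.1.1) p • opV g o u p
        + lam p.1.1 • opXperp g o (opV g o u) p)
      + (matVec (Matrix.of fun i j => opXperp g o (fun q => A.form q.1.1 q.1.2 i j) p) (u p)
        + matVec (A.form p.1.1 p.1.2) (opXperp g o u p))
      + (matVec (Matrix.of fun i j => opXperp g o (fun q => Φ.mat q.1.1 i j) p) (u p)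
        + matVec (Φ.mat p.1.1) (opXperp g o u p)) := by
    refine (opXperp_add o ((h1.add h2).add h3) h4 p).trans ?_
    rw [opXperp_add o (h1.add h2) h3, opXperp_add o h1 h2, opXperp_lam_smul o hlam (hu.opV o),
      opXperp_mulMat o (isSmooth_conn g o A) hu]
    congr 1
    exact opXperp_mulMat o (isSmooth_higgs g Φ) hu p
  have e2 : opMagnetic g o lam A Φ (opComm g o A u) p =
      opMagnetic g o lam A Φ (opXperp g o u) p
        - opMagnetic g o lam A Φ (mulMat g (rotConn g o A) u) p :=
    opMagnetic_sub o A Φ h5 h6 p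
  have hF := congrArg (fun B => matVec B (u p)) (of_starCurvature o A p)
  have hK := opX_opXperp o hu p
  have hVX := opV_opXperp o hu p
  simp only [add_matVec, sub_matVec, mul_matVec] at hF
  rw [opComm, e1, e2, of_opXperp_higgs o A Φ]
  simp only [opMagnetic, opHiggs, mulMat_apply]
  rw [opX_mulMat o (isSmooth_rotConn o A) hu, opV_mulMat o (isSmooth_rotConn o A) hu,
    of_opV_rotConn]
  simp only [add_matVec, sub_matVec, mul_matVec, neg_matVec, matVec_add, matVec_smul]
  -- The three structure equations enter here. The term −λ(X + A) comes from the commutator with λV,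
  -- through [V, X_⊥] = X and V(VA) = −A.
  have hF' := eq_sub_of_add_eq hF
  have hK' := eq_add_of_sub_eq hK
  have hVX' := eq_add_of_sub_eq hVX
  rw [hF', hK', hVX']
  module

end Coordinates

section Coordinates

set_option linter.unusedSectionVars false

open MeasureTheory

variable {M : Type*} [TopologicalSpace M] [ChartedSpace (EuclideanHalfSpace 2) M]
  [IsManifold (𝓡∂ 2) ∞ M] {n : ℕ}
  {g : Metric M} (o : SurfaceOrientation M)
  {u w u' w' : SM g → EuclideanSpace ℂ (Fin n)} {lam : M → ℝ} (A : UnitaryConnection M n)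
  (Φ : HiggsField M n)

/-! ### Regularity and symmetry of the curvature terms -/

/-- `gaussCurv` is defined at each point in that point's own chart, so its regularity is not visible
from the formula. It is read off from the bracket −[X, X_⊥], whose smoothness is known; ⋆F_A and
⋆d_AΦ are treated below in the same way through their structure equations. -/
lemma IsSmooth.gaussCurv_opV (hu : IsSmooth g u) :
    IsSmooth g (fun p => gaussCurv g p.1.1 • MagneticSurface.opV g o u p) := by
  have h := (((hu.opXperp o).opX o).sub ((hu.opX o).opXperp o)).neg
  refine cast (congrArg _ (funext fun p => ?_)) h
  rw [opX_opXperp o hu p, neg_neg]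

lemma isSmooth_matrix_mul {B C : SM g → Matrix (Fin n) (Fin n) ℂ}
    (hB : ∀ i j, IsSmooth g fun p => B p i j) (hC : ∀ i j, IsSmooth g fun p => C p i j)
    (i j : Fin n) : IsSmooth g fun p => (B p * C p) i j := by
  simp only [Matrix.mul_apply]
  exact IsSmooth.sum _ fun k => (hB i k).bilin (ContinuousLinearMap.mul ℝ ℂ) (hC k j)

lemma isSmooth_starCurvature (g : Metric M) (o : SurfaceOrientation M) (A : UnitaryConnection M n)
    (i j : Fin n) : IsSmooth g fun p => starCurvature g o A p.1.1 i j := by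
  have hA := isSmooth_conn g o A
  have hR := isSmooth_rotConn (g := g) o A
  refine cast (congrArg _ (funext fun p => (starCurvature_eq o A i j p).symm))
    ((((hA i j).opXperp o).add (((hA i j).opV o).opX o)).add
      ((isSmooth_matrix_mul hA hR i j).sub (isSmooth_matrix_mul hR hA i j)))

lemma isSmooth_starCovDerivHiggs (i j : Fin n) :
    IsSmooth g fun p => starCovDerivHiggs g o A Φ p i j := by
  have hR := isSmooth_rotConn (g := g) o A
  have hΦ := isSmooth_higgs g Φ
  refine cast (congrArg _ (funext fun p => ?_)) (((hΦ i j).opXperp o).sub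
    ((isSmooth_matrix_mul hR hΦ i j).sub (isSmooth_matrix_mul hΦ hR i j)))
  have := congrArg (fun B => B i j) (of_opXperp_higgs o A Φ p)
  simp only [Matrix.of_apply, Matrix.add_apply, Matrix.sub_apply] at this
  exact sub_eq_of_eq_add this

/-- In the structure equation for ⋆F_A the operators X and X_⊥ commute with complex conjugation, and
the commutator of two skew-Hermitian matrices is skew-Hermitian. -/
lemma conjTranspose_starCurvature (p : SM g) :
    (starCurvature g o A p.1.1).conjTranspose = -starCurvature g o A p.1.1 := by
  have hA := isSmooth_conn g o A
  have hskew : ∀ (x : M) (v : TangentSpace (𝓡∂ 2) x) (i j : Fin n),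
      Complex.conjCLE (A.form x v j i) = -ContinuousLinearMap.id ℝ ℂ (A.form x v i j) :=
    fun x v i j => congrArg (fun B => B i j) (A.skew x v)
  have h1 : (Matrix.of fun i j => opXperp g o (fun q => A.form q.1.1 q.1.2 i j) p).conjTranspose =
      -Matrix.of fun i j => opXperp g o (fun q => A.form q.1.1 q.1.2 i j) p := by
    ext i j
    refine (opXperp_clm o (Complex.conjCLE : ℂ →L[ℝ] ℂ) (hA j i) p).symm.trans ?_
    refine Eq.trans ?_ (opXperp_clm o (-ContinuousLinearMap.id ℝ ℂ) (hA i j) p)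
    congr 1
    funext q
    exact hskew _ _ i j
  have h2 : (Matrix.of fun i j => opX g (fun q => rotConn g o A q i j) p).conjTranspose =
      -Matrix.of fun i j => opX g (fun q => rotConn g o A q i j) p := by
    ext i j
    refine (opX_clm o (Complex.conjCLE : ℂ →L[ℝ] ℂ) (isSmooth_rotConn o A j i) p).symm.trans ?_
    refine Eq.trans ?_ (opX_clm o (-ContinuousLinearMap.id ℝ ℂ) (isSmooth_rotConn o A i j) p)
    congr 1
    funext q
    exact hskew _ _ i j
  have h3 := eq_add_of_sub_eq (of_starCurvature o A p).symm
  have h4 : (rotConn g o A p).conjTranspose = -rotConn g o A p := A.skew _ _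
  rw [h3]
  simp only [Matrix.conjTranspose_add, Matrix.conjTranspose_sub, Matrix.conjTranspose_mul, h1, h2,
    A.skew, h4, neg_mul_neg]
  abel

/-- ⋆F_A comes from the base, so only `u` is differentiated. -/
lemma opV_starCurvature (hu : IsSmooth g u) (p : SM g) :
    opV g o (mulMat g (fun q => starCurvature g o A q.1.1) u) p =
      matVec (starCurvature g o A p.1.1) (opV g o u p) := by
  rw [opV_mulMat o (isSmooth_starCurvature g o A) hu]
  have h : (Matrix.of fun i j => opV g o (fun q => starCurvature g o A q.1.1 i j) p) = 0 := by
    ext i j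
    have hf := isSmooth_starCurvature g o A i j
    -- Smoothness of ⋆F_A is known on SM rather than on `M`, so `opV_base` does not apply directly.
    -- Subtracting its value at the given base point leaves a function that is zero on that fibre,
    -- and `opV_boundary` finishes with "lies in this fibre" as the predicate.
    have hc : IsSmooth g fun _ => starCurvature g o A p.1.1 i j :=
      isSmooth_base g (f := fun _ => starCurvature g o A p.1.1 i j) contMDiff_const
    have h1 := opV_add o (hf.sub hc) hc p
    simp only [sub_add_cancel] at h1
    rw [Matrix.of_apply, Matrix.zero_apply, h1,
      opV_base o (f := fun _ => starCurvature g o A p.1.1 i j) contMDiff_const, add_zero]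
    exact opV_boundary o (P := fun x => x = p.1.1) (fun q hq => by rw [hq, sub_self]) p rfl
  rw [h, zero_matVec, zero_add]

/-! ### Adjoints -/

variable [MeasurableSpace M]

lemma pairing_smul (c : SM g → ℝ) :
    pairing g o (fun p => c p • u p) w = pairing g o u (fun p => c p • w p) :=
  pairing_congr o fun p => by
    rw [← Complex.coe_smul, ← Complex.coe_smul, inner_smul_left, inner_smul_right, Complex.conj_ofReal]

variable [T2Space M] [CompactSpace M] [BorelSpace M]

lemma pairing_neg_right (hu : IsSmooth g u) (hw : IsSmooth g w) :
    pairing g o u (fun p => -w p) = -pairing g o u w := by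
  have h := pairing_add_right o hu hw hw.neg
  have h0 : pairing g o u (fun p => w p + -w p) = 0 := by
    unfold pairing
    simp only [add_neg_cancel, inner_zero_left]
    exact integralSM_zero g o
  rw [h0] at h
  exact eq_neg_of_add_eq_zero_right h.symm

lemma pairing_sub_left (hu : IsSmooth g u) (hu' : IsSmooth g u') (hw : IsSmooth g w) :
    pairing g o (fun p => u p - u' p) w = pairing g o u w - pairing g o u' w := by
  have h := pairing_add_left o (hu.sub hu') hu' hw
  simp only [sub_add_cancel] at h
  exact eq_sub_of_add_eq h.symm

lemma pairing_sub_right (hu : IsSmooth g u) (hw : IsSmooth g w) (hw' : IsSmooth g w') :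
    pairing g o u (fun p => w p - w' p) = pairing g o u w - pairing g o u w' := by
  have h := pairing_add_right o hu (hw.sub hw') hw'
  simp only [sub_add_cancel] at h
  exact eq_sub_of_add_eq h.symm

lemma pairing_mulMat {B : SM g → Matrix (Fin n) (Fin n) ℂ} (hskew : ∀ p, (B p).conjTranspose = -B p)
    (hB : ∀ i j, IsSmooth g fun p => B p i j) (hu : IsSmooth g u) (hw : IsSmooth g w) :
    pairing g o (mulMat g B u) w = -pairing g o u (mulMat g B w) := by
  rw [← pairing_neg_right o hu (hw.mulMat hB)]
  refine pairing_congr o fun p => ?_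
  rw [mulMat_apply, mulMat_apply, inner_matVec, hskew, neg_matVec]

lemma pairing_opMagnetic (hlam : ContMDiff (𝓡∂ 2) 𝓘(ℝ, ℝ) ∞ lam) (hu : IsSmooth g u)
    (hw : IsSmooth g w) (hu0 : ∀ p : SM g, p.1.1 ∈ (𝓡∂ 2).boundary M → u p = 0) :
    pairing g o (opMagnetic g o lam A Φ u) w = -pairing g o u (opMagnetic g o lam A Φ w) := by
  have h1 := hu.opX o
  have h2 := (hu.opV o).lam_smul hlam
  have h3 := hu.connection A o
  have k1 := hw.opX o
  have k2 := (hw.opV o).lam_smul hlam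
  have k3 := hw.connection A o
  have hV : pairing g o (fun p => lam p.1.1 • opV g o u p) w =
      -pairing g o u (fun p => lam p.1.1 • opV g o w p) := by
    rw [pairing_smul o (fun p : SM g => lam p.1.1), pairing_opV o hu (hw.lam_smul hlam)]
    congr 2
    exact funext fun p => opV_lam_smul o hlam hw p
  refine (pairing_add_left o ((h1.add h2).add h3) (hu.opHiggs Φ) hw).trans ?_
  refine Eq.trans ?_ (congrArg _
    (pairing_add_right o hu ((k1.add k2).add k3) (hw.opHiggs Φ)).symm)
  rw [pairing_add_left o (h1.add h2) h3 hw, pairing_add_left o h1 h2 hw,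
    pairing_add_right o hu (k1.add k2) k3, pairing_add_right o hu k1 k2,
    pairing_opX o hu hw hu0, hV,
    pairing_mulMat o (fun p => A.skew _ _) (isSmooth_conn g o A) hu hw]
  have hΦ : pairing g o (opHiggs g Φ u) w = -pairing g o u (opHiggs g Φ w) :=
    pairing_mulMat o (fun p => Φ.skew _) (isSmooth_higgs g Φ) hu hw
  rw [hΦ]
  ring

/-- A commutator of skew-adjoint operators is skew-adjoint, so no separate integration by parts
along X_⊥ is needed. `Φ` and `lam` serve only to write H as the commutator of P and V; they do not
appear in H. -/
lemma pairing_opComm (Φ : HiggsField M n) (hlam : ContMDiff (𝓡∂ 2) 𝓘(ℝ, ℝ) ∞ lam) (hu : IsSmooth g u)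
    (hw : IsSmooth g w) (hu0 : ∀ p : SM g, p.1.1 ∈ (𝓡∂ 2).boundary M → u p = 0) :
    pairing g o (opComm g o A u) w = -pairing g o u (opComm g o A w) := by
  have e : ∀ {f : SM g → EuclideanSpace ℂ (Fin n)}, IsSmooth g f → opComm g o A f =
      fun p => opMagnetic g o lam A Φ (opV g o f) p - opV g o (opMagnetic g o lam A Φ f) p :=
    fun hf => funext fun p => (opMagnetic_opV_sub o A Φ hlam hf p).symm
  have hm := fun {f : SM g → EuclideanSpace ℂ (Fin n)} (hf : IsSmooth g f) =>
    hf.opMagnetic o A Φ hlam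
  rw [e hu, e hw, pairing_sub_left o (hm (hu.opV o)) ((hm hu).opV o) hw,
    pairing_sub_right o hu (hm (hw.opV o)) ((hm hw).opV o),
    pairing_opMagnetic o A Φ hlam (hu.opV o) hw (opV_boundary o hu0),
    pairing_opV o (hm hu) hw, pairing_opMagnetic o A Φ hlam hu (hw.opV o) hu0,
    pairing_opV o hu (hm hw)]
  ring

/-- The operators ⋆F_A and V are both skew-adjoint and commute, so their pairing is real. This is
why the term needs no real part in the theorem. -/
lemma pairing_starCurvature_conj (hu : IsSmooth g u) :
    starRingEnd ℂ (pairing g o (mulMat g (fun p => starCurvature g o A p.1.1) u) (opV g o u)) =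
      pairing g o (mulMat g (fun p => starCurvature g o A p.1.1) u) (opV g o u) := by
  have hF := isSmooth_starCurvature g o A
  have hFu : IsSmooth g (mulMat g (fun p => starCurvature g o A p.1.1) u) := hu.mulMat hF
  rw [← pairing_conj, pairing_opV o hu hFu,
    pairing_mulMat o (conjTranspose_starCurvature o A) hF hu (hu.opV o)]
  congr 2
  exact funext fun p => opV_starCurvature o A hu p

/-- The energy identity before taking real parts. -/
lemma energy_identity (hlam : ContMDiff (𝓡∂ 2) 𝓘(ℝ, ℝ) ∞ lam) (hu : IsSmooth g u)
    (hu0 : ∀ p : SM g, p.1.1 ∈ (𝓡∂ 2).boundary M → u p = 0) :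
    pairing g o (opMagnetic g o lam A Φ (opV g o u)) (opMagnetic g o lam A Φ (opV g o u))
      - pairing g o (opV g o (opMagnetic g o lam A Φ u)) (opV g o (opMagnetic g o lam A Φ u))
      + pairing g o (opMagnetic g o lam A Φ u) (opMagnetic g o lam A Φ u) =
    pairing g o (opV g o u) (fun p => magneticCurv g o lam p • opV g o u p)
      + pairing g o (opV g o u) (mulMat g (fun p => starCurvature g o A p.1.1) u)
      + pairing g o (opV g o u) (mulMat g (starCovDerivHiggs g o A Φ) u)
      + (pairing g o (fun p => lam p.1.1 • opV g o u p) (opHiggs g Φ u)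
        + pairing g o (opHiggs g Φ u) (fun p => lam p.1.1 • opV g o u p))
      + pairing g o (opHiggs g Φ u) (opAttenuated g A Φ u) := by
  have hW := hu.opV o
  have hQ := hu.opMagnetic o A Φ hlam
  have hH := hu.opComm o A
  have hPW := hW.opMagnetic o A Φ hlam
  have hVQ := hQ.opV o
  have hY := (hu.opX o).add (hu.connection A o)
  have hΦu := hu.opHiggs Φ
  have hlW := hW.lam_smul hlam
  have hK : IsSmooth g (fun p : SM g =>
      (gaussCurv g p.1.1 + opXperp g o (fun q : SM g => lam q.1.1) p) • opV g o u p) := by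
    refine cast (congrArg _ (funext fun p => (add_smul _ _ _).symm)) ((hu.gaussCurv_opV o).add
      (((isSmooth_base g hlam).opXperp o).bilin (ContinuousLinearMap.lsmul ℝ ℝ) hW))
  have hFu : IsSmooth g (mulMat g (fun p => starCurvature g o A p.1.1) u) :=
    hu.mulMat (isSmooth_starCurvature g o A)
  have hDu : IsSmooth g (mulMat g (starCovDerivHiggs g o A Φ) u) :=
    hu.mulMat (isSmooth_starCovDerivHiggs o A Φ)
  set W := opV g o u with hWdef
  set Q := opMagnetic g o lam A Φ u with hQdef
  set H := opComm g o A u with hHdef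
  set Y : SM g → EuclideanSpace ℂ (Fin n) :=
    fun p => opX g u p + mulMat g (fun q => A.form q.1.1 q.1.2) u p with hYdef
  set Fu := mulMat g (fun p => starCurvature g o A p.1.1) u with hFdef
  set Du := mulMat g (starCovDerivHiggs g o A Φ) u with hDdef
  have hlY := hY.lam_smul hlam
  have hW0 := opV_boundary o hu0
  -- In what follows W = Vu, Q = Pu, H stands for Hu and Y = (X + A)u. The relations `e1`, `e2`,
  -- `e3` are the commutators [P, V], [V, H] and [H, P] applied to `u`.
  have e1 : opMagnetic g o lam A Φ W = fun p => opV g o Q p + H p :=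
    funext fun p => eq_add_of_sub_eq' (opMagnetic_opV_sub o A Φ hlam hu p)
  have e2 : opV g o H = fun p => opComm g o A W p + Y p :=
    funext fun p => eq_add_of_sub_eq' (opV_opComm_sub o A hu p)
  have e3 : opComm g o A Q = fun p => opMagnetic g o lam A Φ H p +
      ((gaussCurv g p.1.1 + opXperp g o (fun q : SM g => lam q.1.1) p) • W p
        - lam p.1.1 • Y p + Fu p + Du p) :=
    funext fun p => eq_add_of_sub_eq' (opComm_opMagnetic_sub o A Φ hlam hu p)
  have e4 : Q = fun p => (Y p + lam p.1.1 • W p) + opHiggs g Φ u p :=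
    funext fun p => congrArg (· + opHiggs g Φ u p) (add_right_comm _ _ _)
  -- No boundary terms arise: in `t1` and `t2` the factor Vu vanishes over ∂M together with `u`, and
  -- in `t3` only V is moved.
  have t1 := pairing_opMagnetic o A Φ hlam hW hH hW0
  have t2 := pairing_opComm o A Φ hlam hW hQ hW0
  have t3 := pairing_opV o hH hQ
  have t4 : pairing g o (opMagnetic g o lam A Φ W) (opMagnetic g o lam A Φ W) =
      pairing g o (opMagnetic g o lam A Φ W) (opV g o Q)
        + pairing g o (opMagnetic g o lam A Φ W) H := by
    rw [← pairing_add_right o hPW hVQ hH, ← e1]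
  have t5 : pairing g o (opMagnetic g o lam A Φ W) (opV g o Q) =
      pairing g o (opV g o Q) (opV g o Q) + pairing g o H (opV g o Q) := by
    rw [e1, pairing_add_left o hVQ hH hVQ]
  rw [e2, pairing_add_left o (hW.opComm o A) hY hQ] at t3
  have t6 : pairing g o W (opComm g o A Q) = pairing g o W (opMagnetic g o lam A Φ H)
      + (pairing g o W (fun p =>
          (gaussCurv g p.1.1 + opXperp g o (fun q : SM g => lam q.1.1) p) • W p)
        - pairing g o W (fun p => lam p.1.1 • Y p) + pairing g o W Fu + pairing g o W Du) := by
    rw [e3, pairing_add_right o hW (hH.opMagnetic o A Φ hlam) (((hK.sub hlY).add hFu).add hDu),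
      pairing_add_right o hW ((hK.sub hlY).add hFu) hDu, pairing_add_right o hW (hK.sub hlY) hFu,
      pairing_sub_right o hW hK hlY]
  have t7 : pairing g o Q Q = pairing g o Y Q + pairing g o (fun p => lam p.1.1 • W p) Q
      + pairing g o (opHiggs g Φ u) Q := by
    rw [← pairing_add_left o hY hlW hQ, ← pairing_add_left o (hY.add hlW) hΦu hQ, ← e4]
  have t8 : ∀ {f : SM g → EuclideanSpace ℂ (Fin n)}, IsSmooth g f → pairing g o f Q =
      pairing g o f Y + pairing g o f (fun p => lam p.1.1 • W p)
        + pairing g o f (opHiggs g Φ u) := fun hf => by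
    rw [← pairing_add_right o hf hY hlW, ← pairing_add_right o hf (hY.add hlW) hΦu, ← e4]
  -- The λ² in the curvature term comes not from a commutator but from the product of λVu with
  -- itself inside |Pu|².
  have t9 : pairing g o W (fun p => magneticCurv g o lam p • W p) =
      pairing g o W (fun p =>
          (gaussCurv g p.1.1 + opXperp g o (fun q : SM g => lam q.1.1) p) • W p)
        + pairing g o (fun p => lam p.1.1 • W p) (fun p => lam p.1.1 • W p) := by
    rw [pairing_smul o (fun p : SM g => lam p.1.1),
      ← pairing_add_right o hW hK (hlW.lam_smul hlam)]
    congr 1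
    funext p
    rw [smul_smul, ← add_smul, ← sq]
    rfl
  have t10 : pairing g o (opHiggs g Φ u) (opAttenuated g A Φ u) =
      pairing g o (opHiggs g Φ u) Y + pairing g o (opHiggs g Φ u) (opHiggs g Φ u) :=
    pairing_add_right o hΦu hY hΦu
  have t11 : pairing g o (fun p => lam p.1.1 • W p) Y = pairing g o W (fun p => lam p.1.1 • Y p) :=
    pairing_smul o (fun p : SM g => lam p.1.1)
  rw [t8 hlW, t8 hΦu] at t7
  -- Here ⟨Vu, λY⟩ from [H, P] cancels ⟨λVu, Y⟩ from |Pu|² by `t11`, and ⟨Y, Pu⟩ from `t3` cancels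
  -- the same term in `t7`.
  linear_combination t4 + t1 + t5 + t3 - t2 + t6 + t7 - t9 - t10 + t11

end Coordinates

end MagneticSurface

end

/-- `energy_identity` is an equality of complex numbers, of which the real part is taken. The
squared norms, the curvature term and the ⋆F_A term are already real and stay as they are. The two λ
terms are conjugate to each other and add up to twice a real part. -/
theorem mainTheorem6
    {M : Type*} [TopologicalSpace M] [T2Space M] [CompactSpace M]
    [ChartedSpace (EuclideanHalfSpace 2) M] [IsManifold (𝓡∂ 2) ∞ M]
    [MeasurableSpace M] [BorelSpace M]
    (g : MagneticSurface.Metric M) (o : MagneticSurface.SurfaceOrientation M)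
    (lam : M → ℝ) (hlam : ContMDiff (𝓡∂ 2) 𝓘(ℝ, ℝ) ∞ lam)
    {n : ℕ} (A : MagneticSurface.UnitaryConnection M n) (Φ : MagneticSurface.HiggsField M n)
    (u : MagneticSurface.SM g → EuclideanSpace ℂ (Fin n))
    (hu : MagneticSurface.IsSmooth g u)
    (hu0 : ∀ p : MagneticSurface.SM g, p.1.1 ∈ (𝓡∂ 2).boundary M → u p = 0) :
    (MagneticSurface.normSq g o
        (MagneticSurface.opMagnetic g o lam A Φ (MagneticSurface.opV g o u)) : ℂ)
      - MagneticSurface.pairing g o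
          (MagneticSurface.mulMat g (fun p => MagneticSurface.starCurvature g o A p.1.1) u)
          (MagneticSurface.opV g o u)
      - ((MagneticSurface.pairing g o
          (MagneticSurface.mulMat g (MagneticSurface.starCovDerivHiggs g o A Φ) u)
          (MagneticSurface.opV g o u)).re : ℂ)
      - 2 * ((MagneticSurface.pairing g o
          (fun p => lam p.1.1 • MagneticSurface.opV g o u p)
          (MagneticSurface.opHiggs g Φ u)).re : ℂ)
      - ((MagneticSurface.pairing g o
          (MagneticSurface.opHiggs g Φ u)
          (MagneticSurface.opAttenuated g A Φ u)).re : ℂ)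
      - MagneticSurface.pairing g o
          (fun p => MagneticSurface.magneticCurv g o lam p • MagneticSurface.opV g o u p)
          (MagneticSurface.opV g o u)
    = (MagneticSurface.normSq g o
          (MagneticSurface.opV g o (MagneticSurface.opMagnetic g o lam A Φ u)) : ℂ)
      - (MagneticSurface.normSq g o (MagneticSurface.opMagnetic g o lam A Φ u) : ℂ) := by
  have h := MagneticSurface.energy_identity o A Φ hlam hu hu0
  rw [MagneticSurface.normSq_eq, MagneticSurface.normSq_eq, MagneticSurface.normSq_eq]
  have hF := MagneticSurface.pairing_starCurvature_conj o A hu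
  have hcurv : starRingEnd ℂ (MagneticSurface.pairing g o (fun p => MagneticSurface.magneticCurv g o lam p • MagneticSurface.opV g o u p)
      (MagneticSurface.opV g o u)) = MagneticSurface.pairing g o (fun p => MagneticSurface.magneticCurv g o lam p • MagneticSurface.opV g o u p) (MagneticSurface.opV g o u) := by
    rw [← MagneticSurface.pairing_conj, MagneticSurface.pairing_smul o (MagneticSurface.magneticCurv g o lam)]
  rw [MagneticSurface.pairing_conj o (fun p => MagneticSurface.magneticCurv g o lam p • MagneticSurface.opV g o u p) (MagneticSurface.opV g o u), hcurv,
    MagneticSurface.pairing_conj o (MagneticSurface.mulMat g (fun p => MagneticSurface.starCurvature g o A p.1.1) u) (MagneticSurface.opV g o u), hF,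
    MagneticSurface.pairing_conj o (MagneticSurface.mulMat g (MagneticSurface.starCovDerivHiggs g o A Φ) u) (MagneticSurface.opV g o u),
    MagneticSurface.pairing_conj o (fun p => lam p.1.1 • MagneticSurface.opV g o u p) (MagneticSurface.opHiggs g Φ u), Complex.add_conj] at h
  have hre := congrArg Complex.re h
  rw [← MagneticSurface.normSq_eq, ← MagneticSurface.normSq_eq, ← MagneticSurface.normSq_eq] at hre ⊢
  rw [Complex.conj_eq_iff_re.1 hF |>.symm, Complex.conj_eq_iff_re.1 hcurv |>.symm]
  simp only [Complex.add_re, Complex.sub_re, Complex.ofReal_re, Complex.conj_re] at hre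
  norm_cast
  linear_combination hre
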